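/- Let $X_m(k)$ ($m\ge 0$, $k\ge 1$) be independent random variables on a probability space with $P(X_m(k)=1)=P(X_m(k)=-1)=\tfrac12$, and let $S_m(n)=\sum_{k=1}^n X_m(k)$. For $m\ge1$ put $T_m(0)=0$ and $T_m(k+1)=\min\{n>T_m(k): |S_m(n)-S_m(T_m(k))|=2\}$. Define the twisted walks $\tilde S_m(n)=\sum_{k=1}^n\tilde X_m(k)$ by $\tilde X_0=X_0$ and, for $m\ge1$ and $T_m(k)<n\le T_m(k+1)$, $\tilde X_m(n)=X_m(n)$ if $S_m(T_m(k+1))-S_m(T_m(k))=2\tilde X_{m-1}(k+1)$ and $\tilde X_m(n)=-X_m(n)$ otherwise. Let $\tilde B_m(t)=2^{-m}\tilde S_m(t2^{2m})$ for $t\ge 0$ ($\tilde S_m$ being interpolated linearly). For $k\in\mathbb N_0$, $x\in\mathbb Z$ let $\ell_m(k,x)=\#\{0\le j<k:\tilde S_m(j)=x\}$ and $\ell_m^{\pm}(k,x)=\#\{0\le j<k:\tilde S_m(j)=x,\ \tilde S_m(j+1)=x\pm1\}$. At the grid points $(t,x)\in 2^{-2m}\mathbb N_0\times 2^{-m}\mathbb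 Z$ let $\mathcal L_m(t,x)=2^{-m}\ell_m(t2^{2m},x2^m)$, and extend $\mathcal L_m$ to $[0,\infty)\times\mathbb R$ by cutting each grid cell into two triangles by its diagonal through the lower left corner $(t_k,x_j)$ and interpolating affinely on each triangle. Define the up and down local times $\mathcal L_m^{+}$ and $\mathcal L_m^{-}$ in the same way from $\ell_m^{+}$ and $\ell_m^{-}$. Let $W(t)=\lim_m\tilde B_m(t)$ and $\mathcal L(t,x)=\lim_m\mathcal L_m(t,x)$. Then almost surely $\tilde B_m\to W$ uniformly on $[0,K]$ and $\mathcal L_m\to\mathcal L$ uniformly on $[0,K]\times\mathbb R$ for every $K>0$; $W$ is a Brownian motion; and $\mathcal L$ is the Brownian local time of $W$, that is, almost surely $\mathcal L$ is jointly continuous on $[0,\infty)\times\mathbb R$ and, for all $t\ge0$ and $x\in\mathbb R$, with $\lambda$ denoting Lebesgue measure, $$\mathcal L(t,x)=\lim_{\varepsilon\searrow0}\frac1{2\varepsilon}\,\lambda\{s\in[0,t]: W(s)\in(x-\varepsilon,x+\varepsilon)\}.$$ Moreover, almost surely, for every $K>0$, $\mathcal L_m^{+}(t,x)\to\tfrac12\mathcal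 L(t,x)$ and $\mathcal L_m^{-}(t,x)\to\tfrac12\mathcal L(t,x)$ uniformly on $[0,K]\times\mathbb R$ as $m\to\infty$. For every $C>1$ there is a number $N_7(C)$, depending on $C$ only, such that for all $K>0$ and all integers $m\ge1$ with $K2^{2m}\ge N_7(C)$, $$P\Big(\sup_{(t,x)\in[0,K]\times\mathbb R}\big|\tfrac12\mathcal L(t,x)-\mathcal L^{+}_{m+1}(t,x)\big|\ge 50\,C\,K_*^{1/4}(\log_*K)^{3/4}m^{3/4}2^{-m/2}\Big)\le\frac{30}{1-4^{1-C}}\,(K2^{2m})^{1-C},$$ where $K_*=\max\{1,K\}$ and $\log_*K=\max\{1,\log K\}$, and the same bound holds with $\mathcal L^{-}_{m+1}$ in place of $\mathcal L^{+}_{m+1}$. -/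

import Mathlib

open MeasureTheory ProbabilityTheory Filter Set
open scoped Topology NNReal ENNReal

namespace TwistShrink

/-- The walk with integer steps `ξ 0, ξ 1, …`, started at `0`.
The step taken between the times `i` and `i + 1` is `ξ i`. -/
def walk (ξ : ℕ → ℤ) (n : ℕ) : ℤ := ∑ i ∈ Finset.range n, ξ i

/-- The successive times at which a path `S` has moved by `2` since the previous such time:
`T 0 = 0` and `T (k + 1) = min {n > T k : |S n - S (T k)| = 2}`. -/
noncomputable def refineTime (S : ℕ → ℤ) : ℕ → ℕ
  | 0 => 0
  | k + 1 => sInf {n : ℕ | refineTime S k < n ∧ |S n - S (refineTime S k)| = 2}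

/-- The index `k` of the bridge that contains the step between the times `i` and `i + 1`,
i.e. the `k` with `T k ≤ i < T (k + 1)`. -/
noncomputable def bridgeIndex (S : ℕ → ℤ) (i : ℕ) : ℕ :=
  sInf {k : ℕ | i < refineTime S (k + 1)}

/-- Twisting. The row `X m` holds the steps of the `m`-th original walk (`X m i` is the step
number `i + 1`); `twistedStep X m` are the steps of the `m`-th twisted walk: each bridge of the
original walk is flipped if its sign is not the one of the corresponding step of the twisted walk
one level below. -/
noncomputable def twistedStep (X : ℕ → ℕ → ℤ) : ℕ → ℕ → ℤ
  | 0 => X 0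
  | m + 1 => fun i =>
      let S := walk (X (m + 1))
      let k := bridgeIndex S i
      if S (refineTime S (k + 1)) - S (refineTime S k) = 2 * twistedStep X m k
      then X (m + 1) i else -X (m + 1) i

/-- The `m`-th twisted random walk. -/
noncomputable def twistedWalk (X : ℕ → ℕ → ℤ) (m : ℕ) : ℕ → ℤ := walk (twistedStep X m)

/-- Shrinking: the `m`-th approximating random walk, with time step `2⁻²ᵐ` and space step `2⁻ᵐ`,
interpolated linearly in between (for `t ≥ 0`). -/
noncomputable def approxBM (X : ℕ → ℕ → ℤ) (m : ℕ) (t : ℝ) : ℝ :=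
  let u : ℝ := t * 2 ^ (2 * m)
  let n : ℕ := ⌊u⌋₊
  ((twistedWalk X m n : ℝ) + (u - n) * ((twistedWalk X m (n + 1) : ℝ) - twistedWalk X m n)) / 2 ^ m

/-- The Brownian motion of the construction: the pointwise limit of the approximating walks. -/
noncomputable def limitBM (X : ℕ → ℕ → ℤ) (t : ℝ) : ℝ :=
  limUnder atTop fun m => approxBM X m t

/-- The local time of a walk: the number of visits to `x` at the times `0 ≤ j < k`. -/
def visits (S : ℕ → ℤ) (k : ℕ) (x : ℤ) : ℕ :=
  ((Finset.range k).filter fun j => S j = x).card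

/-- The up local time of a walk: visits to `x` that are followed by a step up. -/
def upVisits (S : ℕ → ℤ) (k : ℕ) (x : ℤ) : ℕ :=
  ((Finset.range k).filter fun j => S j = x ∧ S (j + 1) = x + 1).card

/-- The down local time of a walk: visits to `x` that are followed by a step down. -/
def downVisits (S : ℕ → ℤ) (k : ℕ) (x : ℤ) : ℕ :=
  ((Finset.range k).filter fun j => S j = x ∧ S (j + 1) = x - 1).card

/-- Rescaling and interpolation of a discrete local time `ℓ`: at the grid point
`(k 2⁻²ᵐ, j 2⁻ᵐ)` the value is `2⁻ᵐ ℓ k j`; each grid cell is cut into two triangles by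
its diagonal through the lower left corner, and the function is affine on each triangle. -/
noncomputable def interpolate (m : ℕ) (ℓ : ℕ → ℤ → ℕ) (t x : ℝ) : ℝ :=
  let k : ℕ := ⌊t * 2 ^ (2 * m)⌋₊
  let j : ℤ := ⌊x * 2 ^ m⌋
  let u : ℝ := t * 2 ^ (2 * m) - k
  let v : ℝ := x * 2 ^ m - j
  let f : ℕ → ℤ → ℝ := fun a b => (ℓ a b : ℝ) / 2 ^ m
  if u ≤ v then f k j + u * (f (k + 1) (j + 1) - f k (j + 1)) + v * (f k (j + 1) - f k j)
  else f k j + u * (f (k + 1) j - f k j) + v * (f (k + 1) (j + 1) - f (k + 1) j)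

/-- The local time of the `m`-th approximating walk, at time `t ≥ 0` and level `x`. -/
noncomputable def localTime (X : ℕ → ℕ → ℤ) (m : ℕ) (t x : ℝ) : ℝ :=
  interpolate m (visits (twistedWalk X m)) t x

/-- The up local time of the `m`-th approximating walk. -/
noncomputable def upLocalTime (X : ℕ → ℕ → ℤ) (m : ℕ) (t x : ℝ) : ℝ :=
  interpolate m (upVisits (twistedWalk X m)) t x

/-- The down local time of the `m`-th approximating walk. -/
noncomputable def downLocalTime (X : ℕ → ℕ → ℤ) (m : ℕ) (t x : ℝ) : ℝ :=
  interpolate m (downVisits (twistedWalk X m)) t x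

/-- Brownian local time: the limit of the local times of the approximating walks. -/
noncomputable def brownianLocalTime (X : ℕ → ℕ → ℤ) (t x : ℝ) : ℝ :=
  limUnder atTop fun m => localTime X m t x

/-- Lévy's formula: `L t x` is the limit, as `ε` decreases to `0`, of `1 / (2 ε)` times the
Lebesgue measure of the set of times in `[0, t]` that the path `w` spends in
`(x - ε, x + ε)`, for all `t ≥ 0` and all `x`. -/
def IsLevyLocalTime (w : ℝ → ℝ) (L : ℝ → ℝ → ℝ) : Prop :=
  ∀ t : ℝ, 0 ≤ t → ∀ x : ℝ,
    Tendsto (fun ε : ℝ => 1 / (2 * ε) * volume.real {s ∈ Icc 0 t | w s ∈ Ioo (x - ε) (x + ε)})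
      (𝓝[>] 0) (𝓝 (L t x))

/-- The infinite matrix of independent random signs, each `±1` with probability `1 / 2`. -/
structure IsRademacherArray {Ω : Type*} [MeasurableSpace Ω] (X : Ω → ℕ → ℕ → ℤ)
    (P : Measure Ω) : Prop where
  measurable : ∀ m k, Measurable fun ω => X ω m k
  indep : iIndepFun (fun (p : ℕ × ℕ) (ω : Ω) => X ω p.1 p.2) P
  prob_one : ∀ m k, P {ω | X ω m k = 1} = 1 / 2
  prob_neg_one : ∀ m k, P {ω | X ω m k = -1} = 1 / 2

/-- `log_* K = max {1, log K}`. -/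
noncomputable def logStar (K : ℝ) : ℝ := max 1 (Real.log K)

/-- The supremum of `|f - g|` over the strip `[0, K] × ℝ`, with values in `[0, ∞]`. -/
noncomputable def stripDist (K : ℝ) (f g : ℝ → ℝ → ℝ) : ℝ≥0∞ :=
  ⨆ t ∈ Icc (0 : ℝ) K, ⨆ x : ℝ, ENNReal.ofReal |f t x - g t x|

/-- Uniform convergence on every strip `[0, K] × ℝ`. -/
def TendstoOnStrips (F : ℕ → ℝ → ℝ → ℝ) (L : ℝ → ℝ → ℝ) : Prop :=
  ∀ K : ℝ, 0 < K →
    TendstoUniformlyOn (fun m (p : ℝ × ℝ) => F m p.1 p.2) (fun p => L p.1 p.2) atTop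
      (Icc 0 K ×ˢ univ)

end TwistShrink

/-! Group the steps of a walk into pairs. Its first move by 2 is completed exactly by the first pair
of equal steps (an exit pair), so the times `refineTime` are read off from the exit pairs. Flipping
whole bridges does not change which pairs exit. Hence the walk of level `m` is literally the coarse
walk embedded in that of level `m + 1` (`coarse_twist`), and the flip at each step depends only on
earlier steps and on independent signs, so every twisted walk is again a simple symmetric random
walk (`measurePreserving_twist`).

Every discrepancy to be controlled is a transform `∑ a j * z j` with predictable coefficients. An
exponential supermartingale and Markov's inequality show that it exceeds `√(2λv)` in absolute value,
while its quadratic variation is at most `v`, with probability at most `2 exp (-λ)`. `Regular`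
collects the instances needed. Discrete Tanaka bounds visits to a site by order `√(λM)`. Up minus
down visits at a site, and fine minus twice coarse visits at the end of a bridge, are transforms
whose variation is at most a visit count, hence of order `√(λ√(λM))`. The bridge ends deviate from
`4 * k` by order `√(λn)`, and visits in a window of that length are again of the same order.

With `λ = 3C log N` and `N = K * 2 ^ (2 * j)`, consecutive rescaled local times, and likewise
consecutive paths, differ by at most `15 C * fluctAt K j`. Since `fluctAt` shrinks by `3/4` per
level, the differences telescope and give uniform limits with a rate. The failure probabilities form
a geometric series in `4 ^ (1 - C)`. The up and down statements follow because up plus down is all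
visits and up minus down is small.

Lévy's formula is then deterministic: the time near `x` is approximately a sum of visit counts over
nearby sites, and the limiting local time is jointly continuous (`abs_volume_sub_le`). The limit
path is Brownian because independence of increments passes to almost sure limits through
characteristic functions, and `cos (c / 2 ^ m)` to the power `⌊t * 2 ^ (2 * m)⌋₊` tends to the
Gaussian characteristic function. -/

namespace TwistShrink

/-! ### Pairs of steps, bridges and twisting -/

/-- A sequence of signs. -/
def Signs (z : ℕ → ℤ) : Prop := ∀ i, z i = 1 ∨ z i = -1

/-- The `q`-th pair of steps is an exit pair if both steps go in the same direction. -/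
def ExitPair (z : ℕ → ℤ) (q : ℕ) : Prop := z (2 * q) = z (2 * q + 1)

instance (z : ℕ → ℤ) : DecidablePred (ExitPair z) :=
  fun q => inferInstanceAs (Decidable (z (2 * q) = z (2 * q + 1)))

/-- There are infinitely many exit pairs. -/
def Recurrent (z : ℕ → ℤ) : Prop := (Set.ofPred (ExitPair z)).Infinite

/-- The number of pairs in the first `k` bridges. -/
noncomputable def bridgeEnd (z : ℕ → ℤ) : ℕ → ℕ
  | 0 => 0
  | k + 1 => Nat.nth (ExitPair z) k + 1

/-- The steps of the coarse walk embedded in `walk z`. -/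
noncomputable def coarse (z : ℕ → ℤ) (k : ℕ) : ℤ := z (2 * Nat.nth (ExitPair z) k)

/-- The bridges of `walk x` flipped so that the embedded coarse walk has the steps `y`. -/
noncomputable def twist (x y : ℕ → ℤ) (i : ℕ) : ℤ :=
  y (Nat.count (ExitPair x) (i / 2)) *
    x (2 * Nat.nth (ExitPair x) (Nat.count (ExitPair x) (i / 2))) * x i

lemma walk_zero (z : ℕ → ℤ) : walk z 0 = 0 := by simp [walk]

lemma walk_succ (z : ℕ → ℤ) (n : ℕ) : walk z (n + 1) = walk z n + z n := by
  simp [walk, Finset.sum_range_succ]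

lemma Signs.mul_self {z : ℕ → ℤ} (hz : Signs z) (i : ℕ) : z i * z i = 1 := by
  rcases hz i with h | h <;> simp [h]

lemma Signs.coarse {z : ℕ → ℤ} (hz : Signs z) : Signs (coarse z) := fun _ => hz _

/-- Rewriting the exit indicator as a product of two steps is what turns counts of exit pairs into
transforms of the walk. -/
lemma Signs.exitPair_iff {z : ℕ → ℤ} (hz : Signs z) (q : ℕ) :
    z (2 * q) * z (2 * q + 1) = if ExitPair z q then 1 else -1 := by
  unfold ExitPair
  rcases hz (2 * q) with h | h <;> rcases hz (2 * q + 1) with h' | h' <;> simp [h, h']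

lemma Signs.walk_parity {z : ℕ → ℤ} (hz : Signs z) (n : ℕ) : (walk z n - n) % 2 = 0 := by
  induction n with
  | zero => simp [walk_zero]
  | succ n ih =>
    rw [walk_succ]
    push_cast
    rcases hz n with h | h <;> rw [h] <;> omega

lemma Signs.abs_walk_le {z : ℕ → ℤ} (hz : Signs z) (n : ℕ) : |walk z n| ≤ n := by
  induction n with
  | zero => simp [walk_zero]
  | succ n ih =>
    rw [walk_succ]
    rw [abs_le] at *
    push_cast
    rcases hz n with h | h <;> rw [h] <;> omega

lemma walk_pair_of_not_exit {z : ℕ → ℤ} (hz : Signs z) {q : ℕ} (hq : ¬ ExitPair z q) :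
    walk z (2 * (q + 1)) = walk z (2 * q) := by
  have h := hz.exitPair_iff q
  rw [if_neg hq] at h
  rw [show 2 * (q + 1) = 2 * q + 1 + 1 by ring, walk_succ, walk_succ]
  rcases hz (2 * q) with h1 | h1 <;> rcases hz (2 * q + 1) with h2 | h2 <;> simp_all

lemma walk_pair_of_exit {z : ℕ → ℤ} {q : ℕ} (hq : ExitPair z q) :
    walk z (2 * (q + 1)) = walk z (2 * q) + 2 * z (2 * q) := by
  rw [show 2 * (q + 1) = 2 * q + 1 + 1 by ring, walk_succ, walk_succ, ← hq]
  ring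

lemma walk_even_const {z : ℕ → ℤ} (hz : Signs z) {a : ℕ} (d : ℕ)
    (h : ∀ q, a ≤ q → q < a + d → ¬ ExitPair z q) :
    walk z (2 * (a + d)) = walk z (2 * a) := by
  induction d with
  | zero => simp
  | succ d ih =>
    rw [← add_assoc, walk_pair_of_not_exit hz (h (a + d) (by omega) (by omega))]
    exact ih fun q h1 h2 => h q h1 (by omega)

section Recurrent

variable {z : ℕ → ℤ} (hr : Recurrent z)
include hr

lemma not_exit_of_between {k q : ℕ} (h1 : bridgeEnd z k ≤ q)
    (h2 : q < Nat.nth (ExitPair z) k) : ¬ ExitPair z q := by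
  intro hq
  rw [← Nat.nth_count hq, Nat.nth_lt_nth hr] at h2
  cases k with
  | zero => omega
  | succ k =>
    have h3 : Nat.nth (ExitPair z) k < q := h1
    rw [← Nat.nth_count hq, Nat.nth_lt_nth hr] at h3
    omega

lemma bridgeEnd_le_nth (k : ℕ) : bridgeEnd z k ≤ Nat.nth (ExitPair z) k := by
  cases k with
  | zero => simp [bridgeEnd]
  | succ k => exact (Nat.nth_lt_nth hr).2 (Nat.lt_succ_self k)

lemma bridgeEnd_strictMono : StrictMono (bridgeEnd z) :=
  strictMono_nat_of_lt_succ fun k => Nat.lt_succ_of_le (bridgeEnd_le_nth hr k)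

lemma count_bridgeEnd (k : ℕ) : Nat.count (ExitPair z) (bridgeEnd z k) = k := by
  cases k with
  | zero => simp [bridgeEnd]
  | succ k => exact Nat.count_nth_succ_of_infinite hr k

omit hr in
lemma bridgeEnd_le_of_le_count {k r : ℕ} (h : k ≤ Nat.count (ExitPair z) r) :
    bridgeEnd z k ≤ r := by
  cases k with
  | zero => simp [bridgeEnd]
  | succ k => exact Nat.nth_lt_of_lt_count h

lemma walk_bridge_const (hz : Signs z) {k q : ℕ} (h1 : bridgeEnd z k ≤ q)
    (h2 : q ≤ Nat.nth (ExitPair z) k) : walk z (2 * q) = walk z (2 * bridgeEnd z k) := by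
  obtain ⟨d, rfl⟩ := Nat.exists_eq_add_of_le h1
  exact walk_even_const hz d fun q h3 h4 => not_exit_of_between hr h3 (by omega)

lemma walk_bridge_step (hz : Signs z) (k : ℕ) :
    walk z (2 * bridgeEnd z (k + 1)) = walk z (2 * bridgeEnd z k) + 2 * coarse z k := by
  have h1 : ExitPair z (Nat.nth (ExitPair z) k) := Nat.nth_mem_of_infinite hr k
  rw [bridgeEnd, walk_pair_of_exit h1,
    walk_bridge_const hr hz (bridgeEnd_le_nth hr k) le_rfl, coarse]

lemma walk_bridgeEnd (hz : Signs z) (k : ℕ) :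
    walk z (2 * bridgeEnd z k) = 2 * walk (coarse z) k := by
  induction k with
  | zero => simp [bridgeEnd, walk_zero]
  | succ k ih => rw [walk_bridge_step hr hz, ih, walk_succ]; ring

/-- Before its exit pair a bridge is back at its starting height at every even time and at distance
1 at every odd time; the exit pair then moves it by 2. -/
lemma refineTime_walk (hz : Signs z) (k : ℕ) :
    refineTime (walk z) k = 2 * bridgeEnd z k := by
  induction k with
  | zero => simp [refineTime, bridgeEnd]
  | succ k ih =>
    rw [refineTime, ih]
    apply IsLeast.csInf_eq
    constructor
    · refine ⟨?_, ?_⟩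
      · have := bridgeEnd_strictMono hr (Nat.lt_succ_self k)
        simpa using this
      · rw [walk_bridge_step hr hz]
        rcases hz.coarse k with h | h <;> simp [h]
    · rintro n ⟨h1, h2⟩
      by_contra! hn
      rw [bridgeEnd] at hn
      obtain ⟨q, hq | hq⟩ : ∃ q, n = 2 * q ∨ n = 2 * q + 1 := ⟨n / 2, by omega⟩
      · rw [hq, walk_bridge_const hr hz (k := k) (by omega) (by omega)] at h2
        simp at h2
      · rw [hq, walk_succ, walk_bridge_const hr hz (k := k) (by omega) (by omega)] at h2
        rcases hz (2 * q) with h | h <;> simp [h] at h2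

lemma bridgeIndex_walk (hz : Signs z) (i : ℕ) :
    bridgeIndex (walk z) i = Nat.count (ExitPair z) (i / 2) := by
  have : {k : ℕ | i < refineTime (walk z) (k + 1)} =
      Set.Ici (Nat.count (ExitPair z) (i / 2)) := by
    ext k
    rw [mem_ofPred_eq, refineTime_walk hr hz, mem_Ici, Nat.count_le_iff_le_nth hr, bridgeEnd]
    omega
  rw [bridgeIndex, this, csInf_Ici]

end Recurrent

/-- Both the wanted and the actual direction of the bridge are signs, so the flipping test amounts
to multiplication by their product. -/
lemma twistedStep_succ {X : ℕ → ℕ → ℤ} {m : ℕ} (hx : Signs (X (m + 1)))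
    (hr : Recurrent (X (m + 1))) (hy : Signs (twistedStep X m)) (i : ℕ) :
    twistedStep X (m + 1) i = twist (X (m + 1)) (twistedStep X m) i := by
  rw [twistedStep]
  simp only
  rw [bridgeIndex_walk hr hx, refineTime_walk hr hx, refineTime_walk hr hx,
    walk_bridge_step hr hx, twist, add_sub_cancel_left]
  set k := Nat.count (ExitPair (X (m + 1))) (i / 2)
  change _ = twistedStep X m k * coarse (X (m + 1)) k * _
  rcases hx.coarse k with h1 | h1 <;> rcases hy k with h2 | h2 <;> simp [h1, h2]

section twist

variable {x y : ℕ → ℤ} (hx : Signs x) (hy : Signs y)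
include hx hy

/-- The two steps of a pair lie in the same bridge and get the same factor. -/
lemma exitPair_twist : ExitPair (twist x y) = ExitPair x := by
  ext q
  unfold ExitPair twist
  rw [show (2 * q + 1) / 2 = q by omega, show (2 * q) / 2 = q by omega]
  rcases hx (2 * Nat.nth (ExitPair x) (Nat.count (ExitPair x) q)) with h' | h' <;>
  rcases hy (Nat.count (ExitPair x) q) with h'' | h'' <;> simp [h', h'']

lemma coarse_twist (hr : Recurrent x) : coarse (twist x y) = y := by
  ext k
  rw [coarse, exitPair_twist hx hy, twist]
  rw [Nat.mul_div_cancel_left _ two_pos, Nat.count_nth_of_infinite hr, mul_assoc, hx.mul_self,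
    mul_one]

end twist

/-! ### Visits of the fine and the coarse walk -/

lemma visits_succ (S : ℕ → ℤ) (k : ℕ) (x : ℤ) :
    visits S (k + 1) x = visits S k x + if S k = x then 1 else 0 := by
  rw [visits, visits, Finset.range_add_one, Finset.filter_insert]
  split_ifs <;> simp

lemma upVisits_succ (S : ℕ → ℤ) (k : ℕ) (x : ℤ) :
    upVisits S (k + 1) x = upVisits S k x + if S k = x ∧ S (k + 1) = x + 1 then 1 else 0 := by
  rw [upVisits, upVisits, Finset.range_add_one, Finset.filter_insert]
  split_ifs <;> simp

lemma downVisits_succ (S : ℕ → ℤ) (k : ℕ) (x : ℤ) :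
    downVisits S (k + 1) x = downVisits S k x + if S k = x ∧ S (k + 1) = x - 1 then 1 else 0 := by
  rw [downVisits, downVisits, Finset.range_add_one, Finset.filter_insert]
  split_ifs <;> simp

lemma visits_mono (S : ℕ → ℤ) (x : ℤ) : Monotone fun k => visits S k x :=
  monotone_nat_of_le_succ fun k => by simp [visits_succ]

/-- By parity an even site is occupied only at even times, that is, at the start of a pair. -/
lemma visits_two_mul {z : ℕ → ℤ} (hz : Signs z) (r : ℕ) (i : ℤ) :
    (visits (walk z) (2 * r) (2 * i) : ℤ) =
      ∑ q ∈ Finset.range r, if walk z (2 * q) = 2 * i then 1 else 0 := by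
  induction r with
  | zero => simp [visits]
  | succ r ih =>
    have h := hz.walk_parity (2 * r + 1)
    push_cast at h
    rw [show 2 * (r + 1) = 2 * r + 1 + 1 by ring, visits_succ, visits_succ,
      if_neg (by omega : ¬ walk z (2 * r + 1) = 2 * i), Finset.sum_range_succ]
    push_cast
    rw [ih]
    simp

/-- Each bridge contains exactly one exit pair, and that pair starts at twice the height of the
coarse walk. -/
lemma visits_coarse {z : ℕ → ℤ} (hz : Signs z) (hr : Recurrent z) (k : ℕ) (i : ℤ) :
    (visits (walk (coarse z)) k i : ℤ) = ∑ q ∈ Finset.range (bridgeEnd z k),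
      if ExitPair z q ∧ walk z (2 * q) = 2 * i then 1 else 0 := by
  induction k with
  | zero => simp [visits, bridgeEnd]
  | succ k ih =>
    rw [visits_succ, bridgeEnd, Finset.sum_range_succ,
      ← Finset.sum_range_add_sum_Ico _ (bridgeEnd_le_nth hr k), ← ih, Finset.sum_eq_zero,
      walk_bridge_const hr hz (bridgeEnd_le_nth hr k) le_rfl, walk_bridgeEnd hr hz]
    · have : ExitPair z (Nat.nth (ExitPair z) k) := Nat.nth_mem_of_infinite hr k
      simp [this]
    · intro q hq
      rw [Finset.mem_Ico] at hq
      rw [if_neg]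
      exact fun h => not_exit_of_between hr hq.1 hq.2 h.1

/-- A pair starting at `2 * i` contributes `1` to the fine count and its exit indicator to the
coarse one; `1 - 2 * indicator` is minus the product of the two steps. The right side is a transform
by coefficients known before the second step of each pair. -/
lemma visits_fine_sub_coarse {z : ℕ → ℤ} (hz : Signs z) (hr : Recurrent z) (k : ℕ) (i : ℤ) :
    (visits (walk z) (2 * bridgeEnd z k) (2 * i) : ℤ) - 2 * visits (walk (coarse z)) k i =
      -∑ q ∈ Finset.range (bridgeEnd z k),
        (if walk z (2 * q) = 2 * i then z (2 * q) else 0) * z (2 * q + 1) := by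
  rw [visits_two_mul hz, visits_coarse hz hr, Finset.mul_sum, ← Finset.sum_sub_distrib,
    ← Finset.sum_neg_distrib]
  refine Finset.sum_congr rfl fun q _ => ?_
  have := hz.exitPair_iff q
  by_cases h1 : ExitPair z q <;> by_cases h2 : walk z (2 * q) = 2 * i <;> simp_all

lemma two_mul_count_exit {z : ℕ → ℤ} (hz : Signs z) (r : ℕ) :
    (2 * Nat.count (ExitPair z) r : ℤ) - r =
      ∑ q ∈ Finset.range r, z (2 * q) * z (2 * q + 1) := by
  induction r with
  | zero => simp
  | succ r ih =>
    rw [Finset.sum_range_succ, ← ih, hz.exitPair_iff, Nat.count_succ]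
    split_ifs <;> push_cast <;> ring

/-! ### Up and down visits, Tanaka's formula -/

lemma up_add_down {z : ℕ → ℤ} (hz : Signs z) (n : ℕ) (i : ℤ) :
    upVisits (walk z) n i + downVisits (walk z) n i = visits (walk z) n i := by
  induction n with
  | zero => simp [visits, upVisits, downVisits]
  | succ n ih =>
    rw [visits_succ, upVisits_succ, downVisits_succ, ← ih, walk_succ]
    rcases hz n with h' | h' <;> rw [h'] <;> split_ifs <;> omega

lemma up_sub_down {z : ℕ → ℤ} (hz : Signs z) (n : ℕ) (i : ℤ) :
    (upVisits (walk z) n i : ℤ) - downVisits (walk z) n i =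
      ∑ j ∈ Finset.range n, (if walk z j = i then 1 else 0) * z j := by
  induction n with
  | zero => simp [upVisits, downVisits]
  | succ n ih =>
    rw [upVisits_succ, downVisits_succ, Finset.sum_range_succ, ← ih, walk_succ]
    push_cast
    rcases hz n with h' | h' <;> rw [h'] <;> split_ifs <;> omega

/-- Crossings of the edge between `i` and `i + 1` alternate in direction, so the net number depends
only on the sides on which the walk starts and ends. -/
lemma up_sub_down_succ {z : ℕ → ℤ} (hz : Signs z) (n : ℕ) (i : ℤ) :
    (upVisits (walk z) n i : ℤ) - downVisits (walk z) n (i + 1) =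
      (if i + 1 ≤ walk z n then 1 else 0) - if i + 1 ≤ 0 then 1 else 0 := by
  induction n with
  | zero => simp [upVisits, downVisits, walk_zero]
  | succ n ih =>
    rw [upVisits_succ, downVisits_succ, walk_succ]
    push_cast
    rw [show ∀ a b c d : ℤ, a + b - (c + d) = a - c + (b - d) by intros; ring, ih]
    rcases hz n with h' | h' <;> rw [h'] <;> split_ifs <;> omega

/-- A step changes the distance to `i` by the sign times the step, except at `i` itself, where the
distance always grows by 1. -/
lemma tanaka {z : ℕ → ℤ} (hz : Signs z) (s u : ℕ) (i : ℤ) :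
    |walk z (s + u) - i| = |walk z s - i| +
      ∑ j ∈ Finset.Ico s (s + u), (walk z j - i).sign * z j +
      (visits (walk z) (s + u) i - visits (walk z) s i) := by
  induction u with
  | zero => simp
  | succ u ih =>
    rw [← add_assoc, Finset.sum_Ico_succ_top (by omega), visits_succ, walk_succ]
    have h : |walk z (s + u) + z (s + u) - i| = |walk z (s + u) - i| +
        (walk z (s + u) - i).sign * z (s + u) + if walk z (s + u) = i then 1 else 0 := by
      have hs : |z (s + u)| = 1 := by rcases hz (s + u) with h' | h' <;> simp [h']
      rcases lt_trichotomy (walk z (s + u)) i with h | h | h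
      · rw [Int.sign_eq_neg_one_of_neg (by omega), if_neg h.ne,
            abs_of_neg (by omega : walk z (s + u) - i < 0),
          abs_of_nonpos (by rcases hz (s + u) with h' | h' <;> omega)]
        ring
      · simp [h, hs]
      · rw [Int.sign_eq_one_of_pos (by omega), if_neg h.ne',
            abs_of_pos (by omega : 0 < walk z (s + u) - i),
          abs_of_nonneg (by rcases hz (s + u) with h' | h' <;> omega)]
        ring
    rw [h, ih]
    push_cast
    ring


/-! ### Deviation bounds and their deterministic consequences for a walk -/

/-- The sub-Gaussian deviation bound for the transform of `z` by the coefficients `a`, given that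
its quadratic variation is at most `v`. -/
def Concentrated (z : ℕ → ℤ) (a : ℕ → ℤ) (n : ℕ) (v lam : ℝ) : Prop :=
  ∑ j ∈ Finset.range n, (a j : ℝ) ^ 2 ≤ v →
    |∑ j ∈ Finset.range n, (a j : ℝ) * z j| ≤ √(2 * lam * v)

def stepCoeff (s j : ℕ) : ℤ := if s ≤ j then 1 else 0

def tanakaCoeff (z : ℕ → ℤ) (s : ℕ) (i : ℤ) (j : ℕ) : ℤ :=
  if s ≤ j then (walk z j - i).sign else 0

def siteCoeff (z : ℕ → ℤ) (i : ℤ) (j : ℕ) : ℤ := if walk z j = i then 1 else 0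

/-- Supported on the second steps of pairs: the transform is the sum of the products over pairs,
with a coefficient known one step earlier. -/
def exitCoeff (z : ℕ → ℤ) (j : ℕ) : ℤ := if j % 2 = 1 then z (j - 1) else 0

def exitSiteCoeff (z : ℕ → ℤ) (i : ℤ) (j : ℕ) : ℤ :=
  if j % 2 = 1 ∧ walk z (j - 1) = 2 * i then z (j - 1) else 0

/-- An upper bound for the number of visits to a site up to time `M`. -/
noncomputable def visitBound (M : ℕ) (lam : ℝ) : ℝ := √(2 * lam * M) + 1

/-- A bound for the imbalance between the up and the down visits of a site up to time `M`. -/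
noncomputable def siteBound (M : ℕ) (lam : ℝ) : ℝ := √(2 * lam * visitBound M lam)

/-- A bound for the deviation of the end of a bridge from its mean. -/
noncomputable def timeBound (n : ℕ) (lam : ℝ) : ℝ := 2 * √(6 * lam * n)

/-- A bound for the difference of two consecutive approximations, in lattice units. -/
noncomputable def levelBound (n M : ℕ) (lam : ℝ) : ℝ :=
  9 + √(2 * lam * timeBound n lam) + 3 * siteBound M lam

/-- All deviation bounds used for a walk up to time `M`. -/
structure Regular (z : ℕ → ℤ) (M : ℕ) (lam : ℝ) : Prop where
  step : ∀ s ≤ M, ∀ u ≤ M, Concentrated z (stepCoeff s) (s + u) u lam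
  -- The window may end as late as `2 * M`, hence the wider range of sites.
  tanaka : ∀ s ≤ M, ∀ u ≤ M, ∀ i ∈ Finset.Icc (-(2 * M : ℤ)) (2 * M),
    Concentrated z (tanakaCoeff z s i) (s + u) u lam
  site : ∀ n ≤ M, ∀ i ∈ Finset.Icc (-(M : ℤ)) M,
    Concentrated z (siteCoeff z i) n (visitBound M lam) lam
  exit : ∀ r ≤ M, Concentrated z (exitCoeff z) (2 * r) r lam
  exitSite : ∀ r ≤ M, ∀ i ∈ Finset.Icc (-(M : ℤ)) M,
    Concentrated z (exitSiteCoeff z i) (2 * r) (visitBound M lam) lam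

lemma sum_range_eq_sum_Ico {s u : ℕ} {f : ℕ → ℝ} (hf : ∀ j < s, f j = 0) :
    ∑ j ∈ Finset.range (s + u), f j = ∑ j ∈ Finset.Ico s (s + u), f j := by
  rw [← Finset.sum_range_add_sum_Ico f (Nat.le_add_right s u),
    Finset.sum_eq_zero (s := Finset.range s), zero_add]
  exact fun j hj => hf j (Finset.mem_range.1 hj)

lemma sum_range_two_mul {r : ℕ} {f : ℕ → ℝ} (hf : ∀ j, j % 2 = 0 → f j = 0) :
    ∑ j ∈ Finset.range (2 * r), f j = ∑ q ∈ Finset.range r, f (2 * q + 1) := by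
  induction r with
  | zero => simp
  | succ r ih =>
    rw [show 2 * (r + 1) = 2 * r + 1 + 1 by ring, Finset.sum_range_succ, Finset.sum_range_succ, ih,
      Finset.sum_range_succ, hf (2 * r) (by omega), add_zero]

lemma walk_add (z : ℕ → ℤ) (s u : ℕ) :
    walk z (s + u) = walk z s + ∑ j ∈ Finset.Ico s (s + u), z j :=
  (Finset.sum_range_add_sum_Ico z (Nat.le_add_right s u)).symm

namespace Regular

variable {z : ℕ → ℤ} {M : ℕ} {lam : ℝ}

lemma abs_walk_sub_le (h : Regular z M lam) {s u : ℕ} (hs : s ≤ M) (hu : u ≤ M) :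
    |(walk z (s + u) : ℝ) - walk z s| ≤ √(2 * lam * u) := by
  have h1 := h.step s hs u hu
  unfold Concentrated at h1
  rw [sum_range_eq_sum_Ico (by intro j hj; simp [stepCoeff, hj]),
    sum_range_eq_sum_Ico (by intro j hj; simp [stepCoeff, hj])] at h1
  rw [walk_add]
  push_cast
  rw [add_sub_cancel_left]
  convert h1 ?_ using 2
  · refine Finset.sum_congr rfl fun j hj => ?_
    simp [stepCoeff, (Finset.mem_Ico.1 hj).1]
  · rw [Finset.sum_congr rfl (g := fun _ => (1 : ℝ))]
    · simp
    · intro j hj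
      simp [stepCoeff, (Finset.mem_Ico.1 hj).1]

/-- The count changes only at visits, and at a visit the distance in Tanaka's formula is zero, so
the earlier visits of the window are at most minus the transform. The extra `1` is the visit itself.
-/
lemma visits_sub_le (h : Regular z M lam) (hz : Signs z) (hl : 0 ≤ lam) {s u : ℕ} (hs : s ≤ M)
    (hu : u ≤ M) (i : ℤ) :
    (visits (walk z) (s + u) i : ℝ) - visits (walk z) s i ≤ √(2 * lam * u) + 1 := by
  have key : ∀ w ≤ u,
      (visits (walk z) (s + w) i : ℝ) - visits (walk z) s i ≤ √(2 * lam * u) + 1 := by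
    intro w hw
    induction w with
    | zero => simp; positivity
    | succ w ih =>
      rw [← add_assoc, visits_succ]
      split_ifs with hi
      · have h0 := hz.abs_walk_le (s + w)
        rw [hi] at h0
        -- A visited site lies within the range covered by `Regular`, so no condition on `i` is
        -- needed.
        have h1 := h.tanaka s hs w (by omega) i (by
          rw [Finset.mem_Icc]; rw [abs_le] at h0; push_cast at h0; omega)
        unfold Concentrated at h1
        rw [sum_range_eq_sum_Ico (by intro j hj; simp [tanakaCoeff, hj]),
          sum_range_eq_sum_Ico (by intro j hj; simp [tanakaCoeff, hj])] at h1
        have h2 : ∑ j ∈ Finset.Ico s (s + w), (tanakaCoeff z s i j : ℝ) ^ 2 ≤ w := by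
          calc _ ≤ ∑ j ∈ Finset.Ico s (s + w), (1 : ℝ) := by
                refine Finset.sum_le_sum fun j hj => ?_
                rw [tanakaCoeff, if_pos (Finset.mem_Ico.1 hj).1]
                rcases lt_trichotomy (walk z j - i) 0 with h | h | h
                · simp [Int.sign_eq_neg_one_of_neg h]
                · simp [h]
                · simp [Int.sign_eq_one_of_pos h]
            _ = w := by simp
        have h3 := (abs_le.1 (h1 h2)).1
        have h4 := TwistShrink.tanaka hz s w i
        rw [hi, sub_self, abs_zero] at h4
        have h5 : (∑ j ∈ Finset.Ico s (s + w), (tanakaCoeff z s i j : ℝ) * z j) =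
            ((∑ j ∈ Finset.Ico s (s + w), (walk z j - i).sign * z j : ℤ) : ℝ) := by
          push_cast
          refine Finset.sum_congr rfl fun j hj => ?_
          rw [tanakaCoeff, if_pos (Finset.mem_Ico.1 hj).1]
        have h6 : (visits (walk z) (s + w) i : ℤ) - visits (walk z) s i ≤
            -∑ j ∈ Finset.Ico s (s + w), (walk z j - i).sign * z j := by
          have := abs_nonneg (walk z s - i)
          linarith
        have h7 : (visits (walk z) (s + w) i : ℝ) - visits (walk z) s i ≤
            -((∑ j ∈ Finset.Ico s (s + w), (walk z j - i).sign * z j : ℤ) : ℝ) := by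
          exact_mod_cast h6
        have h8 : √(2 * lam * w) ≤ √(2 * lam * u) := by
          apply Real.sqrt_le_sqrt
          have : (w : ℝ) ≤ u := by exact_mod_cast (by omega : w ≤ u)
          gcongr
        push_cast
        linarith
      · simpa using ih (by omega)
  exact key u le_rfl

lemma visits_le (h : Regular z M lam) (hz : Signs z) (hl : 0 ≤ lam) {n : ℕ} (hn : n ≤ M) (i : ℤ) :
    (visits (walk z) n i : ℝ) ≤ visitBound M lam := by
  have h1 := h.visits_sub_le hz hl (Nat.zero_le M) le_rfl i
  have h2 : (visits (walk z) n i : ℝ) ≤ visits (walk z) (0 + M) i := by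
    exact_mod_cast visits_mono (walk z) i (by omega : n ≤ 0 + M)
  rw [visitBound]
  simp only [visits, Finset.range_zero, Finset.filter_empty, Finset.card_empty] at h1 h2 ⊢
  push_cast at h1
  linarith

lemma siteBound_nonneg : 0 ≤ siteBound M lam := Real.sqrt_nonneg _

lemma visits_eq_sum (S : ℕ → ℤ) (n : ℕ) (i : ℤ) :
    (visits S n i : ℝ) = ∑ j ∈ Finset.range n, if S j = i then (1 : ℝ) else 0 := by
  rw [visits, Finset.card_filter]
  push_cast
  rfl

/-- The quadratic variation of the difference is the number of visits, already bounded by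
`visitBound`: a square root of a square root appears. -/
lemma abs_up_sub_down_le (h : Regular z M lam) (hz : Signs z) (hl : 0 ≤ lam) {n : ℕ} (hn : n ≤ M)
    (i : ℤ) :
    |(upVisits (walk z) n i : ℝ) - downVisits (walk z) n i| ≤ siteBound M lam := by
  have h1 : (upVisits (walk z) n i : ℝ) - downVisits (walk z) n i =
      ∑ j ∈ Finset.range n, (siteCoeff z i j : ℝ) * z j := by
    have := up_sub_down hz n i
    rw [show ∀ a b : ℕ, (a : ℝ) - b = ((a - b : ℤ) : ℝ) by intros; push_cast; ring, this]
    push_cast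
    simp [siteCoeff]
  rw [h1]
  by_cases hi : i ∈ Finset.Icc (-(M : ℤ)) M
  · apply h.site n hn i hi
    refine le_trans (le_of_eq ?_) (h.visits_le hz hl hn i)
    rw [visits_eq_sum]
    refine Finset.sum_congr rfl fun j _ => ?_
    unfold siteCoeff
    split_ifs <;> simp
  · rw [Finset.sum_eq_zero, abs_zero]
    · exact siteBound_nonneg
    · intro j hj
      rw [Finset.mem_range] at hj
      have := abs_le.1 (hz.abs_walk_le j)
      rw [Finset.mem_Icc] at hi
      rw [siteCoeff, if_neg (by omega)]
      simp

/-- At each site total visits are twice the up, or twice the down, visits up to `siteBound`; up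
visits at `i` and down visits at `i + 1` differ by at most 1. -/
lemma abs_visits_succ_sub_le (h : Regular z M lam) (hz : Signs z) (hl : 0 ≤ lam) {n : ℕ}
    (hn : n ≤ M) (i : ℤ) :
    |(visits (walk z) n (i + 1) : ℝ) - visits (walk z) n i| ≤ 2 + 2 * siteBound M lam := by
  have h1 := abs_le.1 (h.abs_up_sub_down_le hz hl hn i)
  have h2 := abs_le.1 (h.abs_up_sub_down_le hz hl hn (i + 1))
  have h3 : |(upVisits (walk z) n i : ℤ) - downVisits (walk z) n (i + 1)| ≤ 1 := by
    rw [up_sub_down_succ hz, abs_le]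
    split_ifs <;> simp
  have h4 : |(upVisits (walk z) n i : ℝ) - downVisits (walk z) n (i + 1)| ≤ 1 := by
    exact_mod_cast h3
  rw [abs_le] at h4
  rw [← up_add_down hz, ← up_add_down hz]
  push_cast
  rw [abs_le]
  constructor <;> linarith [h1.1, h1.2, h2.1, h2.2, h4.1, h4.2]

lemma abs_exit_sum_le (h : Regular z M lam) (hz : Signs z) {r : ℕ} (hr : r ≤ M) :
    |(2 * Nat.count (ExitPair z) r : ℝ) - r| ≤ √(2 * lam * r) := by
  have h1 := h.exit r hr
  unfold Concentrated at h1
  rw [sum_range_two_mul (by intro j hj; simp [exitCoeff, hj]),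
    sum_range_two_mul (by intro j hj; simp [exitCoeff, hj])] at h1
  have h2 := two_mul_count_exit hz r
  have h3 : (2 * Nat.count (ExitPair z) r : ℝ) - r =
      ((∑ q ∈ Finset.range r, z (2 * q) * z (2 * q + 1) : ℤ) : ℝ) := by
    rw [← h2]; push_cast; ring
  rw [h3]
  convert h1 ?_ using 2
  · push_cast
    refine Finset.sum_congr rfl fun q _ => ?_
    simp [exitCoeff, show (2 * q + 1) % 2 = 1 by omega]
  · rw [Finset.sum_congr rfl (g := fun _ => (1 : ℝ))]
    · simp
    · intro q _
      simp only [exitCoeff, show (2 * q + 1) % 2 = 1 by omega, if_true, add_tsub_cancel_right]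
      rcases hz (2 * q) with h | h <;> simp [h]

lemma abs_visits_fine_sub_coarse_le (h : Regular z M lam) (hz : Signs z) (hr : Recurrent z)
    (hl : 0 ≤ lam) {k : ℕ} (hk : 2 * bridgeEnd z k ≤ M) (i : ℤ) :
    |(visits (walk z) (2 * bridgeEnd z k) (2 * i) : ℝ) - 2 * visits (walk (coarse z)) k i| ≤
      siteBound M lam := by
  have h1 : (visits (walk z) (2 * bridgeEnd z k) (2 * i) : ℝ) - 2 * visits (walk (coarse z)) k i =
      -∑ j ∈ Finset.range (2 * bridgeEnd z k), (exitSiteCoeff z i j : ℝ) * z j := by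
    have := visits_fine_sub_coarse hz hr k i
    rw [sum_range_two_mul (by intro j hj; simp [exitSiteCoeff, hj])]
    rw [show ∀ a b : ℕ, (a : ℝ) - 2 * b = ((a - 2 * b : ℤ) : ℝ) by intros; push_cast; ring, this]
    push_cast
    congr 1
    refine Finset.sum_congr rfl fun q _ => ?_
    simp [exitSiteCoeff, show (2 * q + 1) % 2 = 1 by omega]
  rw [h1, abs_neg]
  by_cases hi : i ∈ Finset.Icc (-(M : ℤ)) M
  · apply h.exitSite _ (by omega) i hi
    refine le_trans ?_ (h.visits_le hz hl hk (2 * i))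
    rw [sum_range_two_mul (by intro j hj; simp [exitSiteCoeff, hj])]
    have := visits_two_mul hz (bridgeEnd z k) i
    rw [← Int.cast_natCast, this]
    push_cast
    refine le_of_eq (Finset.sum_congr rfl fun q _ => ?_)
    simp only [exitSiteCoeff, show (2 * q + 1) % 2 = 1 by omega, true_and, add_tsub_cancel_right]
    rcases hz (2 * q) with h | h <;> rw [h] <;> split_ifs <;> simp
  · rw [Finset.sum_eq_zero, abs_zero]
    · exact siteBound_nonneg
    · intro j hj
      rw [Finset.mem_range] at hj
      have := abs_le.1 (hz.abs_walk_le (j - 1))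
      rw [Finset.mem_Icc] at hi
      rw [exitSiteCoeff, if_neg (by omega)]
      simp

/-! ### The ends of the bridges -/

/-- About half of the pairs exit. Fewer than `n` exits among `3 * n` pairs would be a deviation
greater than `n`, while `6 * lam ≤ n` makes the allowed deviation at most `n`. -/
lemma bridgeEnd_le (h : Regular z M lam) (hz : Signs z) {k n : ℕ} (hk : k ≤ n) (hM : 3 * n ≤ M)
    (hn : 6 * lam ≤ n) : bridgeEnd z k ≤ 3 * n := by
  apply bridgeEnd_le_of_le_count
  by_contra! hc
  have h1 := (abs_le.1 (h.abs_exit_sum_le hz hM)).1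
  have h2 : (Nat.count (ExitPair z) (3 * n) : ℝ) + 1 ≤ k := by exact_mod_cast hc
  have h3 : (k : ℝ) ≤ n := by exact_mod_cast hk
  push_cast at h1
  have h4 : √(2 * lam * (3 * n)) ≤ n := by
    apply Real.sqrt_le_iff.2
    refine ⟨by positivity, ?_⟩
    nlinarith [(Nat.cast_nonneg n : (0 : ℝ) ≤ n)]
  linarith

/-- There are exactly `k` exits before the end of the `k`-th bridge, so the exit deviation there is
`2 * k` minus the number of pairs; time in steps doubles it. -/
lemma abs_bridgeEnd_sub_le (h : Regular z M lam) (hz : Signs z) (hr : Recurrent z) (hl : 0 ≤ lam)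
    {k n : ℕ} (hk : k ≤ n) (hM : 3 * n ≤ M) (hn : 6 * lam ≤ n) :
    |((2 * bridgeEnd z k : ℕ) : ℝ) - (4 * k : ℕ)| ≤ timeBound n lam := by
  have h0 := h.bridgeEnd_le hz hk hM hn
  have h1 := h.abs_exit_sum_le hz (h0.trans hM)
  rw [count_bridgeEnd hr] at h1
  have h2 : √(2 * lam * bridgeEnd z k) ≤ √(6 * lam * n) := by
    apply Real.sqrt_le_sqrt
    have : (bridgeEnd z k : ℝ) ≤ 3 * n := by exact_mod_cast h0
    nlinarith
  rw [timeBound]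
  rw [abs_le] at *
  push_cast
  constructor <;> linarith [h1.1, h1.2]

/-- Treats both orders of the mean time `4 * k` and the actual time at once. Both are at most `6 *
n`, which is where `M = 6 * n` comes from. -/
lemma exists_window (h : Regular z M lam) (hz : Signs z) (hr : Recurrent z) (hl : 0 ≤ lam)
    {k n : ℕ} (hk : k ≤ n) (hM : 6 * n ≤ M) (hn : 6 * lam ≤ n) :
    ∃ s u : ℕ, s ≤ M ∧ u ≤ M ∧ √(2 * lam * u) ≤ √(2 * lam * timeBound n lam) ∧
      ((s = 4 * k ∧ s + u = 2 * bridgeEnd z k) ∨ (s = 2 * bridgeEnd z k ∧ s + u = 4 * k)) := by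
  have h0 := h.bridgeEnd_le hz hk (by omega) hn
  have h1 := abs_le.1 (h.abs_bridgeEnd_sub_le hz hr hl hk (by omega) hn)
  rcases le_total (4 * k) (2 * bridgeEnd z k) with hc | hc
  · refine ⟨4 * k, 2 * bridgeEnd z k - 4 * k, by omega, by omega, ?_, Or.inl ⟨rfl, by omega⟩⟩
    apply Real.sqrt_le_sqrt
    rw [Nat.cast_sub hc]
    gcongr
    exact h1.2
  · refine ⟨2 * bridgeEnd z k, 4 * k - 2 * bridgeEnd z k, by omega, by omega, ?_,
      Or.inr ⟨rfl, by omega⟩⟩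
    apply Real.sqrt_le_sqrt
    rw [Nat.cast_sub hc]
    gcongr
    linarith [h1.1]

/-- The comparison with the coarse walk is exact in time only at bridge ends; moving to `4 * k`
costs the visits in a window of length at most `timeBound`. -/
lemma abs_visits_sub_coarse_le (h : Regular z M lam) (hz : Signs z) (hr : Recurrent z)
    (hl : 0 ≤ lam) {k n : ℕ} (hk : k ≤ n) (hM : 6 * n ≤ M) (hn : 6 * lam ≤ n) (i : ℤ) :
    |(visits (walk z) (4 * k) (2 * i) : ℝ) - 2 * visits (walk (coarse z)) k i| ≤
      √(2 * lam * timeBound n lam) + 1 + siteBound M lam := by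
  have h0 := h.bridgeEnd_le hz hk (by omega) hn
  have h1 := abs_le.1 (h.abs_visits_fine_sub_coarse_le hz hr hl (k := k) (by omega) i)
  obtain ⟨s, u, hs, hu, hsu, hc⟩ := h.exists_window hz hr hl hk hM hn
  have h2 := h.visits_sub_le hz hl hs hu (2 * i)
  have h3 : (visits (walk z) s (2 * i) : ℝ) ≤ visits (walk z) (s + u) (2 * i) := by
    exact_mod_cast visits_mono (walk z) (2 * i) (by omega : s ≤ s + u)
  rcases hc with ⟨h4, h5⟩ | ⟨h4, h5⟩ <;> rw [h5, h4] at h2 h3 <;> rw [abs_le] <;>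
    constructor <;> linarith [h1.1, h1.2]

lemma abs_walk_sub_coarse_le (h : Regular z M lam) (hz : Signs z) (hr : Recurrent z)
    (hl : 0 ≤ lam) {k n : ℕ} (hk : k ≤ n) (hM : 6 * n ≤ M) (hn : 6 * lam ≤ n) :
    |(walk z (4 * k) : ℝ) - 2 * walk (coarse z) k| ≤ √(2 * lam * timeBound n lam) := by
  obtain ⟨s, u, hs, hu, hsu, hc⟩ := h.exists_window hz hr hl hk hM hn
  have h2 := h.abs_walk_sub_le hs hu
  have h3 : (2 * walk (coarse z) k : ℝ) = walk z (2 * bridgeEnd z k) := by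
    rw [walk_bridgeEnd hr hz]; push_cast; ring
  rw [h3]
  rcases hc with ⟨h4, h5⟩ | ⟨h4, h5⟩ <;> rw [h5, h4] at h2
  · rw [abs_sub_comm]; linarith
  · linarith

end Regular


/-! ### From lattice estimates to interpolated functions -/

/-- Shrinking and linear interpolation of a walk. -/
noncomputable def pathInterp (m : ℕ) (S : ℕ → ℤ) (t : ℝ) : ℝ :=
  ((S ⌊t * 2 ^ (2 * m)⌋₊ : ℝ) + (t * 2 ^ (2 * m) - ⌊t * 2 ^ (2 * m)⌋₊) *
    ((S (⌊t * 2 ^ (2 * m)⌋₊ + 1) : ℝ) - S ⌊t * 2 ^ (2 * m)⌋₊)) / 2 ^ m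

/-- Linear interpolation of a discrete local time in space, at a fixed time. -/
noncomputable def spaceInterp (ℓ : ℤ → ℕ) (r : ℝ) : ℝ :=
  (1 - Int.fract r) * ℓ ⌊r⌋ + Int.fract r * ℓ (⌊r⌋ + 1)

lemma floor_frac {t : ℝ} (ht : 0 ≤ t) : 0 ≤ t - ⌊t⌋₊ ∧ t - ⌊t⌋₊ < 1 :=
  ⟨sub_nonneg.2 (Nat.floor_le ht), by linarith [Nat.lt_floor_add_one t]⟩

lemma abs_pathInterp_sub_le {z : ℕ → ℤ} (hz : Signs z) (m : ℕ) {t : ℝ} (ht : 0 ≤ t) :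
    |pathInterp m (walk z) t - walk z ⌊t * 2 ^ (2 * m)⌋₊ / 2 ^ m| ≤ 1 / 2 ^ m := by
  obtain ⟨h1, h2⟩ := floor_frac (t := t * 2 ^ (2 * m)) (by positivity)
  set k := ⌊t * 2 ^ (2 * m)⌋₊
  rw [pathInterp, ← sub_div, abs_div, abs_of_pos (by positivity : (0 : ℝ) < 2 ^ m)]
  gcongr
  rw [walk_succ, add_sub_cancel_left, abs_mul, abs_of_nonneg h1]
  push_cast
  rw [add_sub_cancel_left]
  rcases hz k with h | h <;> rw [h] <;> simp <;> linarith

/-- During one time step each count grows by at most 1, so interpolation in time can be dropped at a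
cost of one lattice unit, whichever triangle the point is in. -/
lemma abs_interpolate_sub_le (m : ℕ) {ℓ : ℕ → ℤ → ℕ}
    (hl : ∀ k i, ℓ k i ≤ ℓ (k + 1) i ∧ ℓ (k + 1) i ≤ ℓ k i + 1) {t : ℝ} (ht : 0 ≤ t) (x : ℝ) :
    |interpolate m ℓ t x - spaceInterp (ℓ ⌊t * 2 ^ (2 * m)⌋₊) (x * 2 ^ m) / 2 ^ m| ≤
      1 / 2 ^ m := by
  obtain ⟨h1, h2⟩ := floor_frac (t := t * 2 ^ (2 * m)) (by positivity)
  have h3 := Int.fract_nonneg (x * 2 ^ m)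
  have h4 := Int.fract_lt_one (x * 2 ^ m)
  have h5 : x * 2 ^ m - ⌊x * 2 ^ m⌋ = Int.fract (x * 2 ^ m) := rfl
  simp only [interpolate, spaceInterp, h5]
  set k := ⌊t * 2 ^ (2 * m)⌋₊
  set j := ⌊x * 2 ^ m⌋
  set v := Int.fract (x * 2 ^ m)
  set u := t * 2 ^ (2 * m) - k
  have hp : (0 : ℝ) < 2 ^ m := by positivity
  have a1 : (ℓ k j : ℝ) ≤ ℓ (k + 1) j := by exact_mod_cast (hl k j).1
  have a2 : (ℓ (k + 1) j : ℝ) ≤ ℓ k j + 1 := by exact_mod_cast (hl k j).2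
  have b1 : (ℓ k (j + 1) : ℝ) ≤ ℓ (k + 1) (j + 1) := by exact_mod_cast (hl k (j + 1)).1
  have b2 : (ℓ (k + 1) (j + 1) : ℝ) ≤ ℓ k (j + 1) + 1 := by exact_mod_cast (hl k (j + 1)).2
  split_ifs with h
  · rw [show ∀ a b c : ℝ, a / 2 ^ m + u * (b / 2 ^ m - c / 2 ^ m) + v * (c / 2 ^ m - a / 2 ^ m)
      - ((1 - v) * a + v * c) / 2 ^ m = u * (b - c) / 2 ^ m by intros; ring, abs_div, abs_of_pos hp]
    gcongr
    rw [abs_le]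
    constructor <;> nlinarith
  · rw [show ∀ a b c d : ℝ, a / 2 ^ m + u * (b / 2 ^ m - a / 2 ^ m) + v * (c / 2 ^ m - b / 2 ^ m)
      - ((1 - v) * a + v * d) / 2 ^ m = ((u - v) * (b - a) + v * (c - d)) / 2 ^ m by intros; ring,
      abs_div, abs_of_pos hp]
    gcongr
    rw [abs_le]
    constructor <;> nlinarith

lemma visits_step (S : ℕ → ℤ) (k : ℕ) (i : ℤ) :
    visits S k i ≤ visits S (k + 1) i ∧ visits S (k + 1) i ≤ visits S k i + 1 := by
  rw [visits_succ]
  split_ifs <;> omega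

lemma visits_le_add (S : ℕ → ℤ) (k d : ℕ) (i : ℤ) :
    visits S k i ≤ visits S (k + d) i ∧ visits S (k + d) i ≤ visits S k i + d := by
  induction d with
  | zero => simp
  | succ d ih =>
    have := visits_step S (k + d) i
    rw [← add_assoc]
    omega

lemma abs_spaceInterp_sub_le {f g : ℤ → ℕ} {c : ℝ} (r : ℝ) (h : ∀ i, |(f i : ℝ) - g i| ≤ c) :
    |spaceInterp f r - spaceInterp g r| ≤ c := by
  have h3 := Int.fract_nonneg r
  have h4 := (Int.fract_lt_one r).le
  have h5 := abs_le.1 (h ⌊r⌋)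
  have h6 := abs_le.1 (h (⌊r⌋ + 1))
  rw [spaceInterp, spaceInterp, abs_le]
  generalize Int.fract r = v at *
  constructor <;> nlinarith

/-- Even fine sites are coarse sites. An odd fine site is the midpoint of a coarse cell, where the
affine interpolant is compared with `f` through the two even neighbours, at the extra cost `d`. -/
lemma abs_spaceInterp_two_mul_sub_le {f g : ℤ → ℕ} {c d : ℝ} (r : ℝ)
    (h : ∀ i, |(f (2 * i) : ℝ) - 2 * g i| ≤ c) (hd : ∀ i, |(f (i + 1) : ℝ) - f i| ≤ d) :
    |spaceInterp f (2 * r) - 2 * spaceInterp g r| ≤ c + d := by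
  have h3 := Int.fract_nonneg r
  have h4 := (Int.fract_lt_one r).le
  have h5 := abs_le.1 (h ⌊r⌋)
  have h6 := abs_le.1 (h (⌊r⌋ + 1))
  have h7 := abs_le.1 (hd (2 * ⌊r⌋))
  have h8 := abs_le.1 (hd (2 * ⌊r⌋ + 1))
  rw [show 2 * ⌊r⌋ + 1 + 1 = 2 * (⌊r⌋ + 1) by ring] at h8
  rw [spaceInterp, spaceInterp, abs_le]
  by_cases hv : Int.fract r < 1 / 2
  · have e1 : ⌊2 * r⌋ = 2 * ⌊r⌋ := by
      rw [Int.floor_eq_iff]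
      push_cast
      have := Int.self_sub_floor r
      constructor <;> linarith
    have e2 : Int.fract (2 * r) = 2 * Int.fract r := by
      rw [← Int.self_sub_floor, ← Int.self_sub_floor, e1]; push_cast; ring
    rw [e1, e2]
    generalize Int.fract r = v at *
    constructor <;> nlinarith
  · have e1 : ⌊2 * r⌋ = 2 * ⌊r⌋ + 1 := by
      rw [Int.floor_eq_iff]
      push_cast
      have := Int.self_sub_floor r
      have := Int.fract_lt_one r
      constructor <;> linarith
    have e2 : Int.fract (2 * r) = 2 * Int.fract r - 1 := by
      rw [← Int.self_sub_floor, ← Int.self_sub_floor, e1]; push_cast; ring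
    rw [e1, e2, show 2 * ⌊r⌋ + 1 + 1 = 2 * (⌊r⌋ + 1) by ring]
    generalize Int.fract r = v at *
    constructor <;> nlinarith

lemma abs_spaceInterp_sub_of_near {f : ℤ → ℕ} {d : ℝ} (hd : ∀ i, |(f (i + 1) : ℝ) - f i| ≤ d)
    {r r' : ℝ} (hr : |r - r'| ≤ 1) : |spaceInterp f r - spaceInterp f r'| ≤ 3 * d := by
  have key : ∀ r : ℝ, |spaceInterp f r - f ⌊r⌋| ≤ d := by
    intro r
    have h3 := Int.fract_nonneg r
    have h4 := (Int.fract_lt_one r).le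
    have h5 := abs_le.1 (hd ⌊r⌋)
    rw [spaceInterp, abs_le]
    generalize Int.fract r = v at *
    constructor <;> nlinarith
  have k1 := abs_le.1 (key r)
  have k2 := abs_le.1 (key r')
  have h0 : 0 ≤ d := (abs_nonneg _).trans (hd 0)
  rw [abs_le] at hr
  have h1 : ⌊r⌋ ≤ ⌊r'⌋ + 1 := by
    rw [← Int.floor_add_one]; exact Int.floor_mono (by linarith)
  have h2 : ⌊r'⌋ ≤ ⌊r⌋ + 1 := by
    rw [← Int.floor_add_one]; exact Int.floor_mono (by linarith)
  have k3 : |(f ⌊r⌋ : ℝ) - f ⌊r'⌋| ≤ d := by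
    obtain h | h | h : ⌊r⌋ = ⌊r'⌋ ∨ ⌊r⌋ = ⌊r'⌋ + 1 ∨ ⌊r'⌋ = ⌊r⌋ + 1 := by omega
    · rw [h]; simpa using h0
    · rw [h]; exact hd _
    · rw [h, abs_sub_comm]; exact hd _
  rw [abs_le] at *
  constructor <;> linarith [k3.1, k3.2]

lemma floor_four_mul {t : ℝ} (ht : 0 ≤ t) (m : ℕ) :
    ∃ d ≤ 3, ⌊t * 2 ^ (2 * (m + 1))⌋₊ = 4 * ⌊t * 2 ^ (2 * m)⌋₊ + d := by
  obtain ⟨h1, h2⟩ := floor_frac (t := t * 2 ^ (2 * m)) (by positivity)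
  set k := ⌊t * 2 ^ (2 * m)⌋₊
  have h3 : t * 2 ^ (2 * (m + 1)) = 4 * (t * 2 ^ (2 * m)) := by ring
  have h4 : 4 * k ≤ ⌊t * 2 ^ (2 * (m + 1))⌋₊ := by
    apply Nat.le_floor; rw [h3]; push_cast; linarith
  have h5 : ⌊t * 2 ^ (2 * (m + 1))⌋₊ < 4 * k + 4 := by
    rw [Nat.floor_lt (by positivity), h3]; push_cast; linarith
  exact ⟨_, by omega, (Nat.add_sub_cancel' h4).symm⟩

lemma abs_le_div_iff_abs_mul_le {a c p : ℝ} (hp : 0 < p) : |a| ≤ c / p ↔ |a * p| ≤ c := by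
  rw [abs_mul, abs_of_pos hp, le_div_iff₀ hp]

/-- In fine lattice units the fine interpolation error is 1 and the coarse one 2, whence the `3`. -/
lemma abs_sub_le_of_rescale {m : ℕ} {A B a c e : ℝ} (h1 : |A - a / 2 ^ (m + 1)| ≤ 1 / 2 ^ (m + 1))
    (h2 : |B - c / 2 ^ m| ≤ 1 / 2 ^ m) (h : |a - 2 * c| ≤ e) :
    |A - B| ≤ (3 + e) / 2 ^ (m + 1) := by
  have hp : (0 : ℝ) < 2 ^ m := by positivity
  have e1 : (A - a / 2 ^ (m + 1)) * 2 ^ (m + 1) = A * 2 ^ (m + 1) - a := by field_simp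
  have e2 : (B - c / 2 ^ m) * 2 ^ m = B * 2 ^ m - c := by field_simp
  rw [abs_le_div_iff_abs_mul_le (by positivity), e1] at h1
  rw [abs_le_div_iff_abs_mul_le (by positivity), e2] at h2
  rw [abs_le_div_iff_abs_mul_le (by positivity)]
  rw [pow_succ] at *
  rw [abs_le] at *
  constructor <;> linarith [h1.1, h1.2, h2.1, h2.2, h.1, h.2]

section Level

variable {z : ℕ → ℤ} {n M : ℕ} {lam : ℝ} (h : Regular z M lam) (hz : Signs z) (hl : 0 ≤ lam)
include h hz hl

/-- The constant 9 in `levelBound` is 3 for interpolation, 3 for the at most three fine steps after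
`4 * k`, 1 from the window and 2 from neighbouring sites. One `siteBound` comes from the bridge
ends, two from neighbouring sites. -/
lemma abs_interpolate_visits_succ_sub_le (hr : Recurrent z) (hM : 6 * n ≤ M) (hn : 6 * lam ≤ n)
    (m : ℕ) {t : ℝ} (ht : 0 ≤ t) (htn : ⌊t * 2 ^ (2 * m)⌋₊ ≤ n) (x : ℝ) :
    |interpolate (m + 1) (visits (walk z)) t x - interpolate m (visits (walk (coarse z))) t x| ≤
      levelBound n M lam / 2 ^ (m + 1) := by
  have h1 := abs_interpolate_sub_le (m + 1) (visits_step (walk z)) ht x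
  have h2 := abs_interpolate_sub_le m (visits_step (walk (coarse z))) ht x
  obtain ⟨d, hd, hk⟩ := floor_four_mul ht m
  set k := ⌊t * 2 ^ (2 * m)⌋₊
  rw [hk] at h1
  have h3 : |spaceInterp (visits (walk z) (4 * k + d)) (x * 2 ^ (m + 1)) -
      spaceInterp (visits (walk z) (4 * k)) (x * 2 ^ (m + 1))| ≤ 3 := by
    apply abs_spaceInterp_sub_le
    intro i
    have h4 := visits_le_add (walk z) (4 * k) d i
    have h5 : (visits (walk z) (4 * k) i : ℝ) ≤ visits (walk z) (4 * k + d) i := by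
      exact_mod_cast h4.1
    have h6 : (visits (walk z) (4 * k + d) i : ℝ) ≤ visits (walk z) (4 * k) i + 3 := by
      exact_mod_cast (by omega : visits (walk z) (4 * k + d) i ≤ visits (walk z) (4 * k) i + 3)
    rw [abs_le]
    constructor <;> linarith
  have h4 := abs_spaceInterp_two_mul_sub_le (x * 2 ^ m)
    (h.abs_visits_sub_coarse_le hz hr hl htn hM hn)
    (h.abs_visits_succ_sub_le hz hl (n := 4 * k) (by omega))
  rw [show 2 * (x * 2 ^ m) = x * 2 ^ (m + 1) by ring] at h4
  refine (abs_sub_le_of_rescale h1 h2 ((abs_sub_le _ _ _).trans (add_le_add h3 h4))).trans ?_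
  unfold levelBound
  exact div_le_div_of_nonneg_right (by linarith) (by positivity)

lemma abs_pathInterp_succ_sub_le (hr : Recurrent z) (hM : 6 * n ≤ M) (hn : 6 * lam ≤ n)
    (m : ℕ) {t : ℝ} (ht : 0 ≤ t) (htn : ⌊t * 2 ^ (2 * m)⌋₊ ≤ n) :
    |pathInterp (m + 1) (walk z) t - pathInterp m (walk (coarse z)) t| ≤
      levelBound n M lam / 2 ^ (m + 1) := by
  have h1 := abs_pathInterp_sub_le hz (m + 1) ht
  have h2 := abs_pathInterp_sub_le hz.coarse m ht
  obtain ⟨d, hd, hk⟩ := floor_four_mul ht m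
  set k := ⌊t * 2 ^ (2 * m)⌋₊
  rw [hk] at h1
  have h3 : |(walk z (4 * k + d) : ℝ) - walk z (4 * k)| ≤ 3 := by
    have : ∀ d : ℕ, |walk z (4 * k + d) - walk z (4 * k)| ≤ (d : ℤ) := by
      intro d
      induction d with
      | zero => simp
      | succ d ih =>
        rw [← add_assoc, walk_succ]
        rw [abs_le] at *
        push_cast
        rcases hz (4 * k + d) with h | h <;> rw [h] <;> omega
    exact_mod_cast (this d).trans (by omega)
  have h4 := h.abs_walk_sub_coarse_le hz hr hl htn hM hn
  have h5 : 0 ≤ siteBound M lam := Regular.siteBound_nonneg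
  refine (abs_sub_le_of_rescale h1 h2 ((abs_sub_le _ _ _).trans (add_le_add h3 h4))).trans ?_
  unfold levelBound
  exact div_le_div_of_nonneg_right (by linarith) (by positivity)

lemma abs_interpolate_up_sub_down_le (m : ℕ) {t : ℝ} (ht : 0 ≤ t)
    (htM : ⌊t * 2 ^ (2 * m)⌋₊ + 1 ≤ M) (x : ℝ) :
    |interpolate m (upVisits (walk z)) t x - interpolate m (downVisits (walk z)) t x| ≤
      siteBound M lam / 2 ^ m := by
  obtain ⟨h1, h2⟩ := floor_frac (t := t * 2 ^ (2 * m)) (by positivity)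
  have h3 := Int.fract_nonneg (x * 2 ^ m)
  have h4 := Int.fract_lt_one (x * 2 ^ m)
  have h5 : x * 2 ^ m - ⌊x * 2 ^ m⌋ = Int.fract (x * 2 ^ m) := rfl
  simp only [interpolate, h5]
  set k := ⌊t * 2 ^ (2 * m)⌋₊
  set j := ⌊x * 2 ^ m⌋
  have a1 := abs_le.1 (h.abs_up_sub_down_le hz hl (by omega : k ≤ M) j)
  have a2 := abs_le.1 (h.abs_up_sub_down_le hz hl htM j)
  have a3 := abs_le.1 (h.abs_up_sub_down_le hz hl (by omega : k ≤ M) (j + 1))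
  have a4 := abs_le.1 (h.abs_up_sub_down_le hz hl htM (j + 1))
  generalize Int.fract (x * 2 ^ m) = v at *
  generalize t * 2 ^ (2 * m) - k = u at *
  have hp : (0 : ℝ) < 2 ^ m := by positivity
  rw [abs_le_div_iff_abs_mul_le hp]
  by_cases hc : u ≤ v
  · simp only [if_pos hc]
    -- In barycentric coordinates the difference is a convex combination of its values at the three
    -- corners.
    rw [show ∀ a b c a' b' c' : ℝ, (a / 2 ^ m + u * (b / 2 ^ m - c / 2 ^ m) +
      v * (c / 2 ^ m - a / 2 ^ m) - (a' / 2 ^ m + u * (b' / 2 ^ m - c' / 2 ^ m) +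
      v * (c' / 2 ^ m - a' / 2 ^ m))) * 2 ^ m = (1 - v) * (a - a') + (v - u) * (c - c') +
      u * (b - b') by intros; field_simp; ring, abs_le]
    constructor <;> nlinarith
  · simp only [if_neg hc]
    rw [show ∀ a b c a' b' c' : ℝ, (a / 2 ^ m + u * (b / 2 ^ m - a / 2 ^ m) +
      v * (c / 2 ^ m - b / 2 ^ m) - (a' / 2 ^ m + u * (b' / 2 ^ m - a' / 2 ^ m) +
      v * (c' / 2 ^ m - b' / 2 ^ m))) * 2 ^ m = (1 - u) * (a - a') + (u - v) * (b - b') +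
      v * (c - c') by intros; field_simp; ring, abs_le]
    constructor <;> nlinarith

lemma abs_interpolate_visits_sub_of_near (m : ℕ) {t t' x x' : ℝ} (ht : 0 ≤ t) (ht' : 0 ≤ t')
    (htM : ⌊t * 2 ^ (2 * m)⌋₊ ≤ M) (htt : |t - t'| * 2 ^ (2 * m) ≤ 1)
    (hxx : |x - x'| * 2 ^ m ≤ 1) :
    |interpolate m (visits (walk z)) t x - interpolate m (visits (walk z)) t' x'| ≤
      (9 + 6 * siteBound M lam) / 2 ^ m := by
  have h1 := abs_interpolate_sub_le m (visits_step (walk z)) ht x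
  have h2 := abs_interpolate_sub_le m (visits_step (walk z)) ht' x'
  have hx : |x * 2 ^ m - x' * 2 ^ m| ≤ 1 := by
    rw [← sub_mul, abs_mul, abs_of_pos (by positivity : (0 : ℝ) < 2 ^ m)]; exact hxx
  have ht1 : |t * 2 ^ (2 * m) - t' * 2 ^ (2 * m)| ≤ 1 := by
    rw [← sub_mul, abs_mul, abs_of_pos (by positivity : (0 : ℝ) < 2 ^ (2 * m))]; exact htt
  rw [abs_le] at ht1
  have k1 : ⌊t * 2 ^ (2 * m)⌋₊ ≤ ⌊t' * 2 ^ (2 * m)⌋₊ + 1 := by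
    rw [← Nat.floor_add_one (by positivity)]; exact Nat.floor_mono (by linarith)
  have k2 : ⌊t' * 2 ^ (2 * m)⌋₊ ≤ ⌊t * 2 ^ (2 * m)⌋₊ + 1 := by
    rw [← Nat.floor_add_one (by positivity)]; exact Nat.floor_mono (by linarith)
  set k := ⌊t * 2 ^ (2 * m)⌋₊
  set k' := ⌊t' * 2 ^ (2 * m)⌋₊
  have h3 := abs_spaceInterp_sub_of_near (h.abs_visits_succ_sub_le hz hl htM) hx
  have h4 : |spaceInterp (visits (walk z) k) (x' * 2 ^ m) -
      spaceInterp (visits (walk z) k') (x' * 2 ^ m)| ≤ 1 := by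
    apply abs_spaceInterp_sub_le
    intro i
    obtain h | h | h : k = k' ∨ k = k' + 1 ∨ k' = k + 1 := by omega
    · rw [h]; simp
    · have := visits_step (walk z) k' i
      rw [h, abs_le]
      have a1 : (visits (walk z) k' i : ℝ) ≤ visits (walk z) (k' + 1) i := by
        exact_mod_cast this.1
      have a2 : (visits (walk z) (k' + 1) i : ℝ) ≤ visits (walk z) k' i + 1 := by
        exact_mod_cast this.2
      constructor <;> linarith
    · have := visits_step (walk z) k i
      rw [h, abs_le]
      have a1 : (visits (walk z) k i : ℝ) ≤ visits (walk z) (k + 1) i := by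
        exact_mod_cast this.1
      have a2 : (visits (walk z) (k + 1) i : ℝ) ≤ visits (walk z) k i + 1 := by
        exact_mod_cast this.2
      constructor <;> linarith
  have h5 : |spaceInterp (visits (walk z) k) (x * 2 ^ m) / 2 ^ m -
      spaceInterp (visits (walk z) k') (x' * 2 ^ m) / 2 ^ m| ≤
      (7 + 6 * siteBound M lam) / 2 ^ m := by
    rw [← sub_div, abs_div, abs_of_pos (by positivity : (0 : ℝ) < 2 ^ m)]
    gcongr
    rw [abs_le] at *
    constructor <;> linarith [h3.1, h3.2, h4.1, h4.2]
  rw [show (9 + 6 * siteBound M lam) / 2 ^ m =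
    1 / 2 ^ m + 1 / 2 ^ m + (7 + 6 * siteBound M lam) / 2 ^ m by ring]
  rw [abs_le] at *
  constructor <;> linarith [h1.1, h1.2, h2.1, h2.2, h5.1, h5.2]

end Level

lemma interpolate_up_add_down {z : ℕ → ℤ} (hz : Signs z) (m : ℕ) (t x : ℝ) :
    interpolate m (upVisits (walk z)) t x + interpolate m (downVisits (walk z)) t x =
      interpolate m (visits (walk z)) t x := by
  simp only [interpolate, ← up_add_down hz]
  split_ifs <;> push_cast <;> ring

lemma abs_pathInterp_sub_of_near {z : ℕ → ℤ} (hz : Signs z) (m : ℕ) {t t' : ℝ} (ht : 0 ≤ t)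
    (ht' : 0 ≤ t') (htt : |t - t'| * 2 ^ (2 * m) ≤ 1) :
    |pathInterp m (walk z) t - pathInterp m (walk z) t'| ≤ 3 / 2 ^ m := by
  have h1 := abs_pathInterp_sub_le hz m ht
  have h2 := abs_pathInterp_sub_le hz m ht'
  have ht1 : |t * 2 ^ (2 * m) - t' * 2 ^ (2 * m)| ≤ 1 := by
    rw [← sub_mul, abs_mul, abs_of_pos (by positivity : (0 : ℝ) < 2 ^ (2 * m))]; exact htt
  rw [abs_le] at ht1
  have k1 : ⌊t * 2 ^ (2 * m)⌋₊ ≤ ⌊t' * 2 ^ (2 * m)⌋₊ + 1 := by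
    rw [← Nat.floor_add_one (by positivity)]; exact Nat.floor_mono (by linarith)
  have k2 : ⌊t' * 2 ^ (2 * m)⌋₊ ≤ ⌊t * 2 ^ (2 * m)⌋₊ + 1 := by
    rw [← Nat.floor_add_one (by positivity)]; exact Nat.floor_mono (by linarith)
  set k := ⌊t * 2 ^ (2 * m)⌋₊
  set k' := ⌊t' * 2 ^ (2 * m)⌋₊
  have h3 : |(walk z k : ℝ) - walk z k'| ≤ 1 := by
    obtain h | h | h : k = k' ∨ k = k' + 1 ∨ k' = k + 1 := by omega
    · rw [h]; simp
    · rw [h, walk_succ]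
      rcases hz k' with h | h <;> rw [h] <;> simp
    · rw [h, walk_succ]
      rcases hz k with h | h <;> rw [h] <;> simp
  have h5 : |(walk z k : ℝ) / 2 ^ m - walk z k' / 2 ^ m| ≤ 1 / 2 ^ m := by
    rw [← sub_div, abs_div, abs_of_pos (by positivity : (0 : ℝ) < 2 ^ m)]
    gcongr
  rw [show (3 : ℝ) / 2 ^ m = 1 / 2 ^ m + 1 / 2 ^ m + 1 / 2 ^ m by ring]
  rw [abs_le] at *
  constructor <;> linarith [h1.1, h1.2, h2.1, h2.2, h5.1, h5.2]


/-! ### Random signs and the exponential supermartingale -/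

/-- The law of a random sign. -/
noncomputable def coin : Measure ℤ :=
  (1 / 2 : ℝ≥0∞) • Measure.dirac 1 + (1 / 2 : ℝ≥0∞) • Measure.dirac (-1)

instance : IsProbabilityMeasure coin where
  measure_univ := by simp [coin, ENNReal.inv_two_add_inv_two]

/-- The law of a sequence of independent random signs. -/
noncomputable def signLaw : Measure (ℕ → ℤ) := Measure.infinitePi fun _ => coin

instance : IsProbabilityMeasure signLaw := by unfold signLaw; infer_instance

lemma coin_map_neg : coin.map (fun a => -a) = coin := by
  rw [coin, Measure.map_add _ _ measurable_neg, Measure.map_smul, Measure.map_smul,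
    Measure.map_dirac' measurable_neg, Measure.map_dirac' measurable_neg, neg_neg, add_comm]

lemma ae_coin : ∀ᵐ a ∂coin, a = 1 ∨ a = -1 := by
  rw [coin, ae_add_measure_iff]
  refine ⟨Measure.ae_smul_measure ?_ _, Measure.ae_smul_measure ?_ _⟩ <;>
  · rw [ae_dirac_eq]; simp

lemma ae_signs : ∀ᵐ z ∂signLaw, Signs z := by
  refine ae_all_iff.2 fun i => ?_
  exact (measurePreserving_eval_infinitePi (fun _ : ℕ => coin) i).quasiMeasurePreserving.ae ae_coin

lemma measurePreserving_mul_signs {δ : ℕ → ℤ} (hδ : Signs δ) :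
    MeasurePreserving (fun (z : ℕ → ℤ) i => z i * δ i) signLaw signLaw := by
  refine ⟨by fun_prop, ?_⟩
  rw [signLaw, Measure.infinitePi_map_pi (μ := fun _ : ℕ => coin) (f := fun i a => a * δ i)
    (fun i => by fun_prop)]
  congr 1
  ext1 i
  rcases hδ i with h | h
  · simp [h]
  · simp only [h, mul_neg, mul_one, coin_map_neg]

/-- Change of the sign of the `n`-th step. -/
def flipAt (n : ℕ) (z : ℕ → ℤ) (i : ℕ) : ℤ := z i * if i = n then -1 else 1

lemma measurePreserving_flipAt (n : ℕ) : MeasurePreserving (flipAt n) signLaw signLaw :=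
  measurePreserving_mul_signs fun i => by by_cases h : i = n <;> simp [h]

lemma flipAt_of_ne {n i : ℕ} (h : i ≠ n) (z : ℕ → ℤ) : flipAt n z i = z i := by simp [flipAt, h]

lemma flipAt_self (n : ℕ) (z : ℕ → ℤ) : flipAt n z n = -z n := by simp [flipAt]

/-- Coefficients depending on the past of the sequence only. -/
def Predictable (a : (ℕ → ℤ) → ℕ → ℤ) : Prop :=
  ∀ z z' n, (∀ j < n, z j = z' j) → a z n = a z' n

namespace Predictable

variable {a : (ℕ → ℤ) → ℕ → ℤ} (ha : Predictable a)
include ha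

/-- A predictable coefficient factors through finitely many integer coordinates, a countable space
on which every function is measurable. -/
lemma measurable (n : ℕ) : Measurable fun z => a z n := by
  have : (fun z => a z n) = (fun w : Fin n → ℤ => a (fun j => if h : j < n then w ⟨j, h⟩ else 0) n) ∘
      fun z j => z j := by
    ext z
    exact ha _ _ _ fun j hj => by simp [hj]
  rw [this]
  exact (measurable_of_countable _).comp (by fun_prop)

lemma flipAt_eq {j n : ℕ} (hj : j ≤ n) (z : ℕ → ℤ) : a (flipAt n z) j = a z j :=
  ha _ _ _ fun i hi => flipAt_of_ne (by omega) z

/-- Flipping the last step preserves the law and all coefficients up to that step. Averaging over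
the flip replaces the last exponential factor by a `cosh`, which the compensator dominates. This
avoids conditional expectations. -/
lemma lintegral_exp_le_one (θ : ℝ) (n : ℕ) :
    ∫⁻ z, ENNReal.ofReal (Real.exp (θ * ∑ j ∈ Finset.range n, (a z j : ℝ) * z j -
      θ ^ 2 / 2 * ∑ j ∈ Finset.range n, (a z j : ℝ) ^ 2)) ∂signLaw ≤ 1 := by
  have hm : ∀ j, Measurable fun z : ℕ → ℤ => (a z j : ℝ) := fun j =>
    (measurable_of_countable (fun a : ℤ => (a : ℝ))).comp (ha.measurable j)
  have hm' : ∀ j, Measurable fun z : ℕ → ℤ => (z j : ℝ) := fun j =>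
    (measurable_of_countable (fun a : ℤ => (a : ℝ))).comp (measurable_pi_apply j)
  induction n with
  | zero => simp
  | succ n ih =>
    set g : ℕ → (ℕ → ℤ) → ℝ := fun n z => θ * ∑ j ∈ Finset.range n, (a z j : ℝ) * z j -
      θ ^ 2 / 2 * ∑ j ∈ Finset.range n, (a z j : ℝ) ^ 2 with hg
    have hgm : ∀ n, Measurable (g n) := fun n => by fun_prop
    change ∫⁻ z, ENNReal.ofReal (Real.exp (g (n + 1) z)) ∂signLaw ≤ 1
    change ∫⁻ z, ENNReal.ofReal (Real.exp (g n z)) ∂signLaw ≤ 1 at ih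
    have hG : ∀ n, Measurable fun z => ENNReal.ofReal (Real.exp (g n z)) := fun n => by fun_prop
    have h1 : ∫⁻ z, ENNReal.ofReal (Real.exp (g (n + 1) (flipAt n z))) ∂signLaw =
        ∫⁻ z, ENNReal.ofReal (Real.exp (g (n + 1) z)) ∂signLaw :=
      (measurePreserving_flipAt n).lintegral_comp (hG (n + 1))
    have h2 : ∫⁻ z, ENNReal.ofReal (Real.exp (g (n + 1) z)) ∂signLaw +
        ∫⁻ z, ENNReal.ofReal (Real.exp (g (n + 1) (flipAt n z))) ∂signLaw ≤
        2 * ∫⁻ z, ENNReal.ofReal (Real.exp (g n z)) ∂signLaw := by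
      rw [← lintegral_add_left (hG _), ← lintegral_const_mul _ (hG n)]
      refine lintegral_mono_ae ?_
      filter_upwards [ae_signs] with z hz
      rw [← ENNReal.ofReal_add (Real.exp_nonneg _) (Real.exp_nonneg _),
        ← ENNReal.ofReal_ofNat 2, ← ENNReal.ofReal_mul (by norm_num)]
      apply ENNReal.ofReal_le_ofReal
      have e1 : g (n + 1) z = g n z + (θ * a z n * z n - θ ^ 2 / 2 * (a z n : ℝ) ^ 2) := by
        simp only [hg, Finset.sum_range_succ]; ring
      have e2 : g (n + 1) (flipAt n z) =
          g n z + (-(θ * a z n * z n) - θ ^ 2 / 2 * (a z n : ℝ) ^ 2) := by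
        simp only [hg, Finset.sum_range_succ, ha.flipAt_eq le_rfl, flipAt_self]
        have s1 : ∑ j ∈ Finset.range n, (a (flipAt n z) j : ℝ) * flipAt n z j =
            ∑ j ∈ Finset.range n, (a z j : ℝ) * z j := Finset.sum_congr rfl fun j hj => by
          rw [ha.flipAt_eq (Finset.mem_range.1 hj).le, flipAt_of_ne (Finset.mem_range.1 hj).ne]
        have s2 : ∑ j ∈ Finset.range n, (a (flipAt n z) j : ℝ) ^ 2 =
            ∑ j ∈ Finset.range n, (a z j : ℝ) ^ 2 := Finset.sum_congr rfl fun j hj => by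
          rw [ha.flipAt_eq (Finset.mem_range.1 hj).le]
        rw [s1, s2]
        push_cast
        ring
      have e3 := Real.cosh_le_exp_half_sq (θ * a z n * z n)
      have e4 : (θ * a z n * z n) ^ 2 / 2 = θ ^ 2 / 2 * (a z n : ℝ) ^ 2 := by
        rcases hz n with h | h <;> rw [h] <;> push_cast <;> ring
      rw [e4, Real.cosh_eq] at e3
      rw [e1, e2, Real.exp_add, Real.exp_add, Real.exp_sub (θ * a z n * z n),
        Real.exp_sub (-(θ * a z n * z n)), ← mul_add, ← add_div, mul_comm (OfNat.ofNat 2)]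
      gcongr
      rw [div_le_iff₀ (Real.exp_pos _)]
      linarith
    rw [h1, ← two_mul] at h2
    exact ((ENNReal.mul_le_mul_iff_right two_ne_zero ENNReal.ofNat_ne_top).1 h2).trans ih

lemma measure_lt_sum_le (n : ℕ) {v lam : ℝ} (hv : 0 < v) (hl : 0 < lam) :
    signLaw {z | ∑ j ∈ Finset.range n, (a z j : ℝ) ^ 2 ≤ v ∧
      √(2 * lam * v) < ∑ j ∈ Finset.range n, (a z j : ℝ) * z j} ≤
      ENNReal.ofReal (Real.exp (-lam)) := by
  have hm : ∀ j, Measurable fun z : ℕ → ℤ => (a z j : ℝ) := fun j =>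
    (measurable_of_countable (fun a : ℤ => (a : ℝ))).comp (ha.measurable j)
  have hm' : ∀ j, Measurable fun z : ℕ → ℤ => (z j : ℝ) := fun j =>
    (measurable_of_countable (fun a : ℤ => (a : ℝ))).comp (measurable_pi_apply j)
  -- The optimal exponent: the linear term is `2 * lam` and the compensator at most `lam`.
  set θ : ℝ := √(2 * lam / v) with hθ
  have h1 : θ ^ 2 * v = 2 * lam := by
    rw [hθ, Real.sq_sqrt (by positivity)]; field_simp
  have h2 : θ * √(2 * lam * v) = 2 * lam := by
    rw [hθ, ← Real.sqrt_mul (by positivity), show 2 * lam / v * (2 * lam * v) = (2 * lam) ^ 2 by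
      field_simp, Real.sqrt_sq (by positivity)]
  have h0 : 0 ≤ θ := Real.sqrt_nonneg _
  calc _ ≤ signLaw {z | ENNReal.ofReal (Real.exp lam) ≤
          ENNReal.ofReal (Real.exp (θ * ∑ j ∈ Finset.range n, (a z j : ℝ) * z j -
          θ ^ 2 / 2 * ∑ j ∈ Finset.range n, (a z j : ℝ) ^ 2))} := by
        refine measure_mono ?_
        rintro z ⟨hz1, hz2⟩
        apply ENNReal.ofReal_le_ofReal
        apply Real.exp_le_exp.2
        have h3 := mul_le_mul_of_nonneg_left hz2.le h0
        have h4 := mul_le_mul_of_nonneg_left hz1 (sq_nonneg θ)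
        linarith
    _ ≤ _ := meas_ge_le_lintegral_div (by fun_prop) (by simp [Real.exp_pos]) ENNReal.ofReal_ne_top
    _ ≤ 1 / ENNReal.ofReal (Real.exp lam) := by
        gcongr
        exact ha.lintegral_exp_le_one θ n
    _ = _ := by rw [Real.exp_neg, ENNReal.ofReal_inv_of_pos (Real.exp_pos _), one_div]

lemma neg : Predictable fun z n => -a z n := fun z z' n h => by
  simp only [ha z z' n h]

lemma measure_not_concentrated_le (n : ℕ) {v lam : ℝ} (hv : 0 ≤ v) (hl : 0 < lam) :
    signLaw {z | ¬ Concentrated z (a z) n v lam} ≤ ENNReal.ofReal (2 * Real.exp (-lam)) := by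
  -- For `v = 0` the exponent would be undefined, but then all coefficients vanish and so does the
  -- sum.
  rcases hv.eq_or_lt with rfl | hv
  · refine (measure_mono_null ?_ measure_empty).trans_le zero_le
    rintro z hz
    exfalso
    apply hz
    intro h
    rw [Finset.sum_eq_zero]
    · simp
    · intro j hj
      have h2 := (Finset.sum_eq_zero_iff_of_nonneg (fun j _ => sq_nonneg (a z j : ℝ))).1
        (le_antisymm h (Finset.sum_nonneg fun j _ => sq_nonneg _)) j hj
      rw [pow_eq_zero_iff two_ne_zero] at h2
      simp [h2]
  · calc _ ≤ signLaw ({z | ∑ j ∈ Finset.range n, (a z j : ℝ) ^ 2 ≤ v ∧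
          √(2 * lam * v) < ∑ j ∈ Finset.range n, (a z j : ℝ) * z j} ∪
          {z | ∑ j ∈ Finset.range n, ((-a z j : ℤ) : ℝ) ^ 2 ≤ v ∧
          √(2 * lam * v) < ∑ j ∈ Finset.range n, ((-a z j : ℤ) : ℝ) * z j}) := by
          refine measure_mono ?_
          intro z hz
          simp only [Concentrated, mem_ofPred_eq, Classical.not_imp, not_le, lt_abs] at hz
          obtain ⟨h1, h2 | h2⟩ := hz
          · exact Or.inl ⟨h1, h2⟩
          · refine Or.inr ⟨by simpa using h1, by simpa using h2⟩
      _ ≤ _ := measure_union_le _ _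
      _ ≤ ENNReal.ofReal (Real.exp (-lam)) + ENNReal.ofReal (Real.exp (-lam)) :=
          add_le_add (ha.measure_lt_sum_le n hv hl) (ha.neg.measure_lt_sum_le n hv hl)
      _ = _ := by
          rw [← ENNReal.ofReal_add (Real.exp_nonneg _) (Real.exp_nonneg _)]; congr 1; ring

end Predictable

/-! ### Predictability of the coefficients and the union bound -/

lemma walk_congr {z z' : ℕ → ℤ} {n : ℕ} (h : ∀ j < n, z j = z' j) {k : ℕ} (hk : k ≤ n) :
    walk z k = walk z' k :=
  Finset.sum_congr rfl fun j hj => h j ((Finset.mem_range.1 hj).trans_le hk)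

lemma predictable_step (s : ℕ) : Predictable fun _ => stepCoeff s := fun _ _ _ _ => rfl

lemma predictable_tanaka (s : ℕ) (i : ℤ) : Predictable fun z => tanakaCoeff z s i :=
  fun z z' n h => by simp only [tanakaCoeff, walk_congr h le_rfl]

lemma predictable_site (i : ℤ) : Predictable fun z => siteCoeff z i :=
  fun z z' n h => by simp only [siteCoeff, walk_congr h le_rfl]

lemma predictable_exit : Predictable fun z => exitCoeff z := by
  intro z z' n h
  simp only [exitCoeff]
  split_ifs with hn
  · exact h _ (by omega)
  · rfl

lemma predictable_exitSite (i : ℤ) : Predictable fun z => exitSiteCoeff z i := by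
  intro z z' n h
  simp only [exitSiteCoeff, walk_congr h (Nat.sub_le n 1)]
  split_ifs with hn
  · exact h _ (by omega)
  · rfl

lemma measure_biUnion_le_ofReal {α ι : Type*} [MeasurableSpace α] (μ : Measure α) (s : Finset ι)
    (A : ι → Set α) {c : ℝ} (h : ∀ i ∈ s, μ (A i) ≤ ENNReal.ofReal c) :
    μ (⋃ i ∈ s, A i) ≤ ENNReal.ofReal (s.card * c) :=
  (measure_biUnion_finset_le s A).trans <| (Finset.sum_le_card_nsmul s _ _ h).trans_eq <| by
    rw [nsmul_eq_mul, ENNReal.ofReal_mul (by positivity), ENNReal.ofReal_natCast]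

/-- A union bound: the five families have at most `40 * M ^ 3` members, the Tanaka family being the
only cubic one, and each fails with probability at most `2 * exp (-lam)`. -/
lemma measure_not_regular_le {M : ℕ} (hM : 1 ≤ M) {lam : ℝ} (hl : 0 < lam) :
    signLaw {z | ¬ Regular z M lam} ≤ ENNReal.ofReal (80 * M ^ 3 * Real.exp (-lam)) := by
  have hV : 0 ≤ visitBound M lam := by unfold visitBound; positivity
  obtain ⟨c, hc⟩ : ∃ c : ℝ, c = 2 * Real.exp (-lam) := ⟨_, rfl⟩
  have hc0 : 0 ≤ c := by rw [hc]; positivity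
  set R := Finset.range (M + 1)
  set I := Finset.Icc (-(M : ℤ)) M
  set J := Finset.Icc (-(2 * M : ℤ)) (2 * M)
  have hR : (R.card : ℝ) = M + 1 := by simp [R]
  have hI : (I.card : ℝ) = 2 * M + 1 := by
    have : I.card = 2 * M + 1 := by simp only [I, Int.card_Icc]; omega
    rw [this]; push_cast; ring
  have hJ : (J.card : ℝ) = 4 * M + 1 := by
    have : J.card = 4 * M + 1 := by simp only [J, Int.card_Icc]; omega
    rw [this]; push_cast; ring
  have b1 := measure_biUnion_le_ofReal (c := c) signLaw (R ×ˢ R)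
    (fun p => {z | ¬ Concentrated z (stepCoeff p.1) (p.1 + p.2) (p.2 : ℕ) lam})
    fun p _ => by
      rw [hc]
      exact (predictable_step p.1).measure_not_concentrated_le _ (by positivity) hl
  have b2 := measure_biUnion_le_ofReal (c := c) signLaw (R ×ˢ R ×ˢ J)
    (fun p => {z | ¬ Concentrated z (tanakaCoeff z p.1 p.2.2) (p.1 + p.2.1) (p.2.1 : ℕ) lam})
    fun p _ => by
      rw [hc]
      exact (predictable_tanaka p.1 p.2.2).measure_not_concentrated_le _ (by positivity) hl
  have b3 := measure_biUnion_le_ofReal (c := c) signLaw (R ×ˢ I)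
    (fun p => {z | ¬ Concentrated z (siteCoeff z p.2) p.1 (visitBound M lam) lam})
    fun p _ => by rw [hc]; exact (predictable_site p.2).measure_not_concentrated_le _ hV hl
  have b4 := measure_biUnion_le_ofReal (c := c) signLaw R
    (fun p => {z | ¬ Concentrated z (exitCoeff z) (2 * p) p lam})
    fun p _ => by rw [hc]; exact predictable_exit.measure_not_concentrated_le _ (by positivity) hl
  have b5 := measure_biUnion_le_ofReal (c := c) signLaw (R ×ˢ I)
    (fun p => {z | ¬ Concentrated z (exitSiteCoeff z p.2) (2 * p.1) (visitBound M lam) lam})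
    fun p _ => by rw [hc]; exact (predictable_exitSite p.2).measure_not_concentrated_le _ hV hl
  refine (measure_mono ?_).trans <| (measure_union_le _ _).trans <| (add_le_add b1 <|
    (measure_union_le _ _).trans <| add_le_add b2 <| (measure_union_le _ _).trans <|
    add_le_add b3 <| (measure_union_le _ _).trans <| add_le_add b4 b5).trans ?_
  · intro z hz
    by_contra hcon
    apply hz
    simp only [mem_union, mem_iUnion, Finset.mem_product, mem_ofPred_eq, exists_prop, not_or,
      not_exists, not_and, not_not, Prod.forall, R, Finset.mem_range, Nat.lt_succ_iff] at hcon
    obtain ⟨h1, h2, h3, h4, h5⟩ := hcon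
    exact ⟨fun s hs u hu => h1 s u ⟨hs, hu⟩, fun s hs u hu i hi => h2 s u i ⟨hs, hu, hi⟩,
      fun n hn i hi => h3 n i ⟨hn, hi⟩, fun r hr => h4 r hr, fun r hr i hi => h5 r i ⟨hr, hi⟩⟩
  · rw [← ENNReal.ofReal_add (by positivity) (by positivity),
      ← ENNReal.ofReal_add (by positivity) (by positivity),
      ← ENNReal.ofReal_add (by positivity) (by positivity),
      ← ENNReal.ofReal_add (by positivity) (by positivity)]
    apply ENNReal.ofReal_le_ofReal
    simp only [Finset.card_product]
    push_cast
    rw [hR, hI, hJ, hc]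
    have hM' : (1 : ℝ) ≤ M := by exact_mod_cast hM
    have : ((M + 1 : ℝ) * (M + 1) + ((M + 1) * ((M + 1) * (4 * M + 1)) + ((M + 1) * (2 * M + 1) +
        (M + 1 + (M + 1) * (2 * M + 1))))) * 2 ≤ 80 * M ^ 3 := by
      nlinarith [mul_nonneg (sub_nonneg.2 hM') (sub_nonneg.2 hM'),
        mul_nonneg (mul_nonneg (sub_nonneg.2 hM') (sub_nonneg.2 hM')) (sub_nonneg.2 hM')]
    have := mul_le_mul_of_nonneg_right this (Real.exp_nonneg (-lam))
    linarith


/-! ### Recurrence -/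

lemma tendsto_pow_mul_exp_neg_div : Tendsto (fun r : ℕ =>
    ENNReal.ofReal (80 * (r : ℝ) ^ 3 * Real.exp (-(r / 32 : ℝ)))) atTop (𝓝 0) := by
  have h1 : Tendsto (fun r : ℕ => (r : ℝ) / 32) atTop atTop :=
    tendsto_natCast_atTop_atTop.atTop_div_const (by norm_num)
  have h2 := ((Real.tendsto_pow_mul_exp_neg_atTop_nhds_zero 3).comp h1).const_mul (80 * 32 ^ 3)
  rw [mul_zero] at h2
  rw [← ENNReal.ofReal_zero]
  refine ENNReal.tendsto_ofReal (h2.congr fun r => ?_)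
  simp only [Function.comp]
  ring

/-- With `lam = r / 32` the allowed deviation is `r / 4`, so regularity forces at least `3 * r / 8`
exits among `r` pairs, more than `c` once `r ≥ 4 * c + 4`. -/
lemma measure_count_le_eq_zero (c : ℕ) :
    signLaw {z | ∀ r, Nat.count (ExitPair z) r ≤ c} = 0 := by
  refine le_antisymm (ge_of_tendsto tendsto_pow_mul_exp_neg_div ?_) zero_le
  filter_upwards [eventually_ge_atTop (4 * c + 4)] with r hr
  refine le_trans (measure_mono_ae ?_) (measure_not_regular_le (M := r) (by omega)
    (lam := (r : ℝ) / 32) (by have : (0 : ℝ) < r := by exact_mod_cast (by omega : 0 < r)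
                              positivity))
  filter_upwards [ae_signs] with z hz hzc hreg
  have h1 := (abs_le.1 (hreg.abs_exit_sum_le hz le_rfl)).1
  have h2 : √(2 * ((r : ℝ) / 32) * r) = r / 4 := by
    rw [show 2 * ((r : ℝ) / 32) * r = (r / 4) ^ 2 by ring, Real.sqrt_sq (by positivity)]
  have h3 : (Nat.count (ExitPair z) r : ℝ) ≤ c := by exact_mod_cast hzc r
  have h4 : (4 * c + 4 : ℝ) ≤ r := by exact_mod_cast hr
  linarith

lemma ae_recurrent : ∀ᵐ z ∂signLaw, Recurrent z := by
  have h : ∀ᵐ z ∂signLaw, ∀ c, ¬ ∀ r, Nat.count (ExitPair z) r ≤ c :=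
    ae_all_iff.2 fun c => by
      rw [ae_iff]
      simpa only [not_not] using measure_count_le_eq_zero c
  filter_upwards [h] with z hz
  by_contra hfin
  rw [Recurrent, Set.not_infinite] at hfin
  exact hz _ fun r => Nat.count_le_card hfin r

/-! ### Predictable changes of signs -/

section PredictableFlip

variable {a : (ℕ → ℤ) → ℕ → ℤ} (ha : Predictable a) (hs : ∀ z, Signs (a z))
include ha hs

/-- On the event that the coefficient is 1 the map is the identity, elsewhere it is `flipAt n`;
neither event depends on the `n`-th step, so the pieces can be treated separately. -/
lemma measurePreserving_flip_of_predictable (n : ℕ) :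
    MeasurePreserving (fun (z : ℕ → ℤ) i => if i = n then a z n * z n else z i)
      signLaw signLaw := by
  have hm := ha.measurable n
  have hψ : Measurable fun (z : ℕ → ℤ) i => if i = n then a z n * z n else z i := by
    refine measurable_pi_lambda _ fun i => ?_
    by_cases h : i = n
    · simp only [h, if_true]; fun_prop
    · simp only [h, if_false]; fun_prop
  refine ⟨hψ, Measure.ext fun A hA => ?_⟩
  rw [Measure.map_apply hψ hA]
  have hE : MeasurableSet {z | a z n = 1} := hm (measurableSet_singleton 1)
  rw [← measure_inter_add_sdiff _ hE, ← measure_inter_add_sdiff A hE]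
  congr 1
  · congr 1
    ext z
    simp only [mem_inter_iff, mem_preimage, mem_ofPred_eq]
    refine and_congr_left fun h => ?_
    rw [h]
    congr! 1
    ext i
    split_ifs with hi
    · simp [hi]
    · rfl
  · rw [← (measurePreserving_flipAt n).measure_preimage (hA.diff hE).nullMeasurableSet]
    congr 1
    ext z
    simp only [Set.mem_sdiff, mem_preimage, mem_ofPred_eq, ha.flipAt_eq le_rfl]
    refine and_congr_left fun h => ?_
    rw [(hs z n).resolve_left h]
    congr! 1
    ext i
    split_ifs with hi
    · simp [hi, flipAt_self]
    · rw [flipAt_of_ne hi]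

lemma measurePreserving_flip_lt (n : ℕ) :
    MeasurePreserving (fun (z : ℕ → ℤ) i => if i < n then a z i * z i else z i)
      signLaw signLaw := by
  induction n with
  | zero =>
    simp only [not_lt_zero, if_false]
    exact MeasurePreserving.id signLaw
  | succ n ih =>
    -- The latest step is flipped first: this leaves the coefficients of earlier steps unchanged.
    convert ih.comp (measurePreserving_flip_of_predictable ha hs n) using 1
    ext z i
    simp only [Function.comp]
    rcases lt_trichotomy i n with h | h | h
    · have : a (fun i => if i = n then a z n * z n else z i) i = a z i :=
        ha _ _ _ fun j hj => by rw [if_neg (by omega)]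
      rw [if_pos (by omega), if_pos h, if_neg h.ne, this]
    · subst h
      simp
    · rw [if_neg (by omega), if_neg (by omega), if_neg (by omega)]

/-- A cylinder set sees only finitely many coordinates, on which the full flip agrees with a finite
one. -/
lemma measurePreserving_mul_predictable :
    MeasurePreserving (fun (z : ℕ → ℤ) i => a z i * z i) signLaw signLaw := by
  have hm : Measurable fun (z : ℕ → ℤ) i => a z i * z i :=
    measurable_pi_lambda _ fun i => (ha.measurable i).mul (measurable_pi_apply i)
  refine ⟨hm, ?_⟩
  conv_rhs => rw [signLaw]
  refine Measure.eq_infinitePi _ fun s t ht => ?_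
  have hst : MeasurableSet (Set.pi (s : Set ℕ) t) :=
    MeasurableSet.pi s.countable_toSet fun i _ => ht i
  rw [Measure.map_apply hm hst, ← Measure.infinitePi_pi (μ := fun _ : ℕ => coin) fun i _ => ht i]
  change _ = signLaw _
  rw [← (measurePreserving_flip_lt ha hs (s.sup id + 1)).measure_preimage hst.nullMeasurableSet]
  congr 1
  ext z
  simp only [mem_preimage, Set.mem_pi]
  refine forall₂_congr fun i hi => ?_
  have : i < s.sup id + 1 := Nat.lt_succ_of_le (Finset.le_sup (f := id) hi)
  rw [if_pos this]

end PredictableFlip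

/-! ### Measurability -/

section Measurability

variable {α : Type*} [MeasurableSpace α]

lemma measurable_eval_nat {β : Type*} [MeasurableSpace β] [Countable β]
    [MeasurableSingletonClass β] {f : ℕ → α → β} {T : α → ℕ}
    (hf : ∀ n, Measurable (f n)) (hT : Measurable T) : Measurable fun x => f (T x) x := by
  refine measurable_to_countable' fun b => ?_
  have : (fun x => f (T x) x) ⁻¹' {b} = ⋃ n, T ⁻¹' {n} ∩ f n ⁻¹' {b} := by
    ext x; simp
  rw [this]
  exact MeasurableSet.iUnion fun n =>
    (hT (measurableSet_singleton n)).inter (hf n (measurableSet_singleton b))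

lemma measurable_nat_sInf {p : α → ℕ → Prop} (hp : ∀ n, MeasurableSet {x | p x n}) :
    Measurable fun x => sInf {n | p x n} := by
  refine measurable_to_countable' fun n => ?_
  -- The infimum of the empty set is 0, so the value 0 has an additional preimage.
  have : (fun x => sInf {n | p x n}) ⁻¹' {n} =
      ({x | p x n} ∩ ⋂ k < n, {x | p x k}ᶜ) ∪ if n = 0 then ⋂ k, {x | p x k}ᶜ else ∅ := by
    ext x
    simp only [mem_preimage, mem_singleton_iff, mem_union, mem_inter_iff, mem_ofPred_eq,
      mem_iInter, mem_compl_iff]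
    constructor
    · intro h
      by_cases hne : {n | p x n}.Nonempty
      · left
        subst h
        exact ⟨Nat.sInf_mem hne, fun k hk => Nat.notMem_of_lt_sInf hk⟩
      · right
        rw [Set.not_nonempty_iff_eq_empty] at hne
        rw [hne, Nat.sInf_empty] at h
        rw [if_pos h.symm, mem_iInter]
        intro k hk
        have : k ∈ {n | p x n} := hk
        simp [hne] at this
    · rintro (⟨h1, h2⟩ | h)
      · exact le_antisymm (Nat.sInf_le h1) (le_csInf ⟨n, h1⟩ fun k hk => by
          by_contra! hkn
          exact h2 k hkn hk)
      · split_ifs at h with hn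
        · rw [mem_iInter] at h
          have : {n | p x n} = ∅ := by
            ext k; simpa using h k
          rw [this, Nat.sInf_empty, hn]
        · simp at h
  rw [this]
  refine ((hp n).inter (MeasurableSet.iInter fun k => MeasurableSet.iInter fun _ =>
    (hp k).compl)).union ?_
  split_ifs
  · exact MeasurableSet.iInter fun k => (hp k).compl
  · exact MeasurableSet.empty

variable {x : α → ℕ → ℤ} (hx : ∀ i, Measurable fun ω => x ω i)
include hx

lemma measurable_walk (n : ℕ) : Measurable fun ω => walk (x ω) n :=
  Finset.measurable_sum _ fun i _ => hx i

lemma measurable_refineTime (k : ℕ) : Measurable fun ω => refineTime (walk (x ω)) k := by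
  induction k with
  | zero => simp only [refineTime]; fun_prop
  | succ k ih =>
    simp only [refineTime]
    refine measurable_nat_sInf fun n => ?_
    have h1 : Measurable fun ω => walk (x ω) (refineTime (walk (x ω)) k) :=
      measurable_eval_nat (f := fun n ω => walk (x ω) n) (measurable_walk hx) ih
    have h2 : Measurable fun ω => |walk (x ω) n - walk (x ω) (refineTime (walk (x ω)) k)| :=
      (measurable_of_countable (fun a : ℤ => |a|)).comp ((measurable_walk hx n).sub h1)
    exact (measurableSet_lt ih measurable_const).inter (h2 (measurableSet_singleton 2))

lemma measurable_bridgeIndex (i : ℕ) : Measurable fun ω => bridgeIndex (walk (x ω)) i :=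
  measurable_nat_sInf fun k =>
    measurableSet_lt measurable_const (measurable_refineTime hx (k + 1))

lemma measurableSet_exitPair (q : ℕ) : MeasurableSet {ω | ExitPair (x ω) q} :=
  measurableSet_eq_fun (hx _) (hx _)

lemma measurable_count (n : ℕ) : Measurable fun ω => Nat.count (ExitPair (x ω)) n := by
  induction n with
  | zero => simp
  | succ n ih =>
    simp only [Nat.count_succ]
    exact ih.add (Measurable.ite (measurableSet_exitPair hx n) measurable_const measurable_const)

lemma measurable_nth (k : ℕ) : Measurable fun ω => Nat.nth (ExitPair (x ω)) k := by
  induction k using Nat.strong_induction_on with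
  | _ k ih =>
    simp_rw [Nat.nth_eq_sInf _ k]
    refine measurable_nat_sInf fun n => ?_
    have : {ω | ExitPair (x ω) n ∧ ∀ l < k, Nat.nth (ExitPair (x ω)) l < n} =
        {ω | ExitPair (x ω) n} ∩ ⋂ l, ⋂ (_ : l < k), {ω | Nat.nth (ExitPair (x ω)) l < n} := by
      ext ω; simp
    rw [this]
    exact (measurableSet_exitPair hx n).inter (MeasurableSet.iInter fun l =>
      MeasurableSet.iInter fun hl => measurableSet_lt (ih l hl) measurable_const)

lemma measurable_coarse (k : ℕ) : Measurable fun ω => coarse (x ω) k :=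
  measurable_eval_nat (f := fun n ω => x ω (2 * n)) (fun _ => hx _) (measurable_nth hx k)

end Measurability

/-- Only the rows up to `m` are required to be measurable, so that the lemma also applies to the
σ-algebra they generate; this yields independence of the next row. -/
lemma measurable_twistedStep {Ω : Type*} [MeasurableSpace Ω] {X : Ω → ℕ → ℕ → ℤ} (m : ℕ)
    (hX : ∀ j ≤ m, ∀ i, Measurable fun ω => X ω j i) (i : ℕ) :
    Measurable fun ω => twistedStep (X ω) m i := by
  induction m generalizing i with
  | zero => exact hX 0 le_rfl i
  | succ m ih =>
    have ih' := ih fun j hj => hX j (hj.trans (Nat.le_succ m))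
    have hx := hX (m + 1) le_rfl
    have hk := measurable_bridgeIndex hx i
    have hT : ∀ d, Measurable fun ω => walk (X ω (m + 1))
        (refineTime (walk (X ω (m + 1))) (bridgeIndex (walk (X ω (m + 1))) i + d)) := fun d =>
      measurable_eval_nat (f := fun n ω => walk (X ω (m + 1)) n) (measurable_walk hx) <|
        (measurable_eval_nat (f := fun k ω => refineTime (walk (X ω (m + 1))) (k + d))
          (fun k => measurable_refineTime hx (k + d)) hk)
    have hy : Measurable fun ω => twistedStep (X ω) m (bridgeIndex (walk (X ω (m + 1))) i) :=
      measurable_eval_nat (f := fun n ω => twistedStep (X ω) m n) ih' hk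
    simp only [twistedStep]
    exact Measurable.ite (measurableSet_eq_fun ((hT 1).sub (hT 0)) (hy.const_mul 2)) (hx i)
      (hx i).neg

/-! ### The law of the twisted walks -/

/-- Flipping the bridges by the signs `δ`. -/
def bridgeFlip (δ x : ℕ → ℤ) (i : ℕ) : ℤ := δ (Nat.count (ExitPair x) (i / 2)) * x i

/-- The bridge containing a step is determined by the pairs completed before the pair of that step.
-/
lemma predictable_bridgeFlip (δ : ℕ → ℤ) :
    Predictable fun x i => δ (Nat.count (ExitPair x) (i / 2)) := by
  intro z z' n h
  have : Nat.count (ExitPair z) (n / 2) = Nat.count (ExitPair z') (n / 2) := by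
    simp only [Nat.count_eq_card_filter_range]
    congr 1
    refine Finset.filter_congr fun q hq => ?_
    rw [Finset.mem_range] at hq
    unfold ExitPair
    rw [h _ (by omega), h _ (by omega)]
  simp only [this]

lemma measurePreserving_bridgeFlip {δ : ℕ → ℤ} (hδ : Signs δ) :
    MeasurePreserving (bridgeFlip δ) signLaw signLaw :=
  measurePreserving_mul_predictable (predictable_bridgeFlip δ) fun _ _ => hδ _

/-- Twisting is a bridge flip of `x` by the signs `y * coarse x`. For fixed `x` these have the law
of `y`, so they are independent of `x`; for fixed signs the bridge flip is a predictable flip. Two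
skew products and a swap express this. -/
lemma measurePreserving_twist :
    MeasurePreserving (fun p : (ℕ → ℤ) × (ℕ → ℤ) => twist p.1 p.2) (signLaw.prod signLaw)
      signLaw := by
  have h1 : MeasurePreserving
      (fun p : (ℕ → ℤ) × (ℕ → ℤ) => (p.1, fun i => p.2 i * coarse p.1 i))
      (signLaw.prod signLaw) (signLaw.prod signLaw) := by
    refine (MeasurePreserving.id signLaw).skew_product
      (g := fun (x : ℕ → ℤ) (y : ℕ → ℤ) i => y i * coarse x i) ?_ ?_
    · refine measurable_pi_lambda _ fun i => ?_
      exact ((measurable_pi_apply i).comp measurable_snd).mul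
        (measurable_coarse (x := fun p : (ℕ → ℤ) × (ℕ → ℤ) => p.1) (fun i => by fun_prop) i)
    · filter_upwards [ae_signs] with x hx
      exact (measurePreserving_mul_signs hx.coarse).map_eq
  have h2 : MeasurePreserving
      (fun p : (ℕ → ℤ) × (ℕ → ℤ) => (p.1, bridgeFlip p.1 p.2))
      (signLaw.prod signLaw) (signLaw.prod signLaw) := by
    refine (MeasurePreserving.id signLaw).skew_product (g := bridgeFlip) ?_ ?_
    · refine measurable_pi_lambda _ fun i => ?_
      exact (measurable_eval_nat (f := fun n (p : (ℕ → ℤ) × (ℕ → ℤ)) => p.1 n)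
        (fun _ => by fun_prop) (measurable_count (x := fun p : (ℕ → ℤ) × (ℕ → ℤ) => p.2)
          (fun i => by fun_prop) (i / 2))).mul (by fun_prop)
    · filter_upwards [ae_signs] with δ hδ
      exact (measurePreserving_bridgeFlip hδ).map_eq
  exact measurePreserving_snd.comp (h2.comp (Measure.measurePreserving_swap.comp h1))

section Array

variable {Ω : Type*} [MeasurableSpace Ω] {P : Measure Ω} [IsProbabilityMeasure P]
  {X : Ω → ℕ → ℕ → ℤ} (hX : IsRademacherArray X P)
include hX

lemma IsRademacherArray.map_eq_coin (m k : ℕ) : P.map (fun ω => X ω m k) = coin := by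
  have hm := hX.measurable m k
  have h1 : P.map (fun ω => X ω m k) {1} = 1 / 2 := by
    rw [Measure.map_apply hm (measurableSet_singleton _)]; exact hX.prob_one m k
  have h2 : P.map (fun ω => X ω m k) {-1} = 1 / 2 := by
    rw [Measure.map_apply hm (measurableSet_singleton _)]; exact hX.prob_neg_one m k
  have := Measure.isProbabilityMeasure_map (μ := P) hm.aemeasurable
  have h3 : P.map (fun ω => X ω m k) {1, -1}ᶜ = 0 := by
    rw [prob_compl_eq_zero_iff (by measurability), ← Set.singleton_union,
      measure_union (by simp) (measurableSet_singleton _), h1, h2, ENNReal.add_halves]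
  refine Measure.ext_of_singleton fun a => ?_
  by_cases ha1 : a = 1
  · rw [ha1, h1]; simp [coin]
  by_cases ha2 : a = -1
  · rw [ha2, h2]; simp [coin]
  rw [measure_mono_null (by simp [ha1, ha2]) h3]
  simp [coin, Ne.symm ha1, Ne.symm ha2]

lemma IsRademacherArray.map_row (m : ℕ) : P.map (fun ω => X ω m) = signLaw := by
  have h : iIndepFun (fun k ω => X ω m k) P :=
    hX.indep.precomp (g := fun k : ℕ => (m, k)) fun a b h => by simpa using h
  have := h.map_fun_eq_infinitePi_map (hX.measurable m)
  simp only [hX.map_eq_coin] at this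
  exact this

omit [IsProbabilityMeasure P] in
lemma IsRademacherArray.indepFun_row (m : ℕ) :
    IndepFun (fun ω => X ω (m + 1)) (fun ω => twistedStep (X ω) m) P := by
  have h1 := indep_iSup_of_disjoint (m := fun p : ℕ × ℕ => MeasurableSpace.comap
    (fun ω => X ω p.1 p.2) inferInstance) (S := {p | p.1 = m + 1}) (T := {p | p.1 ≤ m})
    (fun p => (hX.measurable p.1 p.2).comap_le) hX.indep
    (Set.disjoint_left.2 fun p h1 h2 => by simp only [mem_ofPred_eq] at h1 h2; omega)
  have hle : ∀ (S : Set (ℕ × ℕ)) (p : ℕ × ℕ), p ∈ S →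
      Measurable[⨆ p ∈ S, MeasurableSpace.comap (fun ω => X ω p.1 p.2) inferInstance]
        fun ω => X ω p.1 p.2 := fun S p hp =>
    Measurable.of_comap_le (le_iSup₂_of_le p hp le_rfl)
  rw [IndepFun_iff_Indep]
  refine indep_of_indep_of_le_left (indep_of_indep_of_le_right h1 ?_) ?_
  · refine Measurable.comap_le ?_
    refine @measurable_pi_lambda _ _ _ (_) _ _ fun i => ?_
    exact @measurable_twistedStep _ (_) _ m (fun j hj i => hle {p | p.1 ≤ m} (j, i) hj) i
  · refine Measurable.comap_le ?_
    refine @measurable_pi_lambda _ _ _ (_) _ _ fun i => ?_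
    exact hle {p | p.1 = m + 1} (m + 1, i) rfl

omit [IsProbabilityMeasure P] in
lemma IsRademacherArray.measurable_twistedStep (m : ℕ) :
    Measurable fun ω => twistedStep (X ω) m :=
  measurable_pi_lambda _ fun i => TwistShrink.measurable_twistedStep m
    (fun j _ i => hX.measurable j i) i

lemma IsRademacherArray.ae_row (m : ℕ) : ∀ᵐ ω ∂P, Signs (X ω m) ∧ Recurrent (X ω m) := by
  have h : MeasurePreserving (fun ω => X ω m) P signLaw :=
    ⟨measurable_pi_lambda _ fun i => hX.measurable m i, hX.map_row m⟩
  exact h.quasiMeasurePreserving.ae (ae_signs.and ae_recurrent)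

/-- The twisted walks are simple symmetric random walks. -/
lemma IsRademacherArray.measurePreserving_twistedStep (m : ℕ) :
    MeasurePreserving (fun ω => twistedStep (X ω) m) P signLaw := by
  refine ⟨hX.measurable_twistedStep m, ?_⟩
  induction m with
  | zero => exact hX.map_row 0
  | succ m ih =>
    have hx : Measurable fun ω => X ω (m + 1) :=
      measurable_pi_lambda _ fun i => hX.measurable (m + 1) i
    have hy := hX.measurable_twistedStep m
    have h1 : P.map (fun ω => (X ω (m + 1), twistedStep (X ω) m)) = signLaw.prod signLaw := by
      rw [(indepFun_iff_map_prod_eq_prod_map_map hx.aemeasurable hy.aemeasurable).1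
        (hX.indepFun_row m), hX.map_row, ih]
    have h2 : ∀ᵐ ω ∂P, Signs (twistedStep (X ω) m) :=
      (⟨hy, ih⟩ : MeasurePreserving _ P signLaw).quasiMeasurePreserving.ae ae_signs
    have h3 : (fun ω => twistedStep (X ω) (m + 1)) =ᵐ[P]
        (fun p : (ℕ → ℤ) × (ℕ → ℤ) => twist p.1 p.2) ∘
          fun ω => (X ω (m + 1), twistedStep (X ω) m) := by
      filter_upwards [h2, hX.ae_row (m + 1)] with ω hω hω'
      ext i
      exact twistedStep_succ hω'.1 hω'.2 hω i
    rw [Measure.map_congr h3, ← Measure.map_map measurePreserving_twist.measurable (hx.prodMk hy),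
      h1, measurePreserving_twist.map_eq]

/-- Almost surely, each twisted walk is embedded in the next one. -/
lemma IsRademacherArray.ae_coarse : ∀ᵐ ω ∂P, ∀ m, Signs (twistedStep (X ω) m) ∧
    Recurrent (twistedStep (X ω) (m + 1)) ∧
    coarse (twistedStep (X ω) (m + 1)) = twistedStep (X ω) m := by
  have h1 : ∀ᵐ ω ∂P, ∀ m, Signs (twistedStep (X ω) m) := ae_all_iff.2 fun m =>
    (hX.measurePreserving_twistedStep m).quasiMeasurePreserving.ae ae_signs
  filter_upwards [h1, ae_all_iff.2 hX.ae_row] with ω hω hω' m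
  have h2 : twistedStep (X ω) (m + 1) = twist (X ω (m + 1)) (twistedStep (X ω) m) := by
    ext i
    exact twistedStep_succ (hω' (m + 1)).1 (hω' (m + 1)).2 (hω m) i
  refine ⟨hω m, ?_, ?_⟩
  · rw [h2, Recurrent, exitPair_twist (hω' (m + 1)).1 (hω m)]
    exact (hω' (m + 1)).2
  · rw [h2, coarse_twist (hω' (m + 1)).1 (hω m) (hω' (m + 1)).2]

lemma IsRademacherArray.measure_not_regular_le (m : ℕ) {M : ℕ} (hM : 1 ≤ M) {lam : ℝ}
    (hl : 0 < lam) : P {ω | ¬ Regular (twistedStep (X ω) m) M lam} ≤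
      ENNReal.ofReal (80 * M ^ 3 * Real.exp (-lam)) := by
  refine le_trans ?_ (TwistShrink.measure_not_regular_le hM hl)
  rw [← (hX.measurePreserving_twistedStep m).map_eq]
  -- Only this inequality is needed, so measurability of the exceptional set need not be shown.
  exact Measure.le_map_apply (hX.measurable_twistedStep m).aemeasurable _

end Array


/-! ### Scaling and numerical constants -/

/-- The order `(N log³ N)^(1/4)` of the local time fluctuations of a walk of length `N`. -/
noncomputable def fluct (N : ℝ) : ℝ := √(Real.log N * √(N * Real.log N))

/-- The rescaled order of the fluctuations at level `j`. -/
noncomputable def fluctAt (K : ℝ) (j : ℕ) : ℝ := fluct (K * 2 ^ (2 * j)) / 2 ^ j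

/-- `N` is large enough for the estimates with the exponent `C`. -/
structure Large (C N : ℝ) : Prop where
  one_le : 1 ≤ N
  -- Makes `log 4` small against `log N`, so that quadrupling `N` multiplies `fluct` by little more
  -- than `√2`.
  log : 18 ≤ Real.log N
  -- Gives `6 * lam ≤ ⌊N⌋₊` for `lam = 3 * C * log N`.
  linear : 18 * C * Real.log N + 1 ≤ N
  -- Here `17280 = 80 * 6 ^ 3` is the factor of the union bound for `M = 6 * ⌊N⌋₊`.
  power : 17280 ≤ N ^ (2 * (C - 1))

lemma exists_large {C : ℝ} (hC : 1 < C) : ∃ N₀ : ℝ, ∀ N, N₀ ≤ N → Large C N := by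
  have h1 : ∀ᶠ N : ℝ in atTop, 18 ≤ Real.log N := Real.tendsto_log_atTop.eventually_ge_atTop 18
  have h2 : ∀ᶠ N : ℝ in atTop, 18 * C * Real.log N + 1 ≤ N := by
    have h := Real.isLittleO_log_id_atTop.bound (c := 1 / (36 * C)) (by positivity)
    filter_upwards [h, eventually_ge_atTop 2] with N hN hN2
    rw [Real.norm_eq_abs, id, Real.norm_eq_abs, abs_of_nonneg (by linarith : 0 ≤ N)] at hN
    have h3 := (le_abs_self _).trans hN
    have h4 := mul_le_mul_of_nonneg_left h3 (by positivity : 0 ≤ 18 * C)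
    have h5 : 18 * C * (1 / (36 * C) * N) = N / 2 := by field_simp; norm_num
    linarith
  have h3 : ∀ᶠ N : ℝ in atTop, 17280 ≤ N ^ (2 * (C - 1)) :=
    (tendsto_rpow_atTop (by linarith : 0 < 2 * (C - 1))).eventually_ge_atTop _
  obtain ⟨N₀, h⟩ := eventually_atTop.1 ((h1.and h2).and (h3.and (eventually_ge_atTop 1)))
  exact ⟨N₀, fun N hN => ⟨(h N hN).2.2, (h N hN).1.1, (h N hN).1.2, (h N hN).2.1⟩⟩

lemma fluct_nonneg (N : ℝ) : 0 ≤ fluct N := Real.sqrt_nonneg _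

lemma fluctAt_nonneg (K : ℝ) (j : ℕ) : 0 ≤ fluctAt K j := div_nonneg (fluct_nonneg _) (by positivity)

namespace Large

variable {C N : ℝ} (h : Large C N) (hC : 1 ≤ C)
include h

lemma fluct_four_mul_le : fluct (4 * N) ≤ 3 / 2 * fluct N := by
  have h1 := h.one_le
  have h2 := h.log
  have h4 : Real.log (4 * N) ≤ 1.078 * Real.log N := by
    rw [Real.log_mul (by norm_num) (by linarith), show (4 : ℝ) = 2 ^ 2 by norm_num, Real.log_pow]
    have := Real.log_two_lt_d9
    push_cast
    linarith
  have h5 : 0 ≤ Real.log (4 * N) := Real.log_nonneg (by linarith)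
  have h6 : √(4 * N * Real.log (4 * N)) ≤ 2.08 * √(N * Real.log N) := by
    rw [show (2.08 : ℝ) = √(2.08 ^ 2) by rw [Real.sqrt_sq (by norm_num)],
      ← Real.sqrt_mul (by norm_num)]
    apply Real.sqrt_le_sqrt
    nlinarith
  unfold fluct
  rw [show (3 / 2 : ℝ) = √((3 / 2) ^ 2) by rw [Real.sqrt_sq (by norm_num)],
    ← Real.sqrt_mul (by norm_num)]
  apply Real.sqrt_le_sqrt
  calc _ ≤ (1.078 * Real.log N) * (2.08 * √(N * Real.log N)) := by gcongr
    _ = (1.078 * 2.08) * (Real.log N * √(N * Real.log N)) := by ring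
    _ ≤ _ := by
      apply mul_le_mul_of_nonneg_right (by norm_num)
      have : 0 ≤ Real.log N := by linarith
      positivity

lemma le_floor : 6 * (3 * C * Real.log N) ≤ ⌊N⌋₊ := by
  have := h.linear
  have := Nat.lt_floor_add_one N
  linarith

include hC

/-- The proof gives the constant 7; the value 7.26 is chosen since `6 * 7.26 = 6.6 ^ 2` in the next
estimate. -/
lemma visitBound_le :
    visitBound (6 * ⌊N⌋₊) (3 * C * Real.log N) ≤ 7.26 * C * √(N * Real.log N) := by
  have h1 := h.one_le
  have h2 := h.log
  have h3 := Nat.floor_le (by linarith : 0 ≤ N)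
  have h4 : 1 ≤ √(N * Real.log N) := Real.one_le_sqrt.2 (by nlinarith)
  have h5 : √(2 * (3 * C * Real.log N) * (6 * ⌊N⌋₊ : ℕ)) ≤ 6 * C * √(N * Real.log N) := by
    apply Real.sqrt_le_iff.2
    refine ⟨by positivity, ?_⟩
    rw [mul_pow, Real.sq_sqrt (by nlinarith)]
    push_cast
    calc 2 * (3 * C * Real.log N) * (6 * ⌊N⌋₊) ≤ 2 * (3 * C * Real.log N) * (6 * N) := by gcongr
      _ = 36 * C * (N * Real.log N) := by ring
      _ ≤ 36 * (C * C) * (N * Real.log N) := by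
        have : C ≤ C * C := by nlinarith
        have : 0 ≤ N * Real.log N := by nlinarith
        gcongr
      _ = _ := by ring
  unfold visitBound
  nlinarith

lemma siteBound_le :
    siteBound (6 * ⌊N⌋₊) (3 * C * Real.log N) ≤ 6.6 * C * fluct N := by
  have h1 := h.one_le
  have h2 := h.log
  have h3 := h.visitBound_le hC
  unfold siteBound fluct
  apply Real.sqrt_le_iff.2
  refine ⟨by positivity, ?_⟩
  rw [mul_pow, Real.sq_sqrt (by positivity)]
  calc _ ≤ 2 * (3 * C * Real.log N) * (7.26 * C * √(N * Real.log N)) := by gcongr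
    _ = _ := by ring

/-- The constants add up as `3 + 7.2 + 3 * 6.6`, the summand 9 of `levelBound` being absorbed
through `3 ≤ C * fluct N`. -/
lemma levelBound_le :
    levelBound ⌊N⌋₊ (6 * ⌊N⌋₊) (3 * C * Real.log N) ≤ 30 * C * fluct N := by
  have h1 := h.one_le
  have h2 := h.log
  have h3 := h.siteBound_le hC
  have h4 := Nat.floor_le (by linarith : 0 ≤ N)
  have h5 : timeBound ⌊N⌋₊ (3 * C * Real.log N) ≤ 8.5 * C * √(N * Real.log N) := by
    unfold timeBound
    have : √(6 * (3 * C * Real.log N) * ⌊N⌋₊) ≤ 4.25 * C * √(N * Real.log N) := by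
      apply Real.sqrt_le_iff.2
      refine ⟨by positivity, ?_⟩
      rw [mul_pow, Real.sq_sqrt (by nlinarith)]
      calc 6 * (3 * C * Real.log N) * ⌊N⌋₊ ≤ 6 * (3 * C * Real.log N) * N := by gcongr
        _ = 18 * C * (N * Real.log N) := by ring
        _ ≤ (4.25 * C) ^ 2 * (N * Real.log N) := by
          have : 18 * C ≤ (4.25 * C) ^ 2 := by nlinarith
          have : 0 ≤ N * Real.log N := by nlinarith
          gcongr
    linarith
  have h6 : √(2 * (3 * C * Real.log N) * timeBound ⌊N⌋₊ (3 * C * Real.log N)) ≤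
      7.2 * C * fluct N := by
    unfold fluct
    apply Real.sqrt_le_iff.2
    refine ⟨by positivity, ?_⟩
    rw [mul_pow, Real.sq_sqrt (by positivity)]
    calc _ ≤ 2 * (3 * C * Real.log N) * (8.5 * C * √(N * Real.log N)) := by gcongr
      _ = 51 * (C ^ 2 * (Real.log N * √(N * Real.log N))) := by ring
      _ ≤ 51.84 * (C ^ 2 * (Real.log N * √(N * Real.log N))) := by
        apply mul_le_mul_of_nonneg_right (by norm_num); positivity
      _ = _ := by ring
  have h7 : 3 ≤ fluct N := by
    unfold fluct
    apply Real.le_sqrt_of_sq_le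
    have : 1 ≤ √(N * Real.log N) := Real.one_le_sqrt.2 (by nlinarith)
    nlinarith
  have h8 : 3 ≤ C * fluct N := by nlinarith
  unfold levelBound
  linarith

omit hC in
lemma measure_bound : 80 * ((6 * ⌊N⌋₊ : ℕ) : ℝ) ^ 3 * Real.exp (-(3 * C * Real.log N)) ≤
    N ^ (1 - C) := by
  have h1 := h.one_le
  have hN : 0 < N := by linarith
  have h4 := Nat.floor_le hN.le
  have h5 : Real.exp (-(3 * C * Real.log N)) = N ^ (-(3 * C)) := by
    rw [Real.rpow_def_of_pos hN]; congr 1; ring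
  rw [h5]
  push_cast
  calc 80 * (6 * (⌊N⌋₊ : ℝ)) ^ 3 * N ^ (-(3 * C)) ≤ 80 * (6 * N) ^ 3 * N ^ (-(3 * C)) := by gcongr
    _ = 17280 * (N ^ (3 : ℝ) * N ^ (-(3 * C))) := by norm_cast; ring
    _ = 17280 * N ^ (3 - 3 * C) := by rw [← Real.rpow_add hN]; ring_nf
    _ ≤ N ^ (2 * (C - 1)) * N ^ (3 - 3 * C) := by
      gcongr
      exact h.power
    _ = _ := by rw [← Real.rpow_add hN]; ring_nf

end Large

/-- From the level `q` on, all the deviation bounds up to time `K` hold. -/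
def GoodFrom (Y : ℕ → ℕ → ℤ) (C K : ℝ) (q : ℕ) : Prop :=
  ∀ j, q ≤ j → Large C (K * 2 ^ (2 * j)) ∧
    Regular (Y (j + 1)) (6 * ⌊K * 2 ^ (2 * j)⌋₊) (3 * C * Real.log (K * 2 ^ (2 * j)))

/-- Each sequence of steps is embedded in the next one. -/
def Nested (Y : ℕ → ℕ → ℤ) : Prop :=
  ∀ m, Signs (Y m) ∧ Recurrent (Y (m + 1)) ∧ coarse (Y (m + 1)) = Y m

/-- The factor `3 / 2` from quadrupling the length meets the factor `1 / 2` from the space scale. -/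
lemma fluctAt_succ_le {C K : ℝ} {j : ℕ} (h : Large C (K * 2 ^ (2 * j))) :
    fluctAt K (j + 1) ≤ 3 / 4 * fluctAt K j := by
  have h1 := h.fluct_four_mul_le
  unfold fluctAt
  rw [show K * 2 ^ (2 * (j + 1)) = 4 * (K * 2 ^ (2 * j)) by ring, pow_succ,
    div_le_iff₀ (by positivity)]
  calc _ ≤ _ := h1
    _ = _ := by field_simp; ring

section GoodFrom

variable {Y : ℕ → ℕ → ℤ} {C K : ℝ} {q : ℕ} (hg : GoodFrom Y C K q) (hY : Nested Y) (hC : 1 ≤ C)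
include hg hY hC

/-- The level bound is `15 * C * fluctAt K j`. As `fluctAt` loses at least a quarter per level, this
is at most `60 * C` times its decrement, a form that telescopes. -/
lemma GoodFrom.abs_interpolate_visits_sub_le {j : ℕ} (hj : q ≤ j) {t : ℝ} (ht : t ∈ Icc 0 K)
    (x : ℝ) :
    |interpolate (j + 1) (visits (walk (Y (j + 1)))) t x -
      interpolate j (visits (walk (Y j))) t x| ≤ 60 * C * (fluctAt K j - fluctAt K (j + 1)) := by
  obtain ⟨h1, h2⟩ := hg j hj
  have h3 := h1.log
  have h4 := abs_interpolate_visits_succ_sub_le h2 (hY (j + 1)).1 (by positivity) (hY j).2.1 le_rfl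
    h1.le_floor j ht.1 (Nat.floor_mono (by gcongr; exact ht.2)) x
  rw [(hY j).2.2] at h4
  have h5 := fluctAt_succ_le h1
  have h6 := h1.levelBound_le hC
  refine h4.trans ?_
  have h7 : levelBound ⌊K * 2 ^ (2 * j)⌋₊ (6 * ⌊K * 2 ^ (2 * j)⌋₊)
      (3 * C * Real.log (K * 2 ^ (2 * j))) / 2 ^ (j + 1) ≤ 15 * C * fluctAt K j := by
    unfold fluctAt
    rw [div_le_iff₀ (by positivity), pow_succ]
    calc _ ≤ _ := h6
      _ = _ := by field_simp; ring
  nlinarith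

lemma GoodFrom.abs_pathInterp_sub_le {j : ℕ} (hj : q ≤ j) {t : ℝ} (ht : t ∈ Icc 0 K) :
    |pathInterp (j + 1) (walk (Y (j + 1))) t - pathInterp j (walk (Y j)) t| ≤
      60 * C * (fluctAt K j - fluctAt K (j + 1)) := by
  obtain ⟨h1, h2⟩ := hg j hj
  have h3 := h1.log
  have h4 := abs_pathInterp_succ_sub_le h2 (hY (j + 1)).1 (by positivity) (hY j).2.1 le_rfl
    h1.le_floor j ht.1 (Nat.floor_mono (by gcongr; exact ht.2))
  rw [(hY j).2.2] at h4
  have h5 := fluctAt_succ_le h1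
  have h6 := h1.levelBound_le hC
  refine h4.trans ?_
  have h7 : levelBound ⌊K * 2 ^ (2 * j)⌋₊ (6 * ⌊K * 2 ^ (2 * j)⌋₊)
      (3 * C * Real.log (K * 2 ^ (2 * j))) / 2 ^ (j + 1) ≤ 15 * C * fluctAt K j := by
    unfold fluctAt
    rw [div_le_iff₀ (by positivity), pow_succ]
    calc _ ≤ _ := h6
      _ = _ := by field_simp; ring
  nlinarith

omit hY in
lemma GoodFrom.siteBound_div_le {j : ℕ} (hj : q ≤ j) :
    siteBound (6 * ⌊K * 2 ^ (2 * j)⌋₊) (3 * C * Real.log (K * 2 ^ (2 * j))) / 2 ^ (j + 1) ≤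
      3.3 * C * fluctAt K j := by
  have h6 := (hg j hj).1.siteBound_le hC
  unfold fluctAt
  rw [div_le_iff₀ (by positivity), pow_succ]
  calc _ ≤ _ := h6
    _ = _ := by field_simp; ring

lemma GoodFrom.abs_interpolate_up_sub_down_le {j : ℕ} (hj : q ≤ j) {t : ℝ} (ht : t ∈ Icc 0 K)
    (x : ℝ) :
    |interpolate (j + 1) (upVisits (walk (Y (j + 1)))) t x -
      interpolate (j + 1) (downVisits (walk (Y (j + 1)))) t x| ≤ 3.3 * C * fluctAt K j := by
  refine le_trans ?_ (hg.siteBound_div_le hC hj)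
  obtain ⟨h1, h2⟩ := hg j hj
  have h3 := h1.log
  have h0 : 2 ≤ ⌊K * 2 ^ (2 * j)⌋₊ := by
    apply Nat.le_floor
    have := h1.linear
    push_cast
    nlinarith
  refine TwistShrink.abs_interpolate_up_sub_down_le h2 (hY (j + 1)).1 (by positivity) _ ht.1 ?_ x
  obtain ⟨d, hd, he⟩ := floor_four_mul ht.1 j
  have : ⌊t * 2 ^ (2 * j)⌋₊ ≤ ⌊K * 2 ^ (2 * j)⌋₊ := Nat.floor_mono (by gcongr; exact ht.2)
  omega

lemma GoodFrom.abs_interpolate_visits_sub_of_near {j : ℕ} (hj : q ≤ j) {t t' x x' : ℝ}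
    (ht : t ∈ Icc 0 K) (ht' : t' ∈ Icc 0 K) (htt : |t - t'| * 2 ^ (2 * (j + 1)) ≤ 1)
    (hxx : |x - x'| * 2 ^ (j + 1) ≤ 1) :
    |interpolate (j + 1) (visits (walk (Y (j + 1)))) t x -
      interpolate (j + 1) (visits (walk (Y (j + 1)))) t' x'| ≤
      9 / 2 ^ (j + 1) + 6 * (3.3 * C * fluctAt K j) := by
  have h5 := hg.siteBound_div_le hC hj
  obtain ⟨h1, h2⟩ := hg j hj
  have h3 := h1.log
  have h0 : 2 ≤ ⌊K * 2 ^ (2 * j)⌋₊ := by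
    apply Nat.le_floor
    have := h1.linear
    push_cast
    nlinarith
  refine (TwistShrink.abs_interpolate_visits_sub_of_near h2 (hY (j + 1)).1 (by positivity) _ ht.1
    ht'.1 ?_ htt hxx).trans ?_
  · obtain ⟨d, hd, he⟩ := floor_four_mul ht.1 j
    have : ⌊t * 2 ^ (2 * j)⌋₊ ≤ ⌊K * 2 ^ (2 * j)⌋₊ := Nat.floor_mono (by gcongr; exact ht.2)
    omega
  · rw [add_div, mul_div_assoc]
    gcongr

end GoodFrom

lemma GoodFrom.tendsto_fluctAt {Y : ℕ → ℕ → ℤ} {C K : ℝ} {q : ℕ} (hg : GoodFrom Y C K q) :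
    Tendsto (fluctAt K) atTop (𝓝 0) := by
  rw [← tendsto_add_atTop_iff_nat q]
  have h : ∀ d, fluctAt K (d + q) ≤ (3 / 4) ^ d * fluctAt K q := by
    intro d
    induction d with
    | zero => simp
    | succ d ih =>
      rw [show d + 1 + q = d + q + 1 by ring, pow_succ]
      have := fluctAt_succ_le (hg (d + q) (by omega)).1
      linarith
  refine squeeze_zero (fun d => fluctAt_nonneg _ _) h ?_
  have := (tendsto_pow_atTop_nhds_zero_of_lt_one (by norm_num : (0 : ℝ) ≤ 3 / 4)
    (by norm_num)).mul_const (fluctAt K q)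
  rwa [zero_mul] at this

/-! ### Limits -/

lemma abs_sub_le_of_telescope {f r : ℕ → ℝ} {c : ℝ} {q : ℕ}
    (h : ∀ j, q ≤ j → |f (j + 1) - f j| ≤ c * (r j - r (j + 1))) {a b : ℕ} (ha : q ≤ a)
    (hab : a ≤ b) : |f b - f a| ≤ c * (r a - r b) := by
  induction b, hab using Nat.le_induction with
  | base => simp
  | succ b hb ih =>
    have h1 := h b (ha.trans hb)
    have h2 := abs_sub_le (f (b + 1)) (f b) (f a)
    linarith

lemma tendsto_limUnder_of_telescope {f r : ℕ → ℝ} {c : ℝ} {q : ℕ} (hc : 0 ≤ c) (hr : ∀ j, 0 ≤ r j)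
    (hr0 : Tendsto r atTop (𝓝 0))
    (h : ∀ j, q ≤ j → |f (j + 1) - f j| ≤ c * (r j - r (j + 1))) :
    Tendsto f atTop (𝓝 (limUnder atTop f)) := by
  apply CauchySeq.tendsto_limUnder
  -- The criterion asks for a bound from every starting index; before `q` a crude constant serves,
  -- which does not affect the limit.
  refine cauchySeq_of_le_tendsto_0' (fun j => if q ≤ j then c * r j else 2 * c * r q +
    |f q| + ∑ i ∈ Finset.range (q + 1), 2 * |f i|) ?_ ?_
  · intro a b hab
    rw [Real.dist_eq, abs_sub_comm]
    have key : ∀ a b, q ≤ a → a ≤ b → |f b - f a| ≤ c * r a := fun a b ha hab => by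
      have h1 := abs_sub_le_of_telescope h ha hab
      have := mul_nonneg hc (hr b)
      linarith
    split_ifs with ha
    · exact key a b ha hab
    · have h3 : ∀ i ≤ q, 2 * |f i| ≤ ∑ i ∈ Finset.range (q + 1), 2 * |f i| := fun i hi =>
        Finset.single_le_sum (f := fun i => 2 * |f i|) (fun i _ => by positivity)
          (Finset.mem_range.2 (by omega))
      have h4 := h3 a (by omega)
      have h6 := mul_nonneg hc (hr q)
      rcases le_total q b with hb | hb
      · have h5 := key q b le_rfl hb
        have h7 : |f b - f a| ≤ |f b - f q| + |f q| + |f a| := by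
          have := abs_sub_le (f b) (f q) (f a)
          have := abs_sub (f q) (f a)
          linarith
        have := abs_nonneg (f a)
        linarith
      · have h5 := h3 b hb
        have := abs_sub (f b) (f a)
        have := abs_nonneg (f q)
        linarith
  · have := hr0.const_mul c
    rw [mul_zero] at this
    refine this.congr' ?_
    filter_upwards [eventually_ge_atTop q] with j hj
    rw [if_pos hj]

lemma abs_limUnder_sub_le {f r : ℕ → ℝ} {c : ℝ} {q : ℕ} (hc : 0 ≤ c) (hr : ∀ j, 0 ≤ r j)
    (hr0 : Tendsto r atTop (𝓝 0))
    (h : ∀ j, q ≤ j → |f (j + 1) - f j| ≤ c * (r j - r (j + 1))) {j : ℕ} (hj : q ≤ j) :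
    |limUnder atTop f - f j| ≤ c * r j := by
  have h1 := tendsto_limUnder_of_telescope hc hr hr0 h
  refine le_of_tendsto ((h1.sub_const (f j)).abs) ?_
  filter_upwards [eventually_ge_atTop j] with p hp
  have h2 := abs_sub_le_of_telescope h hj hp
  have := mul_nonneg hc (hr p)
  linarith

lemma tendstoUniformlyOn_limUnder {α : Type*} {F : ℕ → α → ℝ} {s : Set α} {r : ℕ → ℝ} {c : ℝ}
    {q : ℕ} (hc : 0 ≤ c) (hr : ∀ j, 0 ≤ r j) (hr0 : Tendsto r atTop (𝓝 0))
    (h : ∀ j, q ≤ j → ∀ a ∈ s, |F (j + 1) a - F j a| ≤ c * (r j - r (j + 1))) :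
    TendstoUniformlyOn F (fun a => limUnder atTop fun j => F j a) atTop s := by
  rw [Metric.tendstoUniformlyOn_iff]
  intro ε hε
  have h1 : ∀ᶠ j in atTop, c * r j < ε := by
    have := hr0.const_mul c
    rw [mul_zero] at this
    exact this.eventually_lt_const hε
  filter_upwards [h1, eventually_ge_atTop q] with j hj hqj a ha
  rw [Real.dist_eq]
  exact (abs_limUnder_sub_le hc hr hr0 (fun j hj => h j hj a ha) hqj).trans_lt hj

/-- The approximants need not be shown continuous: an oscillation at most `ε` at some scale
suffices. -/
lemma continuousOn_of_tendstoUniformlyOn {α : Type*} [PseudoMetricSpace α] {F : ℕ → α → ℝ}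
    {f : α → ℝ} {s : Set α} (h : TendstoUniformlyOn F f atTop s)
    (hF : ∀ ε > 0, ∀ᶠ j in atTop, ∃ δ > 0, ∀ a ∈ s, ∀ b ∈ s, dist a b < δ →
      |F j a - F j b| ≤ ε) : ContinuousOn f s := by
  rw [Metric.tendstoUniformlyOn_iff] at h
  rw [Metric.continuousOn_iff]
  intro b hb ε hε
  obtain ⟨j, h1, δ, hδ, h2⟩ := ((h (ε / 4) (by positivity)).and (hF (ε / 4) (by positivity))).exists
  refine ⟨δ, hδ, fun a ha hab => ?_⟩
  have h3 := h1 a ha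
  have h4 := h1 b hb
  have h5 := h2 a ha b hb hab
  rw [Real.dist_eq] at *
  rw [abs_lt] at h3 h4
  rw [abs_le] at h5
  rw [abs_lt]
  constructor <;> linarith [h3.1, h3.2, h4.1, h4.2, h5.1, h5.2]


/-! ### The probability of the deviation bounds -/

section Array

variable {Ω : Type*} [MeasurableSpace Ω] {P : Measure Ω} [IsProbabilityMeasure P]
  {X : Ω → ℕ → ℕ → ℤ} (hX : IsRademacherArray X P)
include hX

/-- Level `j` fails with probability at most `(K * 2 ^ (2 * j)) ^ (1 - C)`, and the levels from `q`
on sum to a geometric series of ratio `4 ^ (1 - C)`. -/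
lemma IsRademacherArray.measure_not_goodFrom_le {C K : ℝ} {q : ℕ} (hC : 1 < C) (hK : 0 < K)
    (hL : ∀ j, q ≤ j → Large C (K * 2 ^ (2 * j))) :
    P {ω | ¬ GoodFrom (twistedStep (X ω)) C K q} ≤
      ENNReal.ofReal ((K * 2 ^ (2 * q)) ^ (1 - C) / (1 - (4 : ℝ) ^ (1 - C))) := by
  have hb0 : 0 ≤ (4 : ℝ) ^ (1 - C) := by positivity
  have hb1 : (4 : ℝ) ^ (1 - C) < 1 := Real.rpow_lt_one_of_one_lt_of_neg (by norm_num) (by linarith)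
  have hpow : ∀ d : ℕ, (K * 2 ^ (2 * (q + d))) ^ (1 - C) =
      (K * 2 ^ (2 * q)) ^ (1 - C) * ((4 : ℝ) ^ (1 - C)) ^ d := by
    intro d
    rw [show K * 2 ^ (2 * (q + d)) = K * 2 ^ (2 * q) * (4 : ℝ) ^ d by
      rw [show (4 : ℝ) = 2 ^ 2 by norm_num, ← pow_mul]; ring,
      Real.mul_rpow (by positivity) (by positivity), ← Real.rpow_natCast 4 d,
      ← Real.rpow_mul (by norm_num), mul_comm (d : ℝ), Real.rpow_mul (by norm_num),
      Real.rpow_natCast]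
  calc P {ω | ¬ GoodFrom (twistedStep (X ω)) C K q}
      ≤ P (⋃ d : ℕ, {ω | ¬ Regular (twistedStep (X ω) (q + d + 1)) (6 * ⌊K * 2 ^ (2 * (q + d))⌋₊)
        (3 * C * Real.log (K * 2 ^ (2 * (q + d))))}) := by
        refine measure_mono fun ω hω => ?_
        by_contra hcon
        simp only [mem_iUnion, mem_ofPred_eq, not_exists, not_not] at hcon
        refine hω fun j hj => ⟨hL j hj, ?_⟩
        obtain ⟨d, rfl⟩ := Nat.exists_eq_add_of_le hj
        exact hcon d
    _ ≤ ∑' d : ℕ, P {ω | ¬ Regular (twistedStep (X ω) (q + d + 1)) (6 * ⌊K * 2 ^ (2 * (q + d))⌋₊)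
        (3 * C * Real.log (K * 2 ^ (2 * (q + d))))} := measure_iUnion_le _
    _ ≤ ∑' d : ℕ, ENNReal.ofReal ((K * 2 ^ (2 * q)) ^ (1 - C) * ((4 : ℝ) ^ (1 - C)) ^ d) := by
        refine ENNReal.tsum_le_tsum fun d => ?_
        have h := hL (q + d) (by omega)
        have h1 := h.log
        have h2 : 1 ≤ ⌊K * 2 ^ (2 * (q + d))⌋₊ := Nat.le_floor (by simpa using h.one_le)
        refine (hX.measure_not_regular_le _ (by omega) (by positivity)).trans ?_
        rw [← hpow]
        exact ENNReal.ofReal_le_ofReal h.measure_bound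
    _ = _ := by
        rw [← ENNReal.ofReal_tsum_of_nonneg (fun d => by positivity)
          ((summable_geometric_of_lt_one hb0 hb1).mul_left _), tsum_mul_left,
          tsum_geometric_of_lt_one hb0 hb1, div_eq_mul_inv]

lemma IsRademacherArray.ae_goodFrom : ∀ᵐ ω ∂P, ∀ K : ℕ, 0 < K →
    ∃ q, GoodFrom (twistedStep (X ω)) 2 K q := by
  refine ae_all_iff.2 fun K => ?_
  by_cases hK : 0 < K
  · obtain ⟨N₀, hN₀⟩ := exists_large (C := 2) (by norm_num)
    have hK' : (0 : ℝ) < K := by exact_mod_cast hK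
    have hN : Tendsto (fun q : ℕ => (K : ℝ) * 2 ^ (2 * q)) atTop atTop := by
      simp_rw [pow_mul]
      exact (tendsto_pow_atTop_atTop_of_one_lt (by norm_num)).const_mul_atTop hK'
    have h0 : P {ω | ∀ q, ¬ GoodFrom (twistedStep (X ω)) 2 K q} = 0 := by
      have h1 : Tendsto (fun q : ℕ => ENNReal.ofReal
          (((K : ℝ) * 2 ^ (2 * q)) ^ (1 - 2 : ℝ) / (1 - (4 : ℝ) ^ (1 - 2 : ℝ)))) atTop (𝓝 0) := by
        rw [← ENNReal.ofReal_zero]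
        refine ENNReal.tendsto_ofReal ?_
        have h2 := ((tendsto_rpow_neg_atTop (y := 1) (by norm_num)).comp hN).div_const
          (1 - (4 : ℝ) ^ (1 - 2 : ℝ))
        rw [zero_div] at h2
        refine h2.congr fun q => ?_
        simp only [Function.comp]
        norm_num
      refine le_antisymm (ge_of_tendsto h1 ?_) zero_le
      filter_upwards [hN.eventually_ge_atTop N₀] with q hq
      have hsub : {ω | ∀ q, ¬ GoodFrom (twistedStep (X ω)) 2 K q} ⊆
          {ω | ¬ GoodFrom (twistedStep (X ω)) 2 K q} := fun ω hω => hω q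
      refine (measure_mono hsub).trans
        (hX.measure_not_goodFrom_le (by norm_num) hK' fun j hj => hN₀ _ (hq.trans ?_))
      gcongr
      norm_num
    have h1 : ∀ᵐ ω ∂P, ¬ ∀ q, ¬ GoodFrom (twistedStep (X ω)) 2 K q := by
      rw [ae_iff]; simpa only [not_not] using h0
    filter_upwards [h1] with ω hω _
    simpa only [not_forall, not_not] using hω
  · exact Eventually.of_forall fun ω h => absurd h hK

end Array

/-! ### Convergence along a good path -/

/-- The pathwise properties from which the almost sure statements follow. -/
structure GoodPath (Y : ℕ → ℕ → ℤ) : Prop where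
  nested : Nested Y
  good : ∀ K : ℕ, 0 < K → ∃ q, GoodFrom Y 2 K q

lemma IsRademacherArray.ae_goodPath {Ω : Type*} [MeasurableSpace Ω] {P : Measure Ω}
    [IsProbabilityMeasure P] {X : Ω → ℕ → ℕ → ℤ} (hX : IsRademacherArray X P) :
    ∀ᵐ ω ∂P, GoodPath (twistedStep (X ω)) := by
  filter_upwards [hX.ae_coarse, hX.ae_goodFrom] with ω h1 h2 using ⟨h1, h2⟩

lemma exists_nat_gt_pos (K : ℝ) : ∃ n : ℕ, 0 < n ∧ K < n := by
  obtain ⟨n, hn⟩ := exists_nat_gt K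
  exact ⟨n + 1, by omega, by push_cast; linarith⟩

lemma tendsto_const_div_two_pow (a : ℝ) : Tendsto (fun j : ℕ => a / 2 ^ j) atTop (𝓝 0) :=
  tendsto_const_nhds.div_atTop (tendsto_pow_atTop_atTop_of_one_lt (by norm_num))

namespace GoodPath

variable {X : ℕ → ℕ → ℤ} (h : GoodPath (twistedStep X))
include h

lemma tendstoUniformlyOn_approxBM (K : ℝ) :
    TendstoUniformlyOn (approxBM X) (limitBM X) atTop (Icc 0 K) := by
  obtain ⟨n, hn, hKn⟩ := exists_nat_gt_pos K
  obtain ⟨q, hq⟩ := h.good n hn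
  refine TendstoUniformlyOn.mono (s := Icc 0 (n : ℝ)) ?_ (Icc_subset_Icc_right hKn.le)
  exact tendstoUniformlyOn_limUnder (c := 60 * 2) (by norm_num) (fluctAt_nonneg n)
    hq.tendsto_fluctAt fun j hj t ht => hq.abs_pathInterp_sub_le h.nested (by norm_num) hj ht

lemma tendstoOnStrips_localTime : TendstoOnStrips (localTime X) (brownianLocalTime X) := by
  intro K _
  obtain ⟨n, hn, hKn⟩ := exists_nat_gt_pos K
  obtain ⟨q, hq⟩ := h.good n hn
  refine TendstoUniformlyOn.mono (s := Icc 0 (n : ℝ) ×ˢ univ) ?_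
    (Set.prod_mono_left (Icc_subset_Icc_right hKn.le))
  exact tendstoUniformlyOn_limUnder (c := 60 * 2) (by norm_num) (fluctAt_nonneg n)
    hq.tendsto_fluctAt fun j hj p hp =>
      hq.abs_interpolate_visits_sub_le h.nested (by norm_num) hj hp.1 p.2

lemma continuousOn_limitBM : ContinuousOn (limitBM X) (Ici 0) := by
  intro t ht
  have hc : ContinuousOn (limitBM X) (Icc 0 (t + 1)) := by
    refine continuousOn_of_tendstoUniformlyOn (h.tendstoUniformlyOn_approxBM (t + 1)) ?_
    intro ε hε
    filter_upwards [(tendsto_const_div_two_pow 3).eventually_le_const hε] with j hj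
    refine ⟨1 / 2 ^ (2 * j), by positivity, fun a ha b hb hab => ?_⟩
    refine (abs_pathInterp_sub_of_near (h.nested j).1 j ha.1 hb.1 ?_).trans hj
    rw [Real.dist_eq, lt_div_iff₀ (by positivity)] at hab
    exact hab.le
  refine (hc t ⟨ht, by linarith⟩).mono_of_mem_nhdsWithin ?_
  rw [mem_nhdsWithin]
  exact ⟨Iio (t + 1), isOpen_Iio, by simp, fun s hs => ⟨hs.2, (mem_Iio.1 hs.1).le⟩⟩

lemma continuousOn_brownianLocalTime :
    ContinuousOn (fun p : ℝ × ℝ => brownianLocalTime X p.1 p.2) (Ici 0 ×ˢ univ) := by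
  rintro ⟨t, x⟩ ⟨ht, -⟩
  have ht : 0 ≤ t := ht
  obtain ⟨n, hn, hKn⟩ := exists_nat_gt_pos t
  obtain ⟨q, hq⟩ := h.good n hn
  have hc : ContinuousOn (fun p : ℝ × ℝ => brownianLocalTime X p.1 p.2) (Icc 0 (n : ℝ) ×ˢ univ) := by
    refine continuousOn_of_tendstoUniformlyOn
      (h.tendstoOnStrips_localTime n (by exact_mod_cast hn)) ?_
    intro ε hε
    have h1 : Tendsto (fun j : ℕ => 9 / 2 ^ (j + 1) + 6 * (3.3 * 2 * fluctAt n j)) atTop (𝓝 0) := by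
      have := ((tendsto_add_atTop_iff_nat 1).2 (tendsto_const_div_two_pow 9)).add
        ((hq.tendsto_fluctAt.const_mul (3.3 * 2)).const_mul 6)
      simpa using this
    rw [← Filter.map_add_atTop_eq_nat 1, eventually_map]
    filter_upwards [h1.eventually_le_const hε, eventually_ge_atTop q] with j hj hjq
    -- The time mesh, which is finer than the space mesh, so both coordinates are within one cell.
    refine ⟨1 / 2 ^ (2 * (j + 1)), by positivity, fun a ha b hb hab => ?_⟩
    rw [lt_div_iff₀ (by positivity)] at hab
    have h2 : |a.1 - b.1| ≤ dist a b := by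
      rw [← Real.dist_eq, Prod.dist_eq]; exact le_max_left _ _
    have h3 : |a.2 - b.2| ≤ dist a b := by
      rw [← Real.dist_eq, Prod.dist_eq]; exact le_max_right _ _
    refine (hq.abs_interpolate_visits_sub_of_near h.nested (by norm_num) hjq ha.1 hb.1 ?_ ?_).trans hj
    · exact (mul_le_mul_of_nonneg_right h2 (by positivity)).trans hab.le
    · refine (mul_le_mul h3 ?_ (by positivity) dist_nonneg).trans hab.le
      exact pow_le_pow_right₀ (by norm_num) (by omega)
  refine (hc (t, x) ⟨⟨ht, hKn.le⟩, mem_univ _⟩).mono_of_mem_nhdsWithin ?_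
  rw [mem_nhdsWithin]
  exact ⟨Iio (n : ℝ) ×ˢ univ, isOpen_Iio.prod isOpen_univ, ⟨hKn, mem_univ _⟩,
    fun s hs => ⟨⟨hs.2.1, (mem_Iio.1 hs.1.1).le⟩, mem_univ _⟩⟩

lemma tendstoOnStrips_of_up_or_down {F : ℕ → ℝ → ℝ → ℝ}
    (hF : ∀ (K : ℝ) (q j : ℕ), GoodFrom (twistedStep X) 2 K q → q ≤ j → ∀ t ∈ Icc 0 K, ∀ x,
      |1 / 2 * localTime X (j + 1) t x - F (j + 1) t x| ≤ 3.3 * fluctAt K j) :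
    TendstoOnStrips F fun t x => 1 / 2 * brownianLocalTime X t x := by
  intro K hK
  obtain ⟨n, hn, hKn⟩ := exists_nat_gt_pos K
  obtain ⟨q, hq⟩ := h.good n hn
  have h1 := h.tendstoOnStrips_localTime K hK
  rw [Metric.tendstoUniformlyOn_iff] at h1 ⊢
  intro ε hε
  have h2 : Tendsto (fun j => 3.3 * fluctAt n j) atTop (𝓝 0) := by
    simpa using hq.tendsto_fluctAt.const_mul 3.3
  have h3 := h1 ε hε
  rw [← Filter.map_add_atTop_eq_nat 1, eventually_map] at h3 ⊢
  filter_upwards [h3, h2.eventually_lt_const (half_pos hε), eventually_ge_atTop q] with j h4 h5 h6 p hp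
  have h7 := h4 p hp
  have h8 := hF n q j hq h6 p.1 ⟨hp.1.1, hp.1.2.trans hKn.le⟩ p.2
  rw [Real.dist_eq] at *
  rw [abs_lt] at *
  rw [abs_le] at h8
  constructor <;> linarith [h7.1, h7.2, h8.1, h8.2]

end GoodPath

/-- Up plus down is the full local time, so each differs from half of it by half of the imbalance:
`1.65 = 3.3 / 2`. -/
lemma abs_half_sub_up_le {X : ℕ → ℕ → ℤ} (hN : Nested (twistedStep X)) {C K : ℝ} (hC : 1 ≤ C)
    {q j : ℕ} (hg : GoodFrom (twistedStep X) C K q) (hj : q ≤ j) {t : ℝ} (ht : t ∈ Icc 0 K)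
    (x : ℝ) :
    |1 / 2 * localTime X (j + 1) t x - upLocalTime X (j + 1) t x| ≤ 1.65 * C * fluctAt K j ∧
    |1 / 2 * localTime X (j + 1) t x - downLocalTime X (j + 1) t x| ≤ 1.65 * C * fluctAt K j := by
  have h1 := hg.abs_interpolate_up_sub_down_le hN hC hj ht x
  have h2 := interpolate_up_add_down (hN (j + 1)).1 (j + 1) t x
  unfold localTime upLocalTime downLocalTime twistedWalk
  rw [← h2]
  simp only [abs_le] at *
  refine ⟨⟨?_, ?_⟩, ⟨?_, ?_⟩⟩ <;> linarith [h1.1, h1.2]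

lemma GoodPath.tendstoOnStrips_up {X : ℕ → ℕ → ℤ} (h : GoodPath (twistedStep X)) :
    TendstoOnStrips (upLocalTime X) fun t x => 1 / 2 * brownianLocalTime X t x :=
  h.tendstoOnStrips_of_up_or_down fun K q j hg hj t ht x => by
    have := (abs_half_sub_up_le h.nested (by norm_num) hg hj ht x).1
    norm_num at this ⊢
    exact this

lemma GoodPath.tendstoOnStrips_down {X : ℕ → ℕ → ℤ} (h : GoodPath (twistedStep X)) :
    TendstoOnStrips (downLocalTime X) fun t x => 1 / 2 * brownianLocalTime X t x :=
  h.tendstoOnStrips_of_up_or_down fun K q j hg hj t ht x => by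
    have := (abs_half_sub_up_le h.nested (by norm_num) hg hj ht x).2
    norm_num at this ⊢
    exact this

/-! ### The rate of convergence -/

lemma fluctAt_le {C K : ℝ} (hK : 0 < K) {m : ℕ} (hm : 1 ≤ m)
    (hL : Large C (K * 2 ^ (2 * m))) :
    fluctAt K m ≤ 2 * ((max 1 K) ^ (1 / 4 : ℝ) * (logStar K) ^ (3 / 4 : ℝ) *
      (m : ℝ) ^ (3 / 4 : ℝ) * (2 : ℝ) ^ (-(m : ℝ) / 2)) := by
  have hm' : (1 : ℝ) ≤ m := by exact_mod_cast hm
  have hS : 1 ≤ logStar K := le_max_left _ _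
  -- Since `1 + 2 * log 2 < 2.4`; below, `2.4 ^ 3 ≤ 2 ^ 4` turns this into the factor 2.
  have hlog : Real.log (K * 2 ^ (2 * m)) ≤ 2.4 * (logStar K * m) := by
    rw [Real.log_mul hK.ne' (by positivity), Real.log_pow]
    have h1 : Real.log K ≤ logStar K := le_max_right _ _
    have h2 := Real.log_two_lt_d9
    have h3 : logStar K ≤ logStar K * m := le_mul_of_one_le_right (by linarith) hm'
    have h4 : (m : ℝ) ≤ logStar K * m := le_mul_of_one_le_left (by linarith) hS
    push_cast
    nlinarith
  have hl := hL.log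
  set N := K * 2 ^ (2 * m) with hN
  set l := Real.log N
  have hN0 : 0 < N := by positivity
  have e1 : fluct N = N ^ (1 / 4 : ℝ) * l ^ (3 / 4 : ℝ) := by
    unfold fluct
    change √(l * √(N * l)) = _
    rw [Real.sqrt_eq_rpow, Real.sqrt_eq_rpow, Real.mul_rpow hN0.le (by linarith),
      Real.mul_rpow (by linarith) (by positivity), Real.mul_rpow (by positivity) (by positivity),
      ← Real.rpow_mul hN0.le, ← Real.rpow_mul (by linarith), mul_left_comm,
      ← Real.rpow_add (by linarith)]
    norm_num
  have e2 : N ^ (1 / 4 : ℝ) / 2 ^ m = K ^ (1 / 4 : ℝ) * (2 : ℝ) ^ (-(m : ℝ) / 2) := by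
    rw [hN, Real.mul_rpow hK.le (by positivity), ← Real.rpow_natCast 2 (2 * m),
      ← Real.rpow_mul (by norm_num), ← Real.rpow_natCast 2 m, mul_div_assoc,
      ← Real.rpow_sub (by norm_num)]
    congr 2
    push_cast
    ring
  have e3 : l ^ (3 / 4 : ℝ) ≤ 2 * ((logStar K) ^ (3 / 4 : ℝ) * (m : ℝ) ^ (3 / 4 : ℝ)) := by
    calc l ^ (3 / 4 : ℝ) ≤ (2.4 * (logStar K * m)) ^ (3 / 4 : ℝ) :=
          Real.rpow_le_rpow (by linarith) hlog (by norm_num)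
      _ = (2.4 : ℝ) ^ (3 / 4 : ℝ) * ((logStar K) ^ (3 / 4 : ℝ) * (m : ℝ) ^ (3 / 4 : ℝ)) := by
          rw [Real.mul_rpow (by norm_num) (by positivity), Real.mul_rpow (by linarith) (by linarith)]
      _ ≤ _ := by
          gcongr
          calc (2.4 : ℝ) ^ (3 / 4 : ℝ) = ((2.4 : ℝ) ^ (3 : ℝ)) ^ (1 / 4 : ℝ) := by
                rw [← Real.rpow_mul (by norm_num)]; norm_num
            _ ≤ ((2 : ℝ) ^ (4 : ℝ)) ^ (1 / 4 : ℝ) := by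
                apply Real.rpow_le_rpow (by positivity) _ (by norm_num)
                norm_num
            _ = 2 := by rw [← Real.rpow_mul (by norm_num)]; norm_num
  calc fluctAt K m = (N ^ (1 / 4 : ℝ) / 2 ^ m) * l ^ (3 / 4 : ℝ) := by
        unfold fluctAt; rw [← hN, e1]; ring
    _ = K ^ (1 / 4 : ℝ) * (2 : ℝ) ^ (-(m : ℝ) / 2) * l ^ (3 / 4 : ℝ) := by rw [e2]
    _ ≤ (max 1 K) ^ (1 / 4 : ℝ) * (2 : ℝ) ^ (-(m : ℝ) / 2) *
        (2 * ((logStar K) ^ (3 / 4 : ℝ) * (m : ℝ) ^ (3 / 4 : ℝ))) := by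
        gcongr
        exact le_max_right _ _
    _ = _ := by ring

/-- Half of the distance to the limit from level `m + 1` is `30 * (3 / 4) = 22.5`, and half of the
imbalance is 1.65. -/
lemma abs_half_brownianLocalTime_sub_le {X : ℕ → ℕ → ℤ} (hN : Nested (twistedStep X)) {C K : ℝ}
    (hC : 1 ≤ C) {m : ℕ} (hg : GoodFrom (twistedStep X) C K m) {t : ℝ} (ht : t ∈ Icc 0 K) (x : ℝ) :
    |1 / 2 * brownianLocalTime X t x - upLocalTime X (m + 1) t x| ≤ 24.15 * C * fluctAt K m ∧
    |1 / 2 * brownianLocalTime X t x - downLocalTime X (m + 1) t x| ≤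
      24.15 * C * fluctAt K m := by
  have h1 := abs_half_sub_up_le hN hC hg le_rfl ht x
  have h2 : |brownianLocalTime X t x - localTime X (m + 1) t x| ≤ 60 * C * fluctAt K (m + 1) :=
    abs_limUnder_sub_le (f := fun j => localTime X j t x) (q := m) (by positivity) (fluctAt_nonneg K)
      hg.tendsto_fluctAt (fun j hj => hg.abs_interpolate_visits_sub_le hN hC hj ht x) (Nat.le_succ m)
  have h3 := mul_le_mul_of_nonneg_left (fluctAt_succ_le (hg m le_rfl).1)
    (by positivity : 0 ≤ 60 * C)
  obtain ⟨h4, h5⟩ := h1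
  simp only [abs_le] at *
  refine ⟨⟨?_, ?_⟩, ⟨?_, ?_⟩⟩ <;> linarith [h2.1, h2.2, h4.1, h4.2, h5.1, h5.2]

lemma IsRademacherArray.measureReal_stripDist_le {Ω : Type*} [MeasurableSpace Ω] {P : Measure Ω}
    [IsProbabilityMeasure P] {X : Ω → ℕ → ℕ → ℤ} (hX : IsRademacherArray X P) {C K : ℝ} {m : ℕ}
    (hC : 1 < C) (hK : 0 < K) (hm : 1 ≤ m) (hL : ∀ j, m ≤ j → Large C (K * 2 ^ (2 * j)))
    {F : Ω → ℝ → ℝ → ℝ}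
    (hF : ∀ ω, Nested (twistedStep (X ω)) → GoodFrom (twistedStep (X ω)) C K m →
      ∀ t ∈ Icc 0 K, ∀ x, |1 / 2 * brownianLocalTime (X ω) t x - F ω t x| ≤
        24.15 * C * fluctAt K m) :
    P.real {ω | ENNReal.ofReal (50 * C * (max 1 K) ^ (1 / 4 : ℝ) *
        (logStar K) ^ (3 / 4 : ℝ) * (m : ℝ) ^ (3 / 4 : ℝ) * (2 : ℝ) ^ (-(m : ℝ) / 2)) ≤
      stripDist K (fun t x => 1 / 2 * brownianLocalTime (X ω) t x) (F ω)} ≤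
    30 / (1 - (4 : ℝ) ^ (1 - C)) * (K * 2 ^ (2 * m)) ^ (1 - C) := by
  have hb : (4 : ℝ) ^ (1 - C) < 1 := Real.rpow_lt_one_of_one_lt_of_neg (by norm_num) (by linarith)
  have hb' : 0 < 1 - (4 : ℝ) ^ (1 - C) := by linarith
  set B := (max 1 K) ^ (1 / 4 : ℝ) * (logStar K) ^ (3 / 4 : ℝ) *
      (m : ℝ) ^ (3 / 4 : ℝ) * (2 : ℝ) ^ (-(m : ℝ) / 2) with hB
  have hB0 : 0 < B := by
    have h1 : (0 : ℝ) < m := by exact_mod_cast hm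
    have h2 : 0 < logStar K := lt_of_lt_of_le one_pos (le_max_left _ _)
    positivity
  have h1 : P {ω | ENNReal.ofReal (50 * C * (max 1 K) ^ (1 / 4 : ℝ) *
        (logStar K) ^ (3 / 4 : ℝ) * (m : ℝ) ^ (3 / 4 : ℝ) * (2 : ℝ) ^ (-(m : ℝ) / 2)) ≤
      stripDist K (fun t x => 1 / 2 * brownianLocalTime (X ω) t x) (F ω)} ≤
      ENNReal.ofReal ((K * 2 ^ (2 * m)) ^ (1 - C) / (1 - (4 : ℝ) ^ (1 - C))) := by
    refine le_trans (measure_mono_ae ?_) (hX.measure_not_goodFrom_le hC hK hL)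
    filter_upwards [hX.ae_coarse] with ω hω hdist hgood
    -- `48.3 = 2 * 24.15` is strictly below 50 and `B` is positive, so on the good event the
    -- threshold is not reached.
    have h2 : stripDist K (fun t x => 1 / 2 * brownianLocalTime (X ω) t x) (F ω) ≤
        ENNReal.ofReal (48.3 * C * B) := by
      refine iSup₂_le fun t ht => iSup_le fun x => ENNReal.ofReal_le_ofReal ?_
      have h3 := hF ω hω hgood t ht x
      have h4 := mul_le_mul_of_nonneg_left (fluctAt_le hK hm (hL m le_rfl))
        (by positivity : 0 ≤ 24.15 * C)
      rw [← hB] at h4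
      linarith
    have h3 := le_trans hdist h2
    rw [ENNReal.ofReal_le_ofReal_iff (by positivity)] at h3
    have h4 : 0 < C * B := by positivity
    have h5 : 50 * C * (max 1 K) ^ (1 / 4 : ℝ) * (logStar K) ^ (3 / 4 : ℝ) *
        (m : ℝ) ^ (3 / 4 : ℝ) * (2 : ℝ) ^ (-(m : ℝ) / 2) = 50 * (C * B) := by rw [hB]; ring
    rw [h5] at h3
    linarith
  have h2 := ENNReal.toReal_mono ENNReal.ofReal_ne_top h1
  rw [ENNReal.toReal_ofReal (by positivity)] at h2
  refine h2.trans ?_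
  rw [div_mul_eq_mul_div]
  gcongr
  have : 0 ≤ (K * 2 ^ (2 * m)) ^ (1 - C) := by positivity
  linarith


/-! ### Occupation times and Lévy's formula -/

lemma interpolate_grid (m : ℕ) (ℓ : ℕ → ℤ → ℕ) (k : ℕ) (i : ℤ) :
    interpolate m ℓ (k / 2 ^ (2 * m)) (i / 2 ^ m) = ℓ k i / 2 ^ m := by
  have h1 : (k : ℝ) / 2 ^ (2 * m) * 2 ^ (2 * m) = k := by field_simp
  have h2 : (i : ℝ) / 2 ^ m * 2 ^ m = i := by field_simp
  simp [interpolate, h1, h2]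

/-- The times `s ≥ 0` at which the rescaled step path is in one of the steps of `J`. -/
def stepTimes (m : ℕ) (J : Finset ℕ) : Set ℝ := {s | 0 ≤ s ∧ ⌊s * 2 ^ (2 * m)⌋₊ ∈ J}

lemma volume_stepTimes (m : ℕ) (J : Finset ℕ) :
    volume (stepTimes m J) = ENNReal.ofReal (J.card / 2 ^ (2 * m)) := by
  have hp : (0 : ℝ) < 2 ^ (2 * m) := by positivity
  have h1 : stepTimes m J =
      ⋃ j ∈ J, Ico ((j : ℝ) / 2 ^ (2 * m)) ((j + 1 : ℝ) / 2 ^ (2 * m)) := by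
    ext s
    simp only [stepTimes, mem_ofPred_eq, mem_iUnion, exists_prop, mem_Ico, div_le_iff₀ hp,
      lt_div_iff₀ hp]
    constructor
    · rintro ⟨h0, h⟩
      exact ⟨_, h, Nat.floor_le (by positivity), Nat.lt_floor_add_one _⟩
    · rintro ⟨j, hj, h2, h3⟩
      have h0 : 0 ≤ s * 2 ^ (2 * m) := le_trans (by positivity) h2
      refine ⟨nonneg_of_mul_nonneg_left h0 hp, ?_⟩
      rwa [(Nat.floor_eq_iff h0).2 ⟨h2, h3⟩]
  rw [h1, measure_biUnion_finset]
  · simp_rw [Real.volume_Ico, ← sub_div, add_sub_cancel_left]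
    rw [Finset.sum_const, nsmul_eq_mul, ← ENNReal.ofReal_natCast,
      ← ENNReal.ofReal_mul (by positivity), mul_one_div]
  · intro i _ j _ hij
    refine Set.disjoint_left.2 fun s hs hs' => hij ?_
    rw [mem_Ico, div_le_iff₀ hp, lt_div_iff₀ hp] at hs hs'
    have h2 : (i : ℝ) < j + 1 := hs.1.trans_lt hs'.2
    have h3 : (j : ℝ) < i + 1 := hs'.1.trans_lt hs.2
    norm_cast at h2 h3
    omega
  · exact fun _ _ => measurableSet_Ico

/-- The steps before `k` at which the rescaled walk is closer to `x` than `a`. -/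
noncomputable def nearSteps (m : ℕ) (S : ℕ → ℤ) (k : ℕ) (x a : ℝ) : Finset ℕ :=
  (Finset.range k).filter fun j => |(S j : ℝ) / 2 ^ m - x| < a

/-- The steps near `x` are sorted by site: there are `2 * a * 2 ^ m` sites up to an error of 1, each
with nearly `2 ^ m * l` visits. -/
lemma abs_card_nearSteps_sub_le {m : ℕ} {S : ℕ → ℤ} {k : ℕ} {x a l η : ℝ} (ha : 0 ≤ a)
    (hη : 0 ≤ η) (h : ∀ i : ℤ, |(i : ℝ) / 2 ^ m - x| < a → |(visits S k i : ℝ) / 2 ^ m - l| ≤ η) :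
    |((nearSteps m S k x a).card : ℝ) / 2 ^ (2 * m) - 2 * a * l| ≤
      (2 * a + 1 / 2 ^ m) * η + 1 / 2 ^ m * |l| := by
  have hp : (0 : ℝ) < 2 ^ m := by positivity
  set A : ℝ := (x - a) * 2 ^ m
  set B : ℝ := (x + a) * 2 ^ m
  set I := Finset.Ioo ⌊A⌋ ⌈B⌉
  have hI : ∀ i : ℤ, i ∈ I ↔ |(i : ℝ) / 2 ^ m - x| < a := by
    intro i
    rw [Finset.mem_Ioo, Int.floor_lt, Int.lt_ceil, abs_lt, ← lt_div_iff₀ hp, ← div_lt_iff₀ hp]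
    constructor <;> rintro ⟨_, _⟩ <;> constructor <;> linarith
  have hcard : |(I.card : ℝ) / 2 ^ m - 2 * a| ≤ 1 / 2 ^ m := by
    have h1 : (I.card : ℤ) ≤ ⌈B⌉ - ⌊A⌋ - 1 ∨ I.card = 0 := by
      rw [Int.card_Ioo]; omega
    have h2 : ⌈B⌉ - ⌊A⌋ - 1 ≤ (I.card : ℤ) := by
      rw [Int.card_Ioo]; omega
    have h3 : B - A = 2 * a * 2 ^ m := by simp only [A, B]; ring
    have h4 : (⌈B⌉ : ℝ) - ⌊A⌋ - 1 ≤ I.card := by exact_mod_cast h2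
    have h5 := Int.le_ceil B
    have h6 := Int.ceil_lt_add_one B
    have h7 := Int.floor_le A
    have h8 := Int.lt_floor_add_one A
    have h0 : 0 ≤ 2 * a * 2 ^ m := by positivity
    rw [abs_le_div_iff_abs_mul_le hp, sub_mul, div_mul_cancel₀ _ hp.ne', abs_le]
    refine ⟨by linarith, ?_⟩
    rcases h1 with h1 | h1
    · have h9 : (I.card : ℝ) ≤ ⌈B⌉ - ⌊A⌋ - 1 := by exact_mod_cast h1
      linarith
    · rw [h1]; push_cast; linarith
  have hsum : ((nearSteps m S k x a).card : ℝ) / 2 ^ (2 * m) =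
      ∑ i ∈ I, (visits S k i : ℝ) / 2 ^ m / 2 ^ m := by
    have h1 : (nearSteps m S k x a).card = ∑ i ∈ I, visits S k i := by
      rw [Finset.card_eq_sum_card_fiberwise (f := S) (t := I)]
      · refine Finset.sum_congr rfl fun i hi => ?_
        rw [visits, nearSteps, Finset.filter_filter]
        congr 1
        refine Finset.filter_congr fun j _ => ?_
        constructor
        · exact fun h => h.2
        · exact fun h => ⟨by rw [h]; exact (hI i).1 hi, h⟩
      · intro j hj
        exact (hI _).2 (Finset.mem_filter.1 hj).2
    rw [h1, Finset.sum_congr rfl fun i _ => div_div _ _ _, ← Finset.sum_div]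
    push_cast
    rw [two_mul, pow_add]
  have h1 : |∑ i ∈ I, (visits S k i : ℝ) / 2 ^ m / 2 ^ m - (I.card : ℝ) / 2 ^ m * l| ≤
      (I.card : ℝ) / 2 ^ m * η := by
    have e1 : ∑ i ∈ I, (visits S k i : ℝ) / 2 ^ m / 2 ^ m - (I.card : ℝ) / 2 ^ m * l =
        ∑ i ∈ I, ((visits S k i : ℝ) / 2 ^ m - l) / 2 ^ m := by
      simp_rw [sub_div]
      rw [Finset.sum_sub_distrib, Finset.sum_const, nsmul_eq_mul]
      ring
    rw [e1]
    refine (Finset.abs_sum_le_sum_abs _ _).trans ?_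
    calc _ ≤ ∑ i ∈ I, η / 2 ^ m := Finset.sum_le_sum fun i hi => by
          rw [abs_div, abs_of_pos hp]
          exact div_le_div_of_nonneg_right (h i ((hI i).1 hi)) hp.le
      _ = _ := by rw [Finset.sum_const, nsmul_eq_mul]; ring
  rw [hsum]
  have hcard' := abs_le.1 hcard
  have h2 : (I.card : ℝ) / 2 ^ m * η ≤ (2 * a + 1 / 2 ^ m) * η := by
    apply mul_le_mul_of_nonneg_right _ hη
    linarith
  have h3 : |(I.card : ℝ) / 2 ^ m * l - 2 * a * l| ≤ 1 / 2 ^ m * |l| := by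
    rw [← sub_mul, abs_mul]
    exact mul_le_mul_of_nonneg_right hcard (abs_nonneg _)
  exact (abs_sub_le _ _ _).trans (add_le_add (h1.trans h2) h3)

/-- The time a path spends near `x`, in terms of a walk that is uniformly close to it. -/
lemma abs_volume_sub_le {m : ℕ} {S : ℕ → ℤ} {w : ℝ → ℝ} {t x ε δ l η : ℝ} (ht : 0 ≤ t)
    (hδ : 0 ≤ δ) (hδε : δ < ε) (hη : 0 ≤ η) (hm : 1 / 2 ^ m ≤ δ)
    (hw : ∀ s ∈ Icc 0 t, |w s - S ⌊s * 2 ^ (2 * m)⌋₊ / 2 ^ m| ≤ δ)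
    (h : ∀ i : ℤ, |(i : ℝ) / 2 ^ m - x| < ε + δ →
      |(visits S ⌊t * 2 ^ (2 * m)⌋₊ i : ℝ) / 2 ^ m - l| ≤ η) :
    |volume.real {s ∈ Icc 0 t | w s ∈ Ioo (x - ε) (x + ε)} - 2 * ε * l| ≤
      2 * ε * η + δ * (3 * |l| + 3 * η + 1) := by
  set k := ⌊t * 2 ^ (2 * m)⌋₊ with hk
  have hp : (0 : ℝ) < 2 ^ (2 * m) := by positivity
  set A := {s ∈ Icc 0 t | w s ∈ Ioo (x - ε) (x + ε)}
  have hmem : ∀ s, w s ∈ Ioo (x - ε) (x + ε) ↔ |w s - x| < ε := by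
    intro s
    rw [mem_Ioo, abs_lt]
    constructor <;> rintro ⟨_, _⟩ <;> constructor <;> linarith
  have hA : volume A ≠ ⊤ :=
    ((measure_mono (sep_subset _ _)).trans_lt (measure_Icc_lt_top)).ne
  have hreal : ∀ J : Finset ℕ, volume.real (stepTimes m J) = J.card / 2 ^ (2 * m) := fun J => by
    rw [measureReal_def, volume_stepTimes, ENNReal.toReal_ofReal (by positivity)]
  have hlow : ((nearSteps m S k x (ε - δ)).card : ℝ) / 2 ^ (2 * m) ≤ volume.real A := by
    rw [← hreal]
    refine measureReal_mono ?_ hA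
    rintro s ⟨hs0, hs⟩
    obtain ⟨h1, h2⟩ := Finset.mem_filter.1 hs
    have hst : s ≤ t := by
      have h3 : s * 2 ^ (2 * m) < k := (Nat.floor_lt (by positivity)).1 (Finset.mem_range.1 h1)
      exact le_of_mul_le_mul_right (h3.le.trans (Nat.floor_le (by positivity))) hp
    refine ⟨⟨hs0, hst⟩, (hmem s).2 ?_⟩
    have := abs_sub_le (w s) (S ⌊s * 2 ^ (2 * m)⌋₊ / 2 ^ m) x
    linarith [hw s ⟨hs0, hst⟩]
  have hupp : volume.real A ≤ ((nearSteps m S k x (ε + δ)).card : ℝ) / 2 ^ (2 * m) + δ := by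
    -- The incomplete last step `k` is not counted by `visits`; including it costs at most one time
    -- mesh, which is at most `δ`.
    have h1 : volume.real A ≤ volume.real (stepTimes m (insert k (nearSteps m S k x (ε + δ)))) := by
      refine measureReal_mono ?_ (by rw [volume_stepTimes]; exact ENNReal.ofReal_ne_top)
      rintro s ⟨⟨hs0, hst⟩, hs⟩
      refine ⟨hs0, ?_⟩
      have hle : ⌊s * 2 ^ (2 * m)⌋₊ ≤ k := Nat.floor_mono (by gcongr)
      rcases hle.eq_or_lt with h2 | h2
      · rw [h2]; exact Finset.mem_insert_self _ _
      · refine Finset.mem_insert_of_mem (Finset.mem_filter.2 ⟨Finset.mem_range.2 h2, ?_⟩)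
        have := abs_sub_le (S ⌊s * 2 ^ (2 * m)⌋₊ / 2 ^ m : ℝ) (w s) x
        rw [abs_sub_comm _ (w s)] at this
        linarith [hw s ⟨hs0, hst⟩, (hmem s).1 hs]
    rw [hreal] at h1
    have h2 : ((insert k (nearSteps m S k x (ε + δ))).card : ℝ) ≤
        (nearSteps m S k x (ε + δ)).card + 1 := by exact_mod_cast Finset.card_insert_le _ _
    have h3 : (1 : ℝ) / 2 ^ (2 * m) ≤ 1 / 2 ^ m := by
      gcongr
      · norm_num
      · omega
    have h4 := div_le_div_of_nonneg_right h2 hp.le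
    rw [add_div] at h4
    linarith
  have e1 := abs_le.1 (abs_card_nearSteps_sub_le (m := m) (S := S) (k := k) (x := x) (l := l)
    (a := ε - δ) (by linarith) hη fun i hi => h i (by linarith))
  have e2 := abs_le.1 (abs_card_nearSteps_sub_le (a := ε + δ) (by linarith) hη h)
  have f1 : 1 / 2 ^ m * |l| ≤ δ * |l| := mul_le_mul_of_nonneg_right hm (abs_nonneg _)
  have f2 : 1 / 2 ^ m * η ≤ δ * η := mul_le_mul_of_nonneg_right hm hη
  have f3 := abs_le.1 (abs_mul δ l ▸ (abs_of_nonneg hδ).symm ▸ le_refl (|δ| * |l|) :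
    |δ * l| ≤ δ * |l|)
  have f4 : 0 ≤ δ * η := by positivity
  rw [abs_le]
  constructor <;> nlinarith

lemma GoodPath.isLevyLocalTime {X : ℕ → ℕ → ℤ} (h : GoodPath (twistedStep X)) :
    IsLevyLocalTime (limitBM X) (brownianLocalTime X) := by
  intro t ht x
  set l := brownianLocalTime X t x with hl
  rw [Metric.tendsto_nhdsWithin_nhds]
  intro η' hη'
  obtain ⟨η, hη, hηη⟩ : ∃ η, 0 < η ∧ 2 * η < η' := ⟨η' / 3, by positivity, by linarith⟩
  have hc := Metric.continuousWithinAt_iff.1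
    (h.continuousOn_brownianLocalTime (t, x) ⟨ht, mem_univ x⟩) (η / 2) (by positivity)
  obtain ⟨ρ, hρ, hc⟩ := hc
  -- Sites within `ε + δ < 2 * ε < ρ` of `x` stay in the continuity neighbourhood.
  refine ⟨ρ / 2, by positivity, fun ε hε0 hε => ?_⟩
  have hε0 : 0 < ε := hε0
  rw [Real.dist_eq, sub_zero, abs_of_pos hε0] at hε
  set D := 3 * |l| + 3 * η + 1 with hD
  have hD0 : 0 < D := by positivity
  -- Balances the two error terms: their sum is `4 * ε * η`, and division by `2 * ε` leaves `2 * η <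
  -- η'`. The level `m` is chosen after `ε`.
  set δ := 2 * ε * η / D with hδ
  have hδ0 : 0 < δ := by positivity
  have hδD : δ * D = 2 * ε * η := div_mul_cancel₀ _ hD0.ne'
  have hδε : δ < ε := by
    rw [hδ, div_lt_iff₀ hD0]
    nlinarith [abs_nonneg l]
  have hunif := (Metric.tendstoUniformlyOn_iff.1 (h.tendstoUniformlyOn_approxBM t)) (δ / 2)
    (by positivity)
  have hloc := (Metric.tendstoUniformlyOn_iff.1
    (h.tendstoOnStrips_localTime (t + 1) (by linarith))) (η / 2) (by positivity)
  have hm1 := (tendsto_const_div_two_pow 1).eventually_le_const (half_pos hδ0)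
  have hm2 := (tendsto_const_div_two_pow 1).eventually_lt_const hρ
  obtain ⟨m, hunif, hloc, hm1, hm2⟩ := (hunif.and (hloc.and (hm1.and hm2))).exists
  have hp : (0 : ℝ) < 2 ^ (2 * m) := by positivity
  have key := abs_volume_sub_le (m := m) (S := twistedWalk X m) (w := limitBM X) (x := x) (l := l)
    ht hδ0.le hδε hη.le (by linarith) (fun s hs => ?_) (fun i hi => ?_)
  · rw [← hD, hδD] at key
    rw [Real.dist_eq]
    rw [show 1 / (2 * ε) * volume.real {s ∈ Icc 0 t | limitBM X s ∈ Ioo (x - ε) (x + ε)} - l =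
      (volume.real {s ∈ Icc 0 t | limitBM X s ∈ Ioo (x - ε) (x + ε)} - 2 * ε * l) / (2 * ε) by
        field_simp, abs_div, abs_of_pos (by positivity : 0 < 2 * ε), div_lt_iff₀ (by positivity)]
    nlinarith
  · have h1 := hunif s hs
    rw [Real.dist_eq] at h1
    have h2 := abs_pathInterp_sub_le (h.nested m).1 m hs.1
    have h3 := abs_sub_le (limitBM X s) (approxBM X m s)
      (twistedWalk X m ⌊s * 2 ^ (2 * m)⌋₊ / 2 ^ m)
    have h4 : |approxBM X m s - twistedWalk X m ⌊s * 2 ^ (2 * m)⌋₊ / 2 ^ m| ≤ 1 / 2 ^ m := h2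
    linarith
  · set k := ⌊t * 2 ^ (2 * m)⌋₊
    have hk1 : (k : ℝ) / 2 ^ (2 * m) ≤ t := by
      rw [div_le_iff₀ hp]; exact Nat.floor_le (by positivity)
    have hk2 : t - 1 / 2 ^ (2 * m) ≤ k / 2 ^ (2 * m) := by
      rw [sub_le_iff_le_add, ← add_div, le_div_iff₀ hp]
      exact (Nat.lt_floor_add_one _).le
    have hk3 : (1 : ℝ) / 2 ^ (2 * m) ≤ 1 / 2 ^ m := by
      gcongr
      · norm_num
      · omega
    have h1 := hloc (k / 2 ^ (2 * m), i / 2 ^ m) ⟨⟨by positivity, by simp only; linarith⟩, mem_univ _⟩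
    have h2 := hc (x := (k / 2 ^ (2 * m), i / 2 ^ m))
      ⟨mem_Ici.2 (by positivity : (0 : ℝ) ≤ k / 2 ^ (2 * m)), mem_univ _⟩ (by
      rw [Prod.dist_eq, max_lt_iff, Real.dist_eq, Real.dist_eq]
      refine ⟨?_, by simp only; linarith⟩
      rw [abs_lt]
      constructor <;> simp only <;> linarith)
    simp only [Real.dist_eq] at h1 h2
    rw [abs_sub_comm] at h1
    rw [show ((visits (twistedWalk X m) k i : ℕ) : ℝ) / 2 ^ m =
      localTime X m (k / 2 ^ (2 * m)) (i / 2 ^ m) from (interpolate_grid m _ k i).symm]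
    have h3 := abs_sub_le (localTime X m (k / 2 ^ (2 * m)) (i / 2 ^ m))
      (brownianLocalTime X (k / 2 ^ (2 * m)) (i / 2 ^ m)) l
    linarith


/-! ### Independence and characteristic functions -/

section Indep

variable {Ω : Type*} [MeasurableSpace Ω] {P : Measure Ω}

lemma charFun_map_toLp {n : ℕ} {D : Fin n → Ω → ℝ} (hD : ∀ i, AEMeasurable (D i) P)
    (t : EuclideanSpace ℝ (Fin n)) :
    charFun (P.map fun ω => WithLp.toLp 2 (D · ω)) t =
      charFun (P.map fun ω => ∑ i, t i * D i ω) 1 := by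
  rw [charFun_apply, charFun_apply, integral_map, integral_map]
  · refine integral_congr_ae (Eventually.of_forall fun ω => ?_)
    simp [PiLp.inner_apply]
  · fun_prop
  · fun_prop
  · exact (PiLp.continuous_toLp 2 _).measurable.comp_aemeasurable (aemeasurable_pi_lambda _ hD)
  · fun_prop

variable [IsProbabilityMeasure P]

/-- Sums of independent random variables over disjoint blocks of indices are independent. -/
lemma iIndepFun_sum_of_disjoint {ι : Type*} {f : ι → Ω → ℝ} (hf : iIndepFun f P)
    (hm : ∀ j, Measurable (f j)) {n : ℕ} {S : Fin n → Finset ι}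
    (hS : ∀ i j, ∀ a ∈ S i, a ∈ S j → i = j) :
    iIndepFun (fun i ω => ∑ j ∈ S i, f j ω) P := by
  rw [iIndepFun_iff_charFun_pi fun i => by fun_prop]
  intro t
  rw [charFun_map_toLp fun i => by fun_prop]
  have h1 : ∀ c : Fin n → ℝ, ∀ T : Finset (Σ _ : Fin n, ι), (∀ p ∈ T, p.2 ∈ S p.1) →
      charFun (P.map fun ω => ∑ p ∈ T, c p.1 * f p.2 ω) 1 =
        ∏ p ∈ T, charFun (P.map (f p.2)) (c p.1) := by
    intro c T hT
    have h2 : iIndepFun (T.restrict fun (p : Σ _ : Fin n, ι) ω => c p.1 * f p.2 ω) P := by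
      have hinj : Function.Injective fun p : T => p.1.2 := by
        rintro ⟨⟨i, a⟩, hp⟩ ⟨⟨j, b⟩, hq⟩ (hab : a = b)
        subst hab
        have : i = j := hS i j a (hT _ hp) (hT _ hq)
        subst this
        rfl
      exact (hf.precomp hinj).comp (fun p x => c p.1.1 * x) fun p => by fun_prop
    rw [h2.charFun_map_fun_finsetSum_eq_prod fun p _ => by fun_prop, Finset.prod_apply]
    refine Finset.prod_congr rfl fun p _ => ?_
    rw [charFun_map_mul_comp (hm _).aemeasurable, mul_one]
  have h2 := h1 t (Finset.univ.sigma S) fun p hp => (Finset.mem_sigma.1 hp).2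
  have h3 : ∀ ω, ∑ i, t i * ∑ j ∈ S i, f j ω =
      ∑ p ∈ Finset.univ.sigma S, t p.1 * f p.2 ω := fun ω => by
    simp_rw [Finset.mul_sum]
    rw [Finset.sum_sigma]
  simp_rw [h3]
  rw [h2, Finset.prod_sigma]
  refine Finset.prod_congr rfl fun i _ => ?_
  rw [(hf.precomp (Subtype.val_injective (p := (· ∈ S i)))).charFun_map_fun_finsetSum_eq_prod
    fun j _ => by fun_prop, Finset.prod_apply]

lemma tendsto_charFun_of_tendsto_ae {E : Type*} [NormedAddCommGroup E] [InnerProductSpace ℝ E]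
    [MeasurableSpace E] [BorelSpace E] [SecondCountableTopology E] {F : ℕ → Ω → E} {G : Ω → E}
    (hF : ∀ m, AEMeasurable (F m) P) (hG : AEMeasurable G P)
    (h : ∀ᵐ ω ∂P, Tendsto (fun m => F m ω) atTop (𝓝 (G ω))) (t : E) :
    Tendsto (fun m => charFun (P.map (F m)) t) atTop (𝓝 (charFun (P.map G) t)) := by
  have h1 : ∀ H : Ω → E, AEMeasurable H P →
      charFun (P.map H) t = ∫ ω, Complex.exp (inner ℝ (H ω) t * Complex.I) ∂P := fun H hH => by
    rw [charFun_apply, integral_map hH]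
    exact (by fun_prop : Continuous fun x : E =>
      Complex.exp (inner ℝ x t * Complex.I)).aestronglyMeasurable
  simp_rw [h1 _ (hF _), h1 _ hG]
  refine tendsto_integral_of_dominated_convergence (fun _ => 1) (fun m => ?_)
    (integrable_const _) (fun m => Eventually.of_forall fun ω => ?_) ?_
  · exact ((by fun_prop : Measurable fun x : E =>
      Complex.exp (inner ℝ x t * Complex.I)).comp_aemeasurable (hF m)).aestronglyMeasurable
  · rw [Complex.norm_exp_ofReal_mul_I]
  · filter_upwards [h] with ω hω
    exact ((by fun_prop : Continuous fun x : E =>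
      Complex.exp (inner ℝ x t * Complex.I)).tendsto _).comp hω

/-- Independence is factorisation of the joint characteristic function, which survives almost sure
limits by dominated convergence. -/
lemma iIndepFun_of_tendsto_ae {n : ℕ} {F : ℕ → Fin n → Ω → ℝ} {G : Fin n → Ω → ℝ}
    (hF : ∀ m i, AEMeasurable (F m i) P) (hG : ∀ i, AEMeasurable (G i) P)
    (h : ∀ i, ∀ᵐ ω ∂P, Tendsto (fun m => F m i ω) atTop (𝓝 (G i ω)))
    (hi : ∀ m, iIndepFun (F m) P) : iIndepFun G P := by
  rw [iIndepFun_iff_charFun_pi hG]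
  intro t
  refine tendsto_nhds_unique (f := fun m => charFun (P.map fun ω => WithLp.toLp 2 (F m · ω)) t)
    (l := atTop) ?_ ?_
  · refine tendsto_charFun_of_tendsto_ae
      (fun m => (PiLp.continuous_toLp 2 _).measurable.comp_aemeasurable
        (aemeasurable_pi_lambda _ (hF m)))
      ((PiLp.continuous_toLp 2 _).measurable.comp_aemeasurable (aemeasurable_pi_lambda _ hG)) ?_ t
    filter_upwards [ae_all_iff.2 h] with ω hω
    exact ((PiLp.continuous_toLp 2 _).tendsto _).comp (tendsto_pi_nhds.2 hω)
  · simp_rw [fun m => (iIndepFun_iff_charFun_pi (hF m)).1 (hi m) t]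
    exact tendsto_finsetProd _ fun i _ =>
      tendsto_charFun_of_tendsto_ae (fun m => hF m i) (hG i) (h i) (t i)

end Indep

lemma integral_coin {E : Type*} [NormedAddCommGroup E] [NormedSpace ℝ E] [CompleteSpace E]
    (f : ℤ → E) : ∫ a, f a ∂coin = (1 / 2 : ℝ) • f 1 + (1 / 2 : ℝ) • f (-1) := by
  have hi : ∀ b : ℤ, Integrable f ((1 / 2 : ℝ≥0∞) • Measure.dirac b) := fun b =>
    (integrable_dirac (by simp)).smul_measure (by simp)
  rw [coin, integral_add_measure (hi _) (hi _), integral_smul_measure, integral_smul_measure,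
    integral_dirac, integral_dirac]
  simp

lemma charFun_coin (s : ℝ) :
    charFun (coin.map fun a : ℤ => (a : ℝ)) s = Real.cos s := by
  rw [charFun_apply, integral_map (by fun_prop) (by fun_prop), integral_coin]
  simp [Complex.cos, Complex.real_smul]
  ring

/-- The characteristic functions of the rescaled walks converge to those of the normal law. -/
lemma tendsto_cos_pow {t : ℝ} (ht : 0 ≤ t) (c : ℝ) :
    Tendsto (fun m : ℕ => Real.cos (c / 2 ^ m) ^ ⌊t * 2 ^ (2 * m)⌋₊) atTop
      (𝓝 (Real.exp (-(c ^ 2 * t / 2)))) := by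
  have hn : Tendsto (fun n : ℕ => n * (Real.cos (c / √n) - 1)) atTop (𝓝 (-(c ^ 2 / 2))) := by
    have h1 : Tendsto (fun n : ℕ => c ^ 4 * (5 / 96) / (n : ℝ)) atTop (𝓝 0) :=
      tendsto_const_nhds.div_atTop tendsto_natCast_atTop_atTop
    rw [tendsto_iff_norm_sub_tendsto_zero]
    refine squeeze_zero' (Eventually.of_forall fun n => norm_nonneg _) ?_ h1
    filter_upwards [tendsto_natCast_atTop_atTop.eventually_ge_atTop (max 1 (c ^ 2))] with n hn
    have hn1 : (1 : ℝ) ≤ n := (le_max_left _ _).trans hn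
    have hn2 : c ^ 2 ≤ n := (le_max_right _ _).trans hn
    have hs : √(n : ℝ) ^ 2 = n := Real.sq_sqrt (by positivity)
    have hs0 : 0 < √(n : ℝ) := Real.sqrt_pos.2 (by linarith)
    have hu : |c / √n| ≤ 1 := by
      rw [← sq_le_one_iff_abs_le_one, div_pow, hs, div_le_one (by linarith)]
      exact hn2
    have hb := Real.cos_bound hu
    have h2 : (n : ℝ) * (Real.cos (c / √n) - 1) - -(c ^ 2 / 2) =
        n * (Real.cos (c / √n) - (1 - (c / √n) ^ 2 / 2)) := by
      rw [div_pow, hs]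
      field_simp
      ring
    rw [Real.norm_eq_abs, h2, abs_mul, abs_of_nonneg (by linarith : (0 : ℝ) ≤ n)]
    refine (mul_le_mul_of_nonneg_left hb (by linarith)).trans_eq ?_
    have h4 : |c / √n| ^ 4 = c ^ 4 / n ^ 2 := by
      rw [show |c / √n| ^ 4 = (|c / √n| ^ 2) ^ 2 by ring, sq_abs, div_pow, hs]
      ring
    rw [h4]
    field_simp
  have h4 : Tendsto (fun m : ℕ => 2 ^ (2 * m)) atTop (atTop : Filter ℕ) := by
    simp_rw [pow_mul]
    exact tendsto_pow_atTop_atTop_of_one_lt (by norm_num)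
  have h5 : Tendsto (fun m : ℕ => Real.cos (c / 2 ^ m) ^ (2 ^ (2 * m))) atTop
      (𝓝 (Real.exp (-(c ^ 2 / 2)))) := by
    refine ((Real.tendsto_one_add_pow_exp_of_tendsto hn).comp h4).congr fun m => ?_
    have h6 : √((2 : ℝ) ^ (2 * m)) = 2 ^ m := by
      rw [mul_comm, pow_mul, Real.sqrt_sq (by positivity)]
    simp [h6]
  have h6 : Tendsto (fun m : ℕ => (⌊t * 2 ^ (2 * m)⌋₊ : ℝ) / 2 ^ (2 * m)) atTop (𝓝 t) := by
    refine ((tendsto_nat_floor_mul_div_atTop ht).comp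
      (tendsto_natCast_atTop_atTop.comp h4)).congr fun m => ?_
    simp
  -- The power `⌊t * 4 ^ m⌋₊` is the `4 ^ m`-th power raised to a real exponent tending to `t`; the
  -- two agree once the cosine is positive.
  have h7 := h5.rpow h6 (Or.inl (Real.exp_pos _).ne')
  rw [← Real.exp_mul, show -(c ^ 2 / 2) * t = -(c ^ 2 * t / 2) by ring] at h7
  refine h7.congr' ?_
  have h8 : Tendsto (fun m : ℕ => Real.cos (c / 2 ^ m)) atTop (𝓝 1) := by
    rw [← Real.cos_zero]
    exact (Real.continuous_cos.tendsto 0).comp (tendsto_const_div_two_pow c)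
  filter_upwards [h8.eventually_const_lt zero_lt_one] with m hm
  rw [← Real.rpow_natCast _ (2 ^ (2 * m)), ← Real.rpow_mul hm.le,
    ← Real.rpow_natCast _ ⌊t * 2 ^ (2 * m)⌋₊, Nat.cast_pow, Nat.cast_ofNat,
    mul_div_cancel₀ _ (by positivity)]

/-! ### The limit path is a Brownian motion -/

section Array

variable {Ω : Type*} [MeasurableSpace Ω] {P : Measure Ω}
  {X : Ω → ℕ → ℕ → ℤ} (hX : IsRademacherArray X P)
include hX

lemma IsRademacherArray.measurable_twistedStep_apply (m j : ℕ) :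
    Measurable fun ω => (twistedStep (X ω) m j : ℝ) :=
  (measurable_of_countable (fun a : ℤ => (a : ℝ))).comp
    ((measurable_pi_apply j).comp (hX.measurable_twistedStep m))

lemma IsRademacherArray.measurable_twistedWalk_div (m n : ℕ) :
    Measurable fun ω => (twistedWalk (X ω) m n : ℝ) / 2 ^ m := by
  simp only [twistedWalk, walk, Int.cast_sum]
  exact (Finset.measurable_sum _ fun j _ => hX.measurable_twistedStep_apply m j).div_const _

variable [IsProbabilityMeasure P]

lemma IsRademacherArray.map_twistedStep_apply (m j : ℕ) :
    P.map (fun ω => (twistedStep (X ω) m j : ℝ)) = coin.map fun a : ℤ => (a : ℝ) := by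
  have h1 : P.map (fun ω => twistedStep (X ω) m j) = coin := by
    have h2 := (measurePreserving_eval_infinitePi (fun _ : ℕ => coin) j).comp
      (hX.measurePreserving_twistedStep m)
    exact h2.map_eq
  have h2 : Measurable fun ω => twistedStep (X ω) m j :=
    (measurable_pi_apply j).comp (hX.measurable_twistedStep m)
  rw [← h1, Measure.map_map (by fun_prop) h2]
  rfl

lemma IsRademacherArray.iIndepFun_twistedStep (m : ℕ) :
    iIndepFun (fun j ω => (twistedStep (X ω) m j : ℝ)) P := by
  have h1 : ∀ j, Measurable fun ω => twistedStep (X ω) m j := fun j =>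
    (measurable_pi_apply j).comp (hX.measurable_twistedStep m)
  have h2 : iIndepFun (fun j ω => twistedStep (X ω) m j) P := by
    rw [iIndepFun_iff_map_fun_eq_infinitePi_map h1]
    have h3 : ∀ j, P.map (fun ω => twistedStep (X ω) m j) = coin := fun j =>
      ((measurePreserving_eval_infinitePi (fun _ : ℕ => coin) j).comp
        (hX.measurePreserving_twistedStep m)).map_eq
    simp_rw [h3]
    exact (hX.measurePreserving_twistedStep m).map_eq
  exact h2.comp (fun _ a => (a : ℝ)) fun _ => by fun_prop

lemma IsRademacherArray.charFun_twistedWalk_div (m n : ℕ) (c : ℝ) :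
    charFun (P.map fun ω => (twistedWalk (X ω) m n : ℝ) / 2 ^ m) c =
      (Real.cos (c / 2 ^ m) ^ n : ℝ) := by
  have h1 := hX.measurable_twistedStep_apply m
  have h2 : (fun ω => (twistedWalk (X ω) m n : ℝ) / 2 ^ m) =
      fun ω => (2 ^ m : ℝ)⁻¹ * ∑ j ∈ Finset.range n, (twistedStep (X ω) m j : ℝ) := by
    ext ω
    simp only [twistedWalk, walk, Int.cast_sum]
    ring
  rw [h2, charFun_map_mul_comp (Finset.aemeasurable_fun_sum _ fun j _ => (h1 j).aemeasurable),
    ((hX.iIndepFun_twistedStep m).restrict _).charFun_map_fun_finsetSum_eq_prod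
      fun j _ => (h1 j).aemeasurable, Finset.prod_apply]
  simp_rw [hX.map_twistedStep_apply, charFun_coin]
  simp [div_eq_inv_mul]

lemma IsRademacherArray.ae_tendsto_twistedWalk_div :
    ∀ᵐ ω ∂P, ∀ t : ℝ, 0 ≤ t → Tendsto
      (fun m : ℕ => (twistedWalk (X ω) m ⌊t * 2 ^ (2 * m)⌋₊ : ℝ) / 2 ^ m) atTop
      (𝓝 (limitBM (X ω) t)) := by
  filter_upwards [hX.ae_goodPath] with ω h t ht
  have h1 := (h.tendstoUniformlyOn_approxBM t).tendsto_at ⟨ht, le_rfl⟩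
  have h2 : Tendsto (fun m : ℕ => approxBM (X ω) m t -
      (twistedWalk (X ω) m ⌊t * 2 ^ (2 * m)⌋₊ : ℝ) / 2 ^ m) atTop (𝓝 0) :=
    squeeze_zero_norm (fun m => abs_pathInterp_sub_le (h.nested m).1 m ht)
      (tendsto_const_div_two_pow 1)
  simpa using h1.sub h2

lemma IsRademacherArray.aemeasurable_limitBM (t : ℝ≥0) :
    AEMeasurable (fun ω => limitBM (X ω) t) P := by
  refine aemeasurable_of_tendsto_metrizable_ae atTop
    (fun m => (hX.measurable_twistedWalk_div m ⌊(t : ℝ) * 2 ^ (2 * m)⌋₊).aemeasurable) ?_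
  filter_upwards [hX.ae_tendsto_twistedWalk_div] with ω h using h t t.2

lemma IsRademacherArray.hasLaw_limitBM (t : ℝ≥0) :
    HasLaw (fun ω => limitBM (X ω) t) (gaussianReal 0 t) P := by
  have hm := hX.aemeasurable_limitBM t
  refine ⟨hm, ?_⟩
  have : IsProbabilityMeasure (P.map fun ω => limitBM (X ω) t) := Measure.isProbabilityMeasure_map hm
  refine Measure.ext_of_charFun (funext fun c => ?_)
  refine tendsto_nhds_unique (tendsto_charFun_of_tendsto_ae
    (fun m => (hX.measurable_twistedWalk_div m ⌊(t : ℝ) * 2 ^ (2 * m)⌋₊).aemeasurable) hm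
    (by filter_upwards [hX.ae_tendsto_twistedWalk_div] with ω h using h t t.2) c) ?_
  simp_rw [hX.charFun_twistedWalk_div]
  rw [charFun_gaussianReal]
  have h := (Complex.continuous_ofReal.tendsto _).comp (tendsto_cos_pow t.coe_nonneg c)
  rw [Complex.ofReal_exp] at h
  have e : (c : ℂ) * (0 : ℝ) * Complex.I - ((t : ℝ) : ℂ) * c ^ 2 / 2 =
      ((-(c ^ 2 * t / 2) : ℝ) : ℂ) := by
    push_cast
    ring
  rw [e]
  exact h

/-- At each level the increments between rounded times are sums over disjoint blocks of independent
steps. -/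
lemma IsRademacherArray.hasIndepIncrements_limitBM :
    HasIndepIncrements (fun (t : ℝ≥0) ω => limitBM (X ω) t) P := by
  intro n t ht
  have hW := fun m k => (hX.measurable_twistedWalk_div m k).aemeasurable (μ := P)
  refine iIndepFun_of_tendsto_ae (F := fun m i ω =>
    (twistedWalk (X ω) m ⌊(t i.succ : ℝ) * 2 ^ (2 * m)⌋₊ : ℝ) / 2 ^ m -
      (twistedWalk (X ω) m ⌊(t i.castSucc : ℝ) * 2 ^ (2 * m)⌋₊ : ℝ) / 2 ^ m)
    (fun m i => (hW m _).sub (hW m _))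
    (fun i => (hX.aemeasurable_limitBM _).sub (hX.aemeasurable_limitBM _)) (fun i => ?_)
    fun m => ?_
  · filter_upwards [hX.ae_tendsto_twistedWalk_div] with ω h
    exact (h _ (t i.succ).2).sub (h _ (t i.castSucc).2)
  · have hmono : ∀ i j, i ≤ j → ⌊(t i : ℝ) * 2 ^ (2 * m)⌋₊ ≤ ⌊(t j : ℝ) * 2 ^ (2 * m)⌋₊ :=
      fun i j hij => Nat.floor_mono (mul_le_mul_of_nonneg_right (by exact_mod_cast ht hij)
        (by positivity))
    have h1 := iIndepFun_sum_of_disjoint (hX.iIndepFun_twistedStep m)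
      (hX.measurable_twistedStep_apply m) (n := n)
      (S := fun i => Finset.Ico ⌊(t i.castSucc : ℝ) * 2 ^ (2 * m)⌋₊
        ⌊(t i.succ : ℝ) * 2 ^ (2 * m)⌋₊) (by
        have key : ∀ (i j : Fin n), i < j → ∀ a,
            a ∈ Finset.Ico ⌊(t i.castSucc : ℝ) * 2 ^ (2 * m)⌋₊ ⌊(t i.succ : ℝ) * 2 ^ (2 * m)⌋₊ →
            a ∉ Finset.Ico ⌊(t j.castSucc : ℝ) * 2 ^ (2 * m)⌋₊
              ⌊(t j.succ : ℝ) * 2 ^ (2 * m)⌋₊ := by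
          intro i j hij a ha hb
          have := hmono i.succ j.castSucc (Fin.succ_le_castSucc_iff.2 hij)
          rw [Finset.mem_Ico] at ha hb
          omega
        intro i j a hi hj
        rcases lt_trichotomy i j with h | h | h
        · exact absurd hj (key i j h a hi)
        · exact h
        · exact absurd hi (key j i h a hj))
    have h2 := h1.comp (fun _ x => x / 2 ^ m) fun _ => by fun_prop
    convert h2 using 1
    ext i ω
    simp only [Function.comp, twistedWalk, walk]
    rw [Finset.sum_Ico_eq_sub _ (hmono _ _ (Fin.castSucc_le_succ i))]
    push_cast
    ring

lemma IsRademacherArray.isBrownianReal_limitBM :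
    IsBrownianReal (fun (t : ℝ≥0) ω => limitBM (X ω) t) P where
  toIsPreBrownianReal :=
    HasIndepIncrements.isPreBrownianReal_of_hasLaw hX.hasLaw_limitBM hX.hasIndepIncrements_limitBM
  cont := by
    filter_upwards [hX.ae_goodPath] with ω h
    exact h.continuousOn_limitBM.comp_continuous NNReal.continuous_coe fun t => t.2

end Array

end TwistShrink

theorem theorem4 :
    ∃ N₇ : ℝ → ℝ,
      ∀ {Ω : Type*} [MeasurableSpace Ω] (P : Measure Ω) [IsProbabilityMeasure P]
        (X : Ω → ℕ → ℕ → ℤ), TwistShrink.IsRademacherArray X P →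
        -- the limit of the approximating walks is a Brownian motion `W`
        IsBrownianReal (fun (t : ℝ≥0) (ω : Ω) => TwistShrink.limitBM (X ω) t) P ∧
        (∀ᵐ ω ∂P, ∀ K : ℝ, 0 < K →
          TendstoUniformlyOn (TwistShrink.approxBM (X ω)) (TwistShrink.limitBM (X ω)) atTop
            (Icc 0 K)) ∧
        -- the limit of the local times of the walks is the jointly continuous local time of `W`
        (∀ᵐ ω ∂P,
          TwistShrink.TendstoOnStrips (TwistShrink.localTime (X ω))
            (TwistShrink.brownianLocalTime (X ω)) ∧
          ContinuousOn (fun p : ℝ × ℝ => TwistShrink.brownianLocalTime (X ω) p.1 p.2)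
            (Ici 0 ×ˢ univ) ∧
          TwistShrink.IsLevyLocalTime (TwistShrink.limitBM (X ω))
            (TwistShrink.brownianLocalTime (X ω))) ∧
        -- the one-sided local times converge to one half of the Brownian local time
        (∀ᵐ ω ∂P,
          TwistShrink.TendstoOnStrips (TwistShrink.upLocalTime (X ω))
            (fun t x => 1 / 2 * TwistShrink.brownianLocalTime (X ω) t x) ∧
          TwistShrink.TendstoOnStrips (TwistShrink.downLocalTime (X ω))
            (fun t x => 1 / 2 * TwistShrink.brownianLocalTime (X ω) t x)) ∧
        -- the rate of this convergence
        (∀ (C K : ℝ) (m : ℕ), 1 < C → 0 < K → 1 ≤ m → N₇ C ≤ K * 2 ^ (2 * m) →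
          P.real {ω |
              ENNReal.ofReal (50 * C * (max 1 K) ^ (1 / 4 : ℝ) *
                (TwistShrink.logStar K) ^ (3 / 4 : ℝ) * (m : ℝ) ^ (3 / 4 : ℝ) *
                (2 : ℝ) ^ (-(m : ℝ) / 2)) ≤
              TwistShrink.stripDist K
                (fun t x => 1 / 2 * TwistShrink.brownianLocalTime (X ω) t x)
                (TwistShrink.upLocalTime (X ω) (m + 1))} ≤
            30 / (1 - (4 : ℝ) ^ (1 - C)) * (K * 2 ^ (2 * m)) ^ (1 - C) ∧
          P.real {ω |
              ENNReal.ofReal (50 * C * (max 1 K) ^ (1 / 4 : ℝ) *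
                (TwistShrink.logStar K) ^ (3 / 4 : ℝ) * (m : ℝ) ^ (3 / 4 : ℝ) *
                (2 : ℝ) ^ (-(m : ℝ) / 2)) ≤
              TwistShrink.stripDist K
                (fun t x => 1 / 2 * TwistShrink.brownianLocalTime (X ω) t x)
                (TwistShrink.downLocalTime (X ω) (m + 1))} ≤
            30 / (1 - (4 : ℝ) ^ (1 - C)) * (K * 2 ^ (2 * m)) ^ (1 - C)) := by
  choose! N₇ hN₇ using fun (C : ℝ) (hC : 1 < C) => TwistShrink.exists_large hC
  refine ⟨N₇, ?_⟩
  intro Ω _ P _ X hX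
  refine ⟨hX.isBrownianReal_limitBM, ?_, ?_, ?_, ?_⟩
  · filter_upwards [hX.ae_goodPath] with ω h K _ using h.tendstoUniformlyOn_approxBM K
  · filter_upwards [hX.ae_goodPath] with ω h using
      ⟨h.tendstoOnStrips_localTime, h.continuousOn_brownianLocalTime, h.isLevyLocalTime⟩
  · filter_upwards [hX.ae_goodPath] with ω h using ⟨h.tendstoOnStrips_up, h.tendstoOnStrips_down⟩
  · intro C K m hC hK hm hN
    -- `N₇ C` is a threshold beyond which every `N` is large, so all finer levels qualify as well.
    have hL : ∀ j, m ≤ j → TwistShrink.Large C (K * 2 ^ (2 * j)) := fun j hj =>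
      hN₇ C hC _ (hN.trans (by gcongr; norm_num))
    exact ⟨hX.measureReal_stripDist_le hC hK hm hL fun ω hω hg t ht x =>
        (TwistShrink.abs_half_brownianLocalTime_sub_le hω hC.le hg ht x).1,
      hX.measureReal_stripDist_le hC hK hm hL fun ω hω hg t ht x =>
        (TwistShrink.abs_half_brownianLocalTime_sub_le hω hC.le hg ht x).2⟩
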